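/- **Polyhedra.** A *block and hole polyhedron* $\mathcal P$ is a drawing without crossings of a finite 3-connected simple graph on the oriented sphere, whose faces are partitioned into blocks, holes and surface faces, all surface faces being triangles (larger remaining faces have been triangulated on their vertices). The *swapped* polyhedron $\overline{\mathcal P}$ is obtained by interchanging blocks and holes. $\mathcal P$ is *separated* if no vertex lies on two holes. **Configurations.** A configuration assigns a point of $\mathbb R^3$ to every vertex; it is *generic* if all coordinates are algebraically independent over $\mathbb Q$. Points have homogeneous coordinates $(x_1,x_2,x_3,1)$, and $a\vee b\in\mathbb R^6$ denotes the vector of Plücker coordinates of the join of $a$ and $b$. A property holds *generically* if it holds at every generic configuration. **Statics.** For a graph $G$ with configuration $p$, a self-stress is a symmetric assignment of scalars $\lambda_{ij}$ to the edges with $\sum_j\lambda_{ij}\,p_i\vee p_j=0$ at each vertex $i$. $(G,p)$ is *independent* if its only self-stress is $0$. It is *statically rigid* if for all loads $L_i=(f_i,0)\vee p_i$ with $\sum_i L_i=0$ there are symmetric scalars $\lambda_{ij}$ on the edges with $L_i+\sum_j\lambda_{ij}\,p_i\vee p_j=0$ for all $i$. It is *isostatic* if it is independent and statically rigid. The graph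 $G_S(\mathcal P)$ consists of the vertices and edges of $\mathcal P$ and, for each block, any generically isostatic graph on the vertices of the block and finitely many added vertices that contains the boundary polygon of the block. Its configurations place the added vertices as well. **Motions.** The body and hinge structure $G^M(\mathcal P)$ at a configuration $p$ has as bodies the blocks and the surface faces and as hinges the edges $ij$ between two of them, on the line $p_i\vee p_j$. A motion assigns a vector $S^F\in\mathbb R^6$ to each body such that $S^F-S^{F'}$ is a multiple of $p_i\vee p_j$ across each hinge; the structure is *rigid* if in every motion all the $S^F$ are equal. **Gussets.** Let $u$ be a vertex that lies on a hole (respectively block) $H$ and also on another hole (respectively block), and let $u_-,u,u_+$ be consecutive on the boundary of $H$. A *gusset* at $(u,H)$ is a new vertex $v$ inside $H$ joined to $u_-,u,u_+$; the triangles $u_-uv$ and $uu_+v$ become surface faces, and the rest of $H$, with $v$ in place of $u$ on its boundary, replaces $H$. A *gusseting* of $\mathcal P$ is a polyhedron obtained from $\mathcal P$ by finitely many (possibly no) successive gussets. If $\mathcal Q$ is a gusseting of $\mathcal P$, then $\overline{\mathcal Q}$ is a gusseting of $\overline{\mathcal P}$. **Corollary 4.9.** Let $\mathcal P$ be a block and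 hole polyhedron. There is a gusseting $\mathcal Q$ of $\mathcal P$ such that $\mathcal Q$ and $\overline{\mathcal Q}$ are separated. For every choice of the graphs $G_S(\mathcal P)$ and $G_S(\overline{\mathcal P})$: 1. For every separated gusseting $\mathcal Q$ of $\mathcal P$ (in particular for $\mathcal Q=\mathcal P$ if $\mathcal P$ is separated), $G^M(\mathcal Q)$ is generically rigid if and only if $G_S(\overline{\mathcal P})$ is generically independent. 2. $G_S(\mathcal P)$ is generically isostatic if and only if the swapped polyhedron is generically isostatic. This holds in both of the following senses: $G_S(\mathcal P)$ is generically isostatic if and only if $G_S(\overline{\mathcal P})$ is; and, for every gusseting $\mathcal Q$ of $\mathcal P$ with $\overline{\mathcal Q}$ separated (in particular for $\mathcal Q=\mathcal P$ if $\overline{\mathcal P}$ is separated), $G_S(\mathcal P)$ is generically isostatic if and only if $G^M(\overline{\mathcal Q})$ is generically rigid and $G_S(\overline{\mathcal P})$ is generically independent. -/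

import Mathlib

universe u

/-! Spherical polyhedra -/

/-- `G` has at least four vertices and stays connected when at most two vertices are deleted. -/
def IsThreeConnected {V : Type*} [Fintype V] (G : SimpleGraph V) : Prop :=
  4 ≤ Fintype.card V ∧
    ∀ S : Finset V, S.card ≤ 2 → (G.induce {v : V | v ∉ S}).Connected

/-- The graph underlying a system of darts: `tail d` is the initial and `tail (rev d)` the
terminal vertex of the dart `d`. -/
def dartGraph {V D : Type*} (tail : D → V) (rev : Equiv.Perm D) : SimpleGraph V :=
  SimpleGraph.fromRel fun a b => ∃ d, tail d = a ∧ tail (rev d) = b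

/-- An abstract spherical polyhedron, i.e. a drawing without crossings of a `3`-connected simple
graph on the sphere, given by its rotation system. `D` is the set of darts (oriented edges), `rev`
reverses a dart, `next` is the successor of a dart on the boundary of the face to its left, and
`left d` is that face. The permutation `next * rev` turns around the initial vertex of a dart.
Faces are the orbits of `next`, vertices are the orbits of `next * rev`, and Euler's formula says
that the (connected, oriented) surface is the sphere. -/
structure SphericalPolyhedron : Type (u + 1) where
  V : Type u
  D : Type u
  F : Type u
  [fintypeV : Fintype V]
  [fintypeD : Fintype D]
  [fintypeF : Fintype F]
  rev : Equiv.Perm D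
  next : Equiv.Perm D
  tail : D → V
  left : D → F
  rev_rev : ∀ d, rev (rev d) = d
  tail_next : ∀ d, tail (next d) = tail (rev d)
  left_next : ∀ d, left (next d) = left d
  left_surjective : ∀ f, ∃ d, left d = f
  face_orbit : ∀ d e, left d = left e → next.SameCycle d e
  vertex_orbit : ∀ d e, tail d = tail e → (next * rev).SameCycle d e
  tail_rev_ne : ∀ d, tail (rev d) ≠ tail d
  dart_ext : ∀ d e, tail d = tail e → tail (rev d) = tail (rev e) → d = e
  threeConnected : IsThreeConnected (dartGraph tail rev)
  euler : 2 * Fintype.card V + 2 * Fintype.card F = Fintype.card D + 4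

attribute [instance] SphericalPolyhedron.fintypeV SphericalPolyhedron.fintypeD
  SphericalPolyhedron.fintypeF

namespace SphericalPolyhedron

/-- The graph of vertices and edges. -/
def graph (P : SphericalPolyhedron.{u}) : SimpleGraph P.V := dartGraph P.tail P.rev

/-- The vertices on the boundary of a face. -/
abbrev FaceVertex (P : SphericalPolyhedron.{u}) (f : P.F) : Type u :=
  {v : P.V // ∃ d, P.left d = f ∧ P.tail d = v}

noncomputable instance (P : SphericalPolyhedron.{u}) (f : P.F) : Fintype (P.FaceVertex f) :=
  Fintype.ofFinite _

lemma adj_of_dart {V D : Type*} {tail : D → V} {rev : Equiv.Perm D}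
    (h : ∀ d, tail (rev d) ≠ tail d) (d : D) : (dartGraph tail rev).Adj (tail d) (tail (rev d)) :=
  (SimpleGraph.fromRel_adj _ _ _).2 ⟨(h d).symm, Or.inl ⟨d, rfl, rfl⟩⟩

/-- No vertex has degree one. -/
lemma rot_ne (P : SphericalPolyhedron.{u}) (d : P.D) : P.next (P.rev d) ≠ d := by
  classical
  intro h
  have huniq : ∀ e, P.tail e = P.tail d → e = d := fun e he =>
    (Equiv.Perm.SameCycle.eq_of_left (P.vertex_orbit d e he.symm) (by simpa [Function.IsFixedPt] using h)).symm
  obtain ⟨hcard, hconn⟩ := P.threeConnected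
  have hc := hconn {P.tail (P.rev d)} (by simp)
  have : ∃ x : P.V, x ∉ ({P.tail d, P.tail (P.rev d)} : Finset P.V) := by
    by_contra hcon
    push Not at hcon
    have h1 : Finset.univ ⊆ ({P.tail d, P.tail (P.rev d)} : Finset P.V) := fun x _ => hcon x
    have h2 := Finset.card_le_card h1
    have h3 := Finset.card_le_two (a := P.tail d) (b := P.tail (P.rev d))
    rw [Finset.card_univ] at h2
    omega
  obtain ⟨x, hx⟩ := this
  simp only [Finset.mem_insert, Finset.mem_singleton, not_or] at hx
  have hpre := hc.preconnected ⟨P.tail d, by simpa using (P.tail_rev_ne d).symm⟩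
    ⟨x, by simpa using hx.2⟩
  obtain ⟨w⟩ := hpre
  cases w with
  | nil => exact hx.1 rfl
  | @cons _ y _ hadj _ =>
    rw [SimpleGraph.induce_adj] at hadj
    obtain ⟨-, ⟨e, he1, he2⟩ | ⟨e, he1, he2⟩⟩ := (SimpleGraph.fromRel_adj _ _ _).1 hadj
    · have := huniq e he1
      subst this
      exact y.2 (by simp [he2])
    · have := huniq (P.rev e) he2
      have h3 : P.tail (P.rev d) = P.tail e := by rw [← this, P.rev_rev]
      exact y.2 (by simp [h3, he1])

lemma next_ne (P : SphericalPolyhedron.{u}) (d : P.D) : P.next d ≠ d := fun h =>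
  P.tail_rev_ne d (by rw [← P.tail_next, h])

/-- No face is a digon. -/
lemma tail_rev_next_ne (P : SphericalPolyhedron.{u}) (d : P.D) :
    P.tail (P.rev (P.next d)) ≠ P.tail d := by
  intro h
  have h1 : P.next d = P.rev d := P.dart_ext _ _ (P.tail_next d) (by rw [h, P.rev_rev])
  apply P.rot_ne (P.rev d)
  rw [P.rev_rev, h1]

lemma next_next_ne (P : SphericalPolyhedron.{u}) (d : P.D) : P.next (P.next d) ≠ d := fun h =>
  P.tail_rev_next_ne d (by rw [← P.tail_next, h])

section Gusset

/-! The gusset at a corner. Let `c` be a dart with initial vertex `u` and terminal vertex `u₊`, let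
`b` be the preceding dart on the boundary of the face `H = left c`, so that `b` runs from `u₋` to
`u`. A new vertex `v = none` is placed in `H` and joined to `u₋`, `u` and `u₊`; the new triangles
`(u₋, u, v)` and `(u, u₊, v)` are the faces `Sum.inr 0` and `Sum.inr 1`, and the rest of `H` is
kept as the face `H`, with `v` in place of `u`. The new darts are, in the order of `Fin 6`,
`u → v`, `v → u`, `u₋ → v`, `v → u₋`, `v → u₊`, `u₊ → v`. -/

variable (P : SphericalPolyhedron.{u}) (c : P.D)

def gussetTail : P.D ⊕ Fin 6 → Option P.V
  | Sum.inl d => some (P.tail d)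
  | Sum.inr 0 => some (P.tail c)
  | Sum.inr 1 => none
  | Sum.inr 2 => some (P.tail (P.next.symm c))
  | Sum.inr 3 => none
  | Sum.inr 4 => none
  | Sum.inr 5 => some (P.tail (P.rev c))

def gussetRevFun : P.D ⊕ Fin 6 → P.D ⊕ Fin 6
  | Sum.inl d => Sum.inl (P.rev d)
  | Sum.inr 0 => Sum.inr 1
  | Sum.inr 1 => Sum.inr 0
  | Sum.inr 2 => Sum.inr 3
  | Sum.inr 3 => Sum.inr 2
  | Sum.inr 4 => Sum.inr 5
  | Sum.inr 5 => Sum.inr 4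

lemma gussetRevFun_invol (x : P.D ⊕ Fin 6) : P.gussetRevFun (P.gussetRevFun x) = x := by
  rcases x with d | i
  · simp [gussetRevFun, P.rev_rev]
  · fin_cases i <;> rfl

def gussetRev : Equiv.Perm (P.D ⊕ Fin 6) where
  toFun := P.gussetRevFun
  invFun := P.gussetRevFun
  left_inv := P.gussetRevFun_invol
  right_inv := P.gussetRevFun_invol

open Classical in
noncomputable def gussetLeft : P.D ⊕ Fin 6 → P.F ⊕ Fin 2
  | Sum.inl d =>
      if d = P.next.symm c then Sum.inr 0 else if d = c then Sum.inr 1 else Sum.inl (P.left d)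
  | Sum.inr 0 => Sum.inr 0
  | Sum.inr 1 => Sum.inr 1
  | Sum.inr 2 => Sum.inl (P.left c)
  | Sum.inr 3 => Sum.inr 0
  | Sum.inr 4 => Sum.inl (P.left c)
  | Sum.inr 5 => Sum.inr 1

open Classical in
noncomputable def gussetNextFun : P.D ⊕ Fin 6 → P.D ⊕ Fin 6
  | Sum.inl d =>
      if d = P.next.symm c then Sum.inr 0
      else if d = c then Sum.inr 5
      else if P.next d = P.next.symm c then Sum.inr 2
      else Sum.inl (P.next d)
  | Sum.inr 0 => Sum.inr 3
  | Sum.inr 1 => Sum.inl c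
  | Sum.inr 2 => Sum.inr 4
  | Sum.inr 3 => Sum.inl (P.next.symm c)
  | Sum.inr 4 => Sum.inl (P.next c)
  | Sum.inr 5 => Sum.inr 1

lemma symm_ne : P.next.symm c ≠ c := fun h =>
  P.next_ne c (by rw [← h, Equiv.apply_symm_apply, h])

lemma next_ne_symm : P.next c ≠ P.next.symm c := fun h =>
  P.next_next_ne c (by rw [h, Equiv.apply_symm_apply])

lemma gussetNextFun_symm : P.gussetNextFun c (Sum.inl (P.next.symm c)) = Sum.inr 0 := by
  simp [gussetNextFun]

lemma gussetNextFun_self : P.gussetNextFun c (Sum.inl c) = Sum.inr 5 := by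
  simp [gussetNextFun, (P.symm_ne c).symm]

lemma gussetNextFun_pred {d : P.D} (hd : P.next d = P.next.symm c) :
    P.gussetNextFun c (Sum.inl d) = Sum.inr 2 := by
  have h1 : d ≠ P.next.symm c := fun h => P.next_ne d (by rw [hd, h])
  have h2 : d ≠ c := fun h => P.next_ne_symm c (by rw [← hd, h])
  simp only [gussetNextFun, if_neg h1, if_neg h2, if_pos hd]

lemma gussetNextFun_of_ne {d : P.D} (h1 : d ≠ P.next.symm c) (h2 : d ≠ c)
    (h3 : P.next d ≠ P.next.symm c) :
    P.gussetNextFun c (Sum.inl d) = Sum.inl (P.next d) := by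
  simp only [gussetNextFun, if_neg h1, if_neg h2, if_neg h3]

lemma gussetNextFun_surjective : Function.Surjective (P.gussetNextFun c) := by
  rintro (d | i)
  · by_cases h1 : d = c
    · exact ⟨Sum.inr 1, by rw [h1]; rfl⟩
    by_cases h2 : d = P.next.symm c
    · exact ⟨Sum.inr 3, by rw [h2]; rfl⟩
    by_cases h3 : d = P.next c
    · exact ⟨Sum.inr 4, by rw [h3]; rfl⟩
    refine ⟨Sum.inl (P.next.symm d), ?_⟩
    rw [gussetNextFun_of_ne]
    · simp
    · simpa using h1
    · exact fun h => h3 (by rw [← h, Equiv.apply_symm_apply])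
    · simpa using h2
  · fin_cases i
    · exact ⟨_, P.gussetNextFun_symm c⟩
    · exact ⟨Sum.inr 5, rfl⟩
    · exact ⟨_, P.gussetNextFun_pred c (d := P.next.symm (P.next.symm c)) (by simp)⟩
    · exact ⟨Sum.inr 0, rfl⟩
    · exact ⟨Sum.inr 2, rfl⟩
    · exact ⟨_, P.gussetNextFun_self c⟩

noncomputable def gussetNext : Equiv.Perm (P.D ⊕ Fin 6) :=
  Equiv.ofBijective (P.gussetNextFun c)
    (Finite.surjective_iff_bijective.1 (P.gussetNextFun_surjective c))

lemma gussetNext_apply (x : P.D ⊕ Fin 6) : P.gussetNext c x = P.gussetNextFun c x := rfl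

lemma gussetRev_apply (x : P.D ⊕ Fin 6) : P.gussetRev x = P.gussetRevFun x := rfl

lemma tail_self : P.tail c = P.tail (P.rev (P.next.symm c)) := by
  rw [← P.tail_next, Equiv.apply_symm_apply]

lemma left_symm : P.left (P.next.symm c) = P.left c := by
  rw [← P.left_next, Equiv.apply_symm_apply]

lemma tail_symm_ne : P.tail (P.next.symm c) ≠ P.tail c := by
  rw [P.tail_self c]
  exact (P.tail_rev_ne _).symm

lemma tail_rev_ne_tail_symm : P.tail (P.rev c) ≠ P.tail (P.next.symm c) := by
  have := P.tail_rev_next_ne (P.next.symm c)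
  rwa [Equiv.apply_symm_apply] at this

lemma gusset_tail_next (x : P.D ⊕ Fin 6) :
    P.gussetTail c (P.gussetNext c x) = P.gussetTail c (P.gussetRev x) := by
  rw [gussetNext_apply, gussetRev_apply]
  rcases x with d | i
  · by_cases h1 : d = P.next.symm c
    · subst h1
      rw [gussetNextFun_symm]
      exact congrArg some (P.tail_self c)
    by_cases h2 : d = c
    · subst h2
      rw [gussetNextFun_self]
      rfl
    by_cases h3 : P.next d = P.next.symm c
    · rw [gussetNextFun_pred P c h3]
      exact congrArg some (by rw [← h3, P.tail_next])
    · rw [gussetNextFun_of_ne P c h1 h2 h3]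
      exact congrArg some (P.tail_next d)
  · fin_cases i <;> first | rfl | exact congrArg some (P.tail_next c)

lemma gussetLeft_symm : P.gussetLeft c (Sum.inl (P.next.symm c)) = Sum.inr 0 := by
  simp [gussetLeft]

lemma gussetLeft_self : P.gussetLeft c (Sum.inl c) = Sum.inr 1 := by
  simp [gussetLeft, (P.symm_ne c).symm]

lemma gussetLeft_of_ne {d : P.D} (h1 : d ≠ P.next.symm c) (h2 : d ≠ c) :
    P.gussetLeft c (Sum.inl d) = Sum.inl (P.left d) := by
  simp only [gussetLeft, if_neg h1, if_neg h2]

lemma gusset_left_next (x : P.D ⊕ Fin 6) :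
    P.gussetLeft c (P.gussetNext c x) = P.gussetLeft c x := by
  rw [gussetNext_apply]
  rcases x with d | i
  · by_cases h1 : d = P.next.symm c
    · subst h1
      rw [gussetNextFun_symm, gussetLeft_symm]
      rfl
    by_cases h2 : d = c
    · subst h2
      rw [gussetNextFun_self, gussetLeft_self]
      rfl
    by_cases h3 : P.next d = P.next.symm c
    · rw [gussetNextFun_pred P c h3, gussetLeft_of_ne P c h1 h2]
      exact congrArg Sum.inl (by rw [← P.left_next d, h3, left_symm])
    · rw [gussetNextFun_of_ne P c h1 h2 h3, gussetLeft_of_ne P c h1 h2,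
        gussetLeft_of_ne P c h3 (fun h => h1 (by rw [← h, Equiv.symm_apply_apply])), P.left_next]
  · fin_cases i
    · rfl
    · exact P.gussetLeft_self c
    · rfl
    · exact P.gussetLeft_symm c
    · exact (P.gussetLeft_of_ne c (P.next_ne_symm c) (P.next_ne c)).trans
        (congrArg Sum.inl (P.left_next c))
    · rfl

open Classical in
/-- The dart that replaces `d` on the boundary of its face. -/
noncomputable def gussetRepl (d : P.D) : P.D ⊕ Fin 6 :=
  if d = P.next.symm c then Sum.inr 2 else if d = c then Sum.inr 4 else Sum.inl d

lemma sameCycle_of_apply {α : Type*} {f : Equiv.Perm α} {x y : α} (h : f x = y) :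
    f.SameCycle x y := ⟨1, by simpa using h⟩

lemma sameCycle_lift {α β : Type*} [Finite α] {f : Equiv.Perm α} {g : Equiv.Perm β} (r : α → β)
    (h : ∀ a, g.SameCycle (r a) (r (f a))) {x y : α} (hxy : f.SameCycle x y) :
    g.SameCycle (r x) (r y) := by
  obtain ⟨n, hn⟩ := hxy.exists_nat_pow_eq
  rw [← hn]
  clear hn
  induction n with
  | zero => exact Equiv.Perm.SameCycle.refl _ _
  | succ k ih =>
    rw [pow_succ', Equiv.Perm.mul_apply]
    exact ih.trans (h _)

lemma gussetRepl_symm : P.gussetRepl c (P.next.symm c) = Sum.inr 2 := by simp [gussetRepl]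

lemma gussetRepl_self : P.gussetRepl c c = Sum.inr 4 := by
  simp [gussetRepl, (P.symm_ne c).symm]

lemma gussetRepl_of_ne {d : P.D} (h1 : d ≠ P.next.symm c) (h2 : d ≠ c) :
    P.gussetRepl c d = Sum.inl d := by
  simp only [gussetRepl, if_neg h1, if_neg h2]

lemma gussetRepl_next (d : P.D) :
    (P.gussetNext c).SameCycle (P.gussetRepl c d) (P.gussetRepl c (P.next d)) := by
  apply sameCycle_of_apply
  rw [gussetNext_apply]
  by_cases h1 : d = P.next.symm c
  · subst h1
    rw [gussetRepl_symm, Equiv.apply_symm_apply, gussetRepl_self]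
    rfl
  by_cases h2 : d = c
  · subst h2
    rw [gussetRepl_self, gussetRepl_of_ne P d (P.next_ne_symm d) (P.next_ne d)]
    rfl
  rw [gussetRepl_of_ne P c h1 h2]
  by_cases h3 : P.next d = P.next.symm c
  · rw [gussetNextFun_pred P c h3, h3, gussetRepl_symm]
  · rw [gussetNextFun_of_ne P c h1 h2 h3,
      gussetRepl_of_ne P c h3 (fun h => h1 (by rw [← h, Equiv.symm_apply_apply]))]

lemma gusset_face_cases (x : P.D ⊕ Fin 6) :
    (P.gussetLeft c x = Sum.inr 0 ∧ (P.gussetNext c).SameCycle (Sum.inr 0) x) ∨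
    (P.gussetLeft c x = Sum.inr 1 ∧ (P.gussetNext c).SameCycle (Sum.inr 1) x) ∨
    ∃ d, P.gussetRepl c d = x ∧ P.gussetLeft c x = Sum.inl (P.left d) := by
  have h03 : (P.gussetNext c).SameCycle (Sum.inr 0) (Sum.inr 3) := sameCycle_of_apply rfl
  have h51 : (P.gussetNext c).SameCycle (Sum.inr 5) (Sum.inr 1) := sameCycle_of_apply rfl
  rcases x with d | i
  · by_cases h1 : d = P.next.symm c
    · subst h1
      exact Or.inl ⟨P.gussetLeft_symm c, h03.trans (sameCycle_of_apply rfl)⟩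
    by_cases h2 : d = c
    · subst h2
      exact Or.inr (Or.inl ⟨P.gussetLeft_self d, sameCycle_of_apply rfl⟩)
    · exact Or.inr (Or.inr ⟨d, P.gussetRepl_of_ne c h1 h2, P.gussetLeft_of_ne c h1 h2⟩)
  · fin_cases i
    · exact Or.inl ⟨rfl, Equiv.Perm.SameCycle.refl _ _⟩
    · exact Or.inr (Or.inl ⟨rfl, Equiv.Perm.SameCycle.refl _ _⟩)
    · exact Or.inr (Or.inr ⟨_, P.gussetRepl_symm c, congrArg Sum.inl (P.left_symm c).symm⟩)
    · exact Or.inl ⟨rfl, h03⟩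
    · exact Or.inr (Or.inr ⟨_, P.gussetRepl_self c, rfl⟩)
    · exact Or.inr (Or.inl ⟨rfl, h51.symm⟩)

lemma gusset_face_orbit (x y : P.D ⊕ Fin 6) (h : P.gussetLeft c x = P.gussetLeft c y) :
    (P.gussetNext c).SameCycle x y := by
  rcases P.gusset_face_cases c x with ⟨hx, hx'⟩ | ⟨hx, hx'⟩ | ⟨d, rfl, hx⟩ <;>
  rcases P.gusset_face_cases c y with ⟨hy, hy'⟩ | ⟨hy, hy'⟩ | ⟨e, rfl, hy⟩ <;>
  rw [hx, hy] at h
  · exact hx'.symm.trans hy'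
  · simp at h
  · simp at h
  · simp at h
  · exact hx'.symm.trans hy'
  · simp at h
  · simp at h
  · simp at h
  · exact sameCycle_lift _ (P.gussetRepl_next c) (P.face_orbit d e (Sum.inl_injective h))

lemma gusset_rot_inl (d : P.D) :
    (P.gussetNext c * P.gussetRev).SameCycle (Sum.inl d) (Sum.inl ((P.next * P.rev) d)) := by
  have hs : ∀ d, (P.gussetNext c * P.gussetRev) (Sum.inl d) =
    P.gussetNextFun c (Sum.inl (P.rev d)) := fun _ => rfl
  rw [Equiv.Perm.mul_apply]
  by_cases h1 : P.rev d = P.next.symm c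
  · refine (sameCycle_of_apply ((hs d).trans (by rw [h1, gussetNextFun_symm]))).trans
      (sameCycle_of_apply ?_)
    rw [h1, Equiv.apply_symm_apply]
    rfl
  by_cases h2 : P.rev d = c
  · refine (sameCycle_of_apply ((hs d).trans (by rw [h2, gussetNextFun_self]))).trans
      (sameCycle_of_apply ?_)
    rw [h2]
    rfl
  by_cases h3 : P.next (P.rev d) = P.next.symm c
  · refine (sameCycle_of_apply ((hs d).trans (by rw [gussetNextFun_pred P c h3]))).trans
      (sameCycle_of_apply ?_)
    rw [h3]
    rfl
  · exact sameCycle_of_apply ((hs d).trans (P.gussetNextFun_of_ne c h1 h2 h3))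

lemma gusset_vertex_cases (x : P.D ⊕ Fin 6) :
    (P.gussetTail c x = none ∧ (P.gussetNext c * P.gussetRev).SameCycle (Sum.inr 1) x) ∨
    ∃ d, P.gussetTail c x = some (P.tail d) ∧
      (P.gussetNext c * P.gussetRev).SameCycle x (Sum.inl d) := by
  have h13 : (P.gussetNext c * P.gussetRev).SameCycle (Sum.inr 1) (Sum.inr 3) :=
    sameCycle_of_apply rfl
  have h34 : (P.gussetNext c * P.gussetRev).SameCycle (Sum.inr 3) (Sum.inr 4) :=
    sameCycle_of_apply rfl
  rcases x with d | i
  · exact Or.inr ⟨d, rfl, Equiv.Perm.SameCycle.refl _ _⟩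
  · fin_cases i
    · exact Or.inr ⟨c, rfl, sameCycle_of_apply rfl⟩
    · exact Or.inl ⟨rfl, Equiv.Perm.SameCycle.refl _ _⟩
    · exact Or.inr ⟨P.next.symm c, rfl, sameCycle_of_apply rfl⟩
    · exact Or.inl ⟨rfl, h13⟩
    · exact Or.inl ⟨rfl, h13.trans h34⟩
    · exact Or.inr ⟨P.next c, congrArg some (P.tail_next c).symm, sameCycle_of_apply rfl⟩

lemma gusset_vertex_orbit (x y : P.D ⊕ Fin 6) (h : P.gussetTail c x = P.gussetTail c y) :
    (P.gussetNext c * P.gussetRev).SameCycle x y := by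
  rcases P.gusset_vertex_cases c x with ⟨hx, hx'⟩ | ⟨d, hx, hx'⟩ <;>
  rcases P.gusset_vertex_cases c y with ⟨hy, hy'⟩ | ⟨e, hy, hy'⟩ <;>
  rw [hx, hy] at h
  · exact hx'.symm.trans hy'
  · simp at h
  · simp at h
  · exact (hx'.trans (sameCycle_lift Sum.inl (P.gusset_rot_inl c)
      (P.vertex_orbit d e (Option.some_injective _ h)))).trans hy'.symm

lemma gusset_tail_rev_ne (x : P.D ⊕ Fin 6) :
    P.gussetTail c (P.gussetRev x) ≠ P.gussetTail c x := by
  rw [gussetRev_apply]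
  rcases x with d | i
  · simpa [gussetRevFun, gussetTail] using P.tail_rev_ne d
  · fin_cases i <;> simp [gussetRevFun, gussetTail]

lemma gusset_dart_ext (x y : P.D ⊕ Fin 6) (h : P.gussetTail c x = P.gussetTail c y)
    (h' : P.gussetTail c (P.gussetRev x) = P.gussetTail c (P.gussetRev y)) : x = y := by
  have h1 := P.tail_symm_ne c
  have h2 := P.tail_rev_ne c
  have h3 := P.tail_rev_ne_tail_symm c
  rw [gussetRev_apply, gussetRev_apply] at h'
  rcases x with d | i <;> rcases y with e | j
  · exact congrArg Sum.inl
      (P.dart_ext d e (Option.some_injective _ h) (Option.some_injective _ h'))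
  · fin_cases j <;> simp [gussetRevFun, gussetTail] at h h'
  · fin_cases i <;> simp [gussetRevFun, gussetTail] at h h'
  · fin_cases i <;> fin_cases j <;>
      simp [gussetRevFun, gussetTail, h1, h2, h3, h1.symm, h2.symm, h3.symm] at h h' ⊢

lemma gusset_threeConnected : IsThreeConnected (dartGraph (P.gussetTail c) P.gussetRev) := by
  classical
  obtain ⟨hcard, hconn⟩ := P.threeConnected
  refine ⟨by rw [Fintype.card_option]; omega, fun S hS => ?_⟩
  have hS' : S.eraseNone.card ≤ 2 := (Finset.card_eraseNone_le _).trans hS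
  have hc := hconn _ hS'
  let φ : (dartGraph P.tail P.rev).induce {v : P.V | v ∉ S.eraseNone} →g
      (dartGraph (P.gussetTail c) P.gussetRev).induce {v | v ∉ S} :=
    { toFun := fun v => ⟨some v.1, by simpa using v.2⟩
      map_rel' := by
        rintro ⟨a, ha⟩ ⟨b, hb⟩ hab
        rw [SimpleGraph.induce_adj] at hab ⊢
        obtain ⟨hne, h⟩ := (SimpleGraph.fromRel_adj _ _ _).1 hab
        refine (SimpleGraph.fromRel_adj _ _ _).2 ⟨by simpa using hne, ?_⟩
        rcases h with ⟨e, h1, h2⟩ | ⟨e, h1, h2⟩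
        · exact Or.inl ⟨Sum.inl e, congrArg some h1, congrArg some h2⟩
        · exact Or.inr ⟨Sum.inl e, congrArg some h1, congrArg some h2⟩ }
  have hold : ∀ a b, ((dartGraph (P.gussetTail c) P.gussetRev).induce {v | v ∉ S}).Reachable
      (φ a) (φ b) := fun a b => (hc.preconnected a b).map φ
  have hnew : ∀ x : {v : Option P.V | v ∉ S}, ∃ a,
      ((dartGraph (P.gussetTail c) P.gussetRev).induce {v | v ∉ S}).Reachable x (φ a) := by
    rintro ⟨x, hx⟩
    rcases x with _ | a
    · have key : ∀ i : Fin 6, P.gussetTail c (Sum.inr i) = none →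
          ∀ w, P.gussetTail c (P.gussetRev (Sum.inr i)) = some w → some w ∉ S →
          ∃ a, ((dartGraph (P.gussetTail c) P.gussetRev).induce {v | v ∉ S}).Reachable
            ⟨none, hx⟩ (φ a) := by
        intro i hi w hw hwS
        refine ⟨⟨w, by simpa using hwS⟩, SimpleGraph.Adj.reachable ?_⟩
        rw [SimpleGraph.induce_adj]
        have := adj_of_dart (P.gusset_tail_rev_ne c) (Sum.inr i)
        rwa [hi, hw] at this
      by_contra hcon
      have m1 : some (P.tail c) ∈ S := by
        by_contra h
        exact hcon (key 1 rfl _ rfl h)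
      have m2 : some (P.tail (P.next.symm c)) ∈ S := by
        by_contra h
        exact hcon (key 3 rfl _ rfl h)
      have m3 : some (P.tail (P.rev c)) ∈ S := by
        by_contra h
        exact hcon (key 4 rfl _ rfl h)
      have hsub : ({some (P.tail c), some (P.tail (P.next.symm c)), some (P.tail (P.rev c))} :
          Finset (Option P.V)) ⊆ S := by
        intro z hz
        simp only [Finset.mem_insert, Finset.mem_singleton] at hz
        rcases hz with rfl | rfl | rfl <;> assumption
      have h3 : ({some (P.tail c), some (P.tail (P.next.symm c)), some (P.tail (P.rev c))} :
          Finset (Option P.V)).card = 3 := by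
        rw [Finset.card_eq_three]
        exact ⟨_, _, _, by simpa using (P.tail_symm_ne c).symm, by simpa using
          (P.tail_rev_ne c).symm, by simpa using (P.tail_rev_ne_tail_symm c).symm, rfl⟩
      have := Finset.card_le_card hsub
      omega
    · exact ⟨⟨a, by simpa using hx⟩, SimpleGraph.Reachable.refl _⟩
  have : Nonempty {v : Option P.V | v ∉ S} := hc.nonempty.map φ
  refine SimpleGraph.Connected.mk fun x y => ?_
  obtain ⟨a, ha⟩ := hnew x
  obtain ⟨b, hb⟩ := hnew y
  exact (ha.trans (hold a b)).trans hb.symm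

/-- The spherical polyhedron with a gusset at the corner preceding the dart `c`. -/
noncomputable def gusset : SphericalPolyhedron.{u} where
  V := Option P.V
  D := P.D ⊕ Fin 6
  F := P.F ⊕ Fin 2
  rev := P.gussetRev
  next := P.gussetNext c
  tail := P.gussetTail c
  left := P.gussetLeft c
  rev_rev := P.gussetRevFun_invol
  tail_next := P.gusset_tail_next c
  left_next := P.gusset_left_next c
  left_surjective := by
    rintro (f | i)
    · by_cases hf : f = P.left c
      · exact ⟨Sum.inr 2, by rw [hf]; rfl⟩
      · obtain ⟨d, rfl⟩ := P.left_surjective f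
        exact ⟨Sum.inl d, P.gussetLeft_of_ne c (fun h => hf (by rw [h, left_symm]))
          (fun h => hf (by rw [h]))⟩
    · fin_cases i
      · exact ⟨Sum.inr 0, rfl⟩
      · exact ⟨Sum.inr 1, rfl⟩
  face_orbit := P.gusset_face_orbit c
  vertex_orbit := P.gusset_vertex_orbit c
  tail_rev_ne := P.gusset_tail_rev_ne c
  dart_ext := P.gusset_dart_ext c
  threeConnected := P.gusset_threeConnected c
  euler := by
    have := P.euler
    simp only [Fintype.card_option, Fintype.card_sum, Fintype.card_fin]
    omega

end Gusset

end SphericalPolyhedron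

/-! Block and hole polyhedra -/

inductive FaceKind
  | block
  | hole
  | surface

def FaceKind.swap : FaceKind → FaceKind
  | .block => .hole
  | .hole => .block
  | .surface => .surface

lemma FaceKind.swap_eq_surface {k : FaceKind} (h : k.swap = .surface) : k = .surface := by
  cases k <;> simp_all [FaceKind.swap]

/-- A spherical polyhedron whose faces are partitioned into blocks, holes and surface faces; the
surface faces are triangles. -/
structure BlockHolePolyhedron extends SphericalPolyhedron.{u} where
  kind : F → FaceKind
  surface_triangle : ∀ d, kind (left d) = .surface → next (next (next d)) = d

namespace BlockHolePolyhedron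

/-- Blocks and holes interchanged. -/
def swap (P : BlockHolePolyhedron.{u}) : BlockHolePolyhedron.{u} where
  toSphericalPolyhedron := P.toSphericalPolyhedron
  kind f := (P.kind f).swap
  surface_triangle d h := P.surface_triangle d (FaceKind.swap_eq_surface h)

/-- At most one hole at every vertex. -/
def Separated (P : BlockHolePolyhedron.{u}) : Prop :=
  ∀ d e, P.tail d = P.tail e → P.kind (P.left d) = .hole → P.kind (P.left e) = .hole →
    P.left d = P.left e

/-- The face `left c` is a hole (a block), and another hole (block) contains the vertex
`tail c`. -/
def IsContactCorner (P : BlockHolePolyhedron.{u}) (c : P.D) : Prop :=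
  P.kind (P.left c) ≠ .surface ∧
    ∃ d, P.tail d = P.tail c ∧ P.left d ≠ P.left c ∧ P.kind (P.left d) = P.kind (P.left c)

/-- Insertion of a gusset: the two new triangles are surface faces, all other faces keep their
kind. -/
noncomputable def gusset (P : BlockHolePolyhedron.{u}) (c : P.D) (hc : P.IsContactCorner c) :
    BlockHolePolyhedron.{u} where
  toSphericalPolyhedron := P.toSphericalPolyhedron.gusset c
  kind := Sum.elim P.kind fun _ => .surface
  surface_triangle := by
    change ∀ x : P.D ⊕ Fin 6, Sum.elim P.kind (fun _ => FaceKind.surface) (P.gussetLeft c x) =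
      .surface → P.gussetNextFun c (P.gussetNextFun c (P.gussetNextFun c x)) = x
    have hns := hc.1
    rintro (d | i) hx
    · by_cases h1 : d = P.next.symm c
      · subst h1
        rw [P.gussetNextFun_symm]
        rfl
      by_cases h2 : d = c
      · subst h2
        rw [P.gussetNextFun_self]
        rfl
      rw [P.gussetLeft_of_ne c h1 h2] at hx
      have hne : ∀ e, P.left e = P.left d → e ≠ P.next.symm c ∧ e ≠ c := by
        refine fun e he => ⟨fun h => hns ?_, fun h => hns ?_⟩
        · rw [← P.left_symm c, ← h, he]
          exact hx
        · rw [← h, he]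
          exact hx
      have hn1 : P.left (P.next d) = P.left d := P.left_next d
      have hn2 : P.left (P.next (P.next d)) = P.left d := (P.left_next _).trans hn1
      have hn3 : P.left (P.next (P.next (P.next d))) = P.left d := (P.left_next _).trans hn2
      rw [P.gussetNextFun_of_ne c h1 h2 (hne _ hn1).1,
        P.gussetNextFun_of_ne c (hne _ hn1).1 (hne _ hn1).2 (hne _ hn2).1,
        P.gussetNextFun_of_ne c (hne _ hn2).1 (hne _ hn2).2 (hne _ hn3).1,
        P.surface_triangle d hx]
    · fin_cases i
      · exact P.gussetNextFun_symm c
      · exact congrArg (P.gussetNextFun c) (P.gussetNextFun_self c)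
      · exact absurd hx hns
      · exact congrArg (P.gussetNextFun c) (P.gussetNextFun_symm c)
      · exact absurd hx hns
      · exact P.gussetNextFun_self c

/-- `P.Gusseting Q`: the polyhedron `Q` arises from `P` by successive insertion of gussets (possibly
none) at vertices that lie on several holes or on several blocks. -/
inductive Gusseting (P : BlockHolePolyhedron.{u}) : BlockHolePolyhedron.{u} → Prop
  | refl : Gusseting P P
  | step {Q : BlockHolePolyhedron.{u}} (h : Gusseting P Q) (c : Q.D) (hc : Q.IsContactCorner c) :
      Gusseting P (Q.gusset c hc)

end BlockHolePolyhedron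

/-! Statics of bar and joint frameworks, in projective coordinates -/

/-- Homogeneous coordinates `(x₁, x₂, x₃, 1)` of a point. -/
def homog (x : Fin 3 → ℝ) : Fin 4 → ℝ := ![x 0, x 1, x 2, 1]

/-- Homogeneous coordinates `(f₁, f₂, f₃, 0)` of a direction. -/
def homogDir (f : Fin 3 → ℝ) : Fin 4 → ℝ := ![f 0, f 1, f 2, 0]

/-- The `2`-extensor `a ∨ b`, with coordinates `(d₁₄, d₂₄, d₃₄, d₂₃, d₃₁, d₁₂)`. -/
def join (a b : Fin 4 → ℝ) : Fin 6 → ℝ :=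
  ![a 0 * b 3 - a 3 * b 0, a 1 * b 3 - a 3 * b 1, a 2 * b 3 - a 3 * b 2,
    a 1 * b 2 - a 2 * b 1, a 2 * b 0 - a 0 * b 2, a 0 * b 1 - a 1 * b 0]

/-- The line (bar, hinge) through two points. -/
def joinPts (x y : Fin 3 → ℝ) : Fin 6 → ℝ := join (homog x) (homog y)

section Framework

variable {W : Type*}

/-- An assignment of scalars to the bars of `G`, extended by zero. -/
def IsBarScalar (G : SimpleGraph W) (l : W → W → ℝ) : Prop :=
  (∀ i j, l i j = l j i) ∧ ∀ i j, ¬ G.Adj i j → l i j = 0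

variable [Fintype W]

def IsSelfStress (G : SimpleGraph W) (p : W → Fin 3 → ℝ) (l : W → W → ℝ) : Prop :=
  IsBarScalar G l ∧ ∀ i, ∑ j, l i j • joinPts (p i) (p j) = 0

/-- Only the zero self-stress. -/
def IsIndependent (G : SimpleGraph W) (p : W → Fin 3 → ℝ) : Prop :=
  ∀ l, IsSelfStress G p l → l = 0

/-- Loads that pass through the joints and sum to zero. -/
def IsEquilibriumLoad (p : W → Fin 3 → ℝ) (L : W → Fin 6 → ℝ) : Prop :=
  (∀ i, ∃ f : Fin 3 → ℝ, L i = join (homogDir f) (homog (p i))) ∧ ∑ i, L i = 0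

/-- Every equilibrium load is resolved by the bars. -/
def IsStaticallyRigid (G : SimpleGraph W) (p : W → Fin 3 → ℝ) : Prop :=
  ∀ L, IsEquilibriumLoad p L →
    ∃ l, IsBarScalar G l ∧ ∀ i, L i + ∑ j, l i j • joinPts (p i) (p j) = 0

/-- The bars form a basis of the space of equilibrium loads. -/
def IsIsostatic (G : SimpleGraph W) (p : W → Fin 3 → ℝ) : Prop :=
  IsIndependent G p ∧ IsStaticallyRigid G p

/-- The coordinates of the points are algebraically independent over the rationals. -/
def IsGenericConfig (p : W → Fin 3 → ℝ) : Prop :=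
  AlgebraicIndependent ℚ fun x : W × Fin 3 => p x.1 x.2

def GenericallyIndependent (G : SimpleGraph W) : Prop :=
  ∀ p : W → Fin 3 → ℝ, IsGenericConfig p → IsIndependent G p

def GenericallyIsostatic (G : SimpleGraph W) : Prop :=
  ∀ p : W → Fin 3 → ℝ, IsGenericConfig p → IsIsostatic G p

end Framework

/-! Body and hinge structures -/

/-- A graph of bodies and hinges (every hinge joins the bodies `fst e` and `snd e`) together with a
`2`-extensor for each hinge. -/
structure BodyHinge where
  Body : Type u
  Hinge : Type u
  fst : Hinge → Body
  snd : Hinge → Body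
  ext : Hinge → Fin 6 → ℝ

/-- An assignment of screw centres to the bodies that differ, across each hinge, by a multiple of
the hinge. -/
def BodyHinge.IsMotion (B : BodyHinge.{u}) (S : B.Body → Fin 6 → ℝ) : Prop :=
  ∀ e, ∃ w : ℝ, S (B.fst e) - S (B.snd e) = w • B.ext e

/-- In every infinitesimal motion all bodies receive the same screw centre. -/
def BodyHinge.IsRigid (B : BodyHinge.{u}) : Prop :=
  ∀ S, B.IsMotion S → ∀ k m, S k = S m

namespace BlockHolePolyhedron

/-- The body and hinge structure of `P` at the configuration `p`: the bodies are the blocks and the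
surface faces, the hinges are the lines of the edges that separate two of them. (Each edge appears
with both orientations, which impose the same condition.) -/
def motionStructure (P : BlockHolePolyhedron.{u}) (p : P.V → Fin 3 → ℝ) : BodyHinge.{u} where
  Body := {f : P.F // P.kind f ≠ .hole}
  Hinge := {d : P.D // P.kind (P.left d) ≠ .hole ∧ P.kind (P.left (P.rev d)) ≠ .hole}
  fst d := ⟨P.left d.1, d.2.1⟩
  snd d := ⟨P.left (P.rev d.1), d.2.2⟩
  ext d := joinPts (p (P.tail d.1)) (p (P.tail (P.rev d.1)))

def MotionGenericallyRigid (P : BlockHolePolyhedron.{u}) : Prop :=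
  ∀ p : P.V → Fin 3 → ℝ, IsGenericConfig p → (P.motionStructure p).IsRigid

/-- The block faces. -/
abbrev Block (P : BlockHolePolyhedron.{u}) : Type u := {f : P.F // P.kind f = .block}

noncomputable instance (P : BlockHolePolyhedron.{u}) : Fintype P.Block := Fintype.ofFinite _

/-- A choice, for every block, of a subframework that contains the boundary polygon of the block, on
the vertices of the block and finitely many added vertices, and that is isostatic for generic
positions of its vertices. -/
structure Filling (P : BlockHolePolyhedron.{u}) where
  added : P.Block → ℕ
  frame : ∀ k : P.Block, SimpleGraph (P.FaceVertex k.1 ⊕ Fin (added k))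
  polygon : ∀ (k : P.Block) (a b : P.FaceVertex k.1),
    (∃ d, P.left d = k.1 ∧ P.tail d = a.1 ∧ P.tail (P.rev d) = b.1) →
      (frame k).Adj (Sum.inl a) (Sum.inl b)
  isostatic : ∀ k : P.Block, GenericallyIsostatic (frame k)

/-- The static framework graph: the vertices and edges of `P` together with the subframeworks
inserted into the blocks. -/
def staticGraph (P : BlockHolePolyhedron.{u}) (I : P.Filling) :
    SimpleGraph (P.V ⊕ Σ k : P.Block, Fin (I.added k)) :=
  P.graph.map Sum.inl ⊔ ⨆ k : P.Block, (I.frame k).map (Sum.map Subtype.val (Sigma.mk k))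

end BlockHolePolyhedron

open scoped Matrix

lemma Equiv.Perm.SameCycle.apply_eq_of_invariant {α β : Type*} [Finite α] {f : Equiv.Perm α}
    (g : α → β) (h : ∀ x, g (f x) = g x) {x y : α} (hxy : f.SameCycle x y) : g x = g y := by
  obtain ⟨n, rfl⟩ := hxy.exists_nat_pow_eq
  clear hxy
  induction n with
  | zero => rfl
  | succ k ih => rw [pow_succ', Equiv.Perm.mul_apply, h, ih]

/-- A function that is preserved by a permutation except at one point of a cycle is constant on the
rest of the cycle. -/
lemma Equiv.Perm.SameCycle.apply_eq_of_invariant_off {α β : Type*} [Finite α] {f : Equiv.Perm α}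
    (g : α → β) (bad : α → Prop) (z : α)
    (hbad : ∀ x y, f.SameCycle z x → f.SameCycle z y → bad x → bad y → x = y)
    (h : ∀ x, f.SameCycle z x → ¬ bad x → ¬ bad (f x) → g (f x) = g x) {x y : α}
    (hx : f.SameCycle z x) (hy : f.SameCycle z y) (hbx : ¬ bad x) (hby : ¬ bad y) : g x = g y := by
  by_cases hex : ∃ w, f.SameCycle z w ∧ bad w
  · obtain ⟨w, hzw, hw⟩ := hex
    have key : ∀ n : ℕ, ¬ bad ((f ^ (n + 1)) w) → g ((f ^ (n + 1)) w) = g (f w) := by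
      intro n
      induction n with
      | zero => intro _; simp
      | succ k ih =>
        intro hk
        have hc : f.SameCycle z ((f ^ (k + 1)) w) := hzw.trans ⟨k + 1, by norm_cast⟩
        rw [pow_succ', Equiv.Perm.mul_apply] at hk ⊢
        by_cases hb : bad ((f ^ (k + 1)) w)
        · rw [hbad _ _ hc hzw hb hw]
        · rw [h _ hc hb hk, ih hb]
    have key' : ∀ v, f.SameCycle z v → ¬ bad v → g v = g (f w) := by
      intro v hv hbv
      obtain ⟨n, hn⟩ := (hzw.symm.trans hv).exists_nat_pow_eq
      cases n with
      | zero => exact absurd (by simpa [← hn] using hw) hbv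
      | succ k => rw [← hn] at hbv ⊢; exact key k hbv
    rw [key' x hx hbx, key' y hy hby]
  · push Not at hex
    have key : ∀ n : ℕ, g ((f ^ n) z) = g z := by
      intro n
      induction n with
      | zero => rfl
      | succ k ih =>
        have hc : f.SameCycle z ((f ^ k) z) := ⟨k, by norm_cast⟩
        rw [pow_succ', Equiv.Perm.mul_apply, h _ hc (hex _ hc)
          (hex _ (Equiv.Perm.sameCycle_apply_right.2 hc)), ih]
    obtain ⟨n, rfl⟩ := hx.exists_nat_pow_eq
    obtain ⟨k, rfl⟩ := hy.exists_nat_pow_eq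
    rw [key, key]

namespace SphericalPolyhedron

variable (Q : SphericalPolyhedron.{u})

lemma eq_of_edge_invariant {α : Type*} (S : Finset Q.V) (hS : S.card ≤ 2) (ψ : Q.V → α)
    (h : ∀ d, Q.tail d ∉ S → Q.tail (Q.rev d) ∉ S → ψ (Q.tail d) = ψ (Q.tail (Q.rev d)))
    {a b : Q.V} (ha : a ∉ S) (hb : b ∉ S) : ψ a = ψ b := by
  obtain ⟨w⟩ := (Q.threeConnected.2 S hS).preconnected ⟨a, ha⟩ ⟨b, hb⟩
  suffices H : ∀ (x y : {v : Q.V | v ∉ S}),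
      ((dartGraph Q.tail Q.rev).induce {v : Q.V | v ∉ S}).Walk x y → ψ x = ψ y from H _ _ w
  intro x y w
  induction w with
  | nil => rfl
  | @cons x y z hadj _ ih =>
    rw [← ih]
    rw [SimpleGraph.induce_adj] at hadj
    obtain ⟨-, ⟨e, he1, he2⟩ | ⟨e, he1, he2⟩⟩ := (SimpleGraph.fromRel_adj _ _ _).1 hadj
    · rw [← he1, ← he2]
      exact h e (he1 ▸ x.2) (he2 ▸ y.2)
    · rw [← he1, ← he2]
      exact (h e (he1 ▸ y.2) (he2 ▸ x.2)).symm

lemma exists_tail_eq (v : Q.V) : ∃ d, Q.tail d = v := by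
  classical
  by_contra hcon
  push Not at hcon
  have hc : 1 < Fintype.card Q.V := by have := Q.threeConnected.1; omega
  obtain ⟨w, hw⟩ := Fintype.exists_ne_of_one_lt_card hc v
  have := Q.eq_of_edge_invariant ∅ (by simp) (fun x => x = v) (fun d _ _ => by
    simp [hcon d, hcon (Q.rev d)]) (a := v) (b := w) (by simp) (by simp)
  simp [hw] at this

lemma left_rot (d : Q.D) : Q.left (Q.next (Q.rev d)) = Q.left (Q.rev d) := Q.left_next _

lemma tail_rot (d : Q.D) : Q.tail (Q.next (Q.rev d)) = Q.tail d := by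
  rw [Q.tail_next, Q.rev_rev]

lemma eq_of_face_invariant {α : Type*} (φ : Q.F → α)
    (h : ∀ d, φ (Q.left d) = φ (Q.left (Q.rev d))) (f g : Q.F) : φ f = φ g := by
  have hv : ∀ d e, Q.tail d = Q.tail e → φ (Q.left d) = φ (Q.left e) := fun d e hde =>
    (Q.vertex_orbit d e hde).apply_eq_of_invariant (fun d => φ (Q.left d))
      (fun x => by rw [Equiv.Perm.mul_apply, Q.left_rot, ← h])
  choose δ hδ using Q.exists_tail_eq
  obtain ⟨d, rfl⟩ := Q.left_surjective f
  obtain ⟨e, rfl⟩ := Q.left_surjective g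
  have := Q.eq_of_edge_invariant ∅ (by simp) (fun v => φ (Q.left (δ v))) (fun x _ _ => by
    rw [hv _ x (hδ _), hv _ (Q.rev x) (hδ _), h]) (a := Q.tail d) (b := Q.tail e)
    (by simp) (by simp)
  rwa [hv _ d (hδ _), hv _ e (hδ _)] at this

open Classical in
lemma sum_rot {M : Type*} [AddCommMonoid M] (v : Q.V) (g : Q.D → M) :
    ∑ d with Q.tail d = v, g (Q.next (Q.rev d)) = ∑ d with Q.tail d = v, g d := by
  refine Finset.sum_equiv (Q.next * Q.rev) (fun d => ?_) (fun d _ => rfl)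
  simp only [Finset.mem_filter, Finset.mem_univ, true_and, Equiv.Perm.mul_apply, Q.tail_rot]

open Classical in
lemma sum_next {M : Type*} [AddCommMonoid M] (f : Q.F) (g : Q.D → M) :
    ∑ d with Q.left d = f, g (Q.next d) = ∑ d with Q.left d = f, g d := by
  refine Finset.sum_equiv Q.next (fun d => ?_) (fun d _ => rfl)
  simp only [Finset.mem_filter, Finset.mem_univ, true_and, Q.left_next]

open Classical in
lemma sum_coboundary_mul {ι : Type*} [Fintype ι] (t : Q.D → ι) (σ : Q.D → ℝ)
    (hσ : ∀ d, σ (Q.rev d) = -σ d)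
    (h : ∀ v, ∑ d with t d = v, σ d = 0) (ψ : ι → ℝ) :
    ∑ d, (ψ (t d) - ψ (t (Q.rev d))) * σ d = 0 := by
  have h1 : ∑ d, ψ (t (Q.rev d)) * σ d = -∑ d, ψ (t d) * σ d := by
    rw [← Equiv.sum_comp Q.rev, ← Finset.sum_neg_distrib]
    exact Finset.sum_congr rfl fun d _ => by rw [Q.rev_rev, hσ]; ring
  have h2 : ∑ d, ψ (t d) * σ d = 0 := by
    rw [← Finset.sum_fiberwise (s := Finset.univ) (g := t)]
    refine Finset.sum_eq_zero fun v _ => ?_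
    rw [← mul_zero (ψ v), ← h v, Finset.mul_sum]
    exact Finset.sum_congr rfl fun d hd => by rw [(Finset.mem_filter.1 hd).2]
  simp only [sub_mul, Finset.sum_sub_distrib, h1, h2]
  simp

lemma exists_orientation : ∃ o : Q.D → ℝ, (∀ d, o (Q.rev d) = -o d) ∧ ∀ d, o d ≠ 0 := by
  classical
  let e := Fintype.equivFin Q.D
  have hne : ∀ d, e (Q.rev d) ≠ e d := fun d h =>
    Q.tail_rev_ne d (by rw [e.injective h])
  refine ⟨fun d => if e d < e (Q.rev d) then 1 else -1, fun d => ?_, fun d => ?_⟩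
  · rcases lt_or_gt_of_ne (hne d) with h | h
    · simp [Q.rev_rev, h, not_lt.2 h.le]
    · simp [Q.rev_rev, h, not_lt.2 h.le]
  · dsimp only
    split_ifs <;> norm_num

def antisymmetric : Submodule ℝ (Q.D → ℝ) where
  carrier := {σ | ∀ d, σ (Q.rev d) = -σ d}
  add_mem' := fun {a b} ha hb d => by simp [ha d, hb d]; ring
  zero_mem' := fun d => by simp
  smul_mem' := fun r a ha d => by simp [ha d]

lemma two_mul_finrank_antisymmetric_le :
    2 * Module.finrank ℝ Q.antisymmetric ≤ Fintype.card Q.D := by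
  obtain ⟨o, ho, ho'⟩ := Q.exists_orientation
  let T : (Q.antisymmetric × Q.antisymmetric) →ₗ[ℝ] (Q.D → ℝ) :=
    { toFun := fun x d => x.1.1 d + o d * x.2.1 d
      map_add' := fun x y => by ext d; simp; ring
      map_smul' := fun r x => by ext d; simp; ring }
  have hT : Function.Injective T := by
    rw [← LinearMap.ker_eq_bot, LinearMap.ker_eq_bot']
    rintro ⟨⟨a, ha⟩, ⟨b, hb⟩⟩ h
    have h1 : ∀ d, a d + o d * b d = 0 := fun d => congrFun h d
    have h2 : ∀ d, -a d + o d * b d = 0 := fun d => by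
      have := h1 (Q.rev d)
      rw [ha d, hb d, ho d] at this
      linarith
    have h3 : a = 0 := by
      ext d
      have := h1 d
      have := h2 d
      simp only [Pi.zero_apply]
      linarith
    have h4 : b = 0 := by
      ext d
      have h5 := h1 d
      rw [h3] at h5
      simpa [ho' d] using h5
    subst h3 h4
    rfl
  have := LinearMap.finrank_le_finrank_of_injective hT
  rw [Module.finrank_prod, Module.finrank_fintype_fun_eq_card] at this
  omega

def hodgeMap : ((Q.V → ℝ) × (Q.F → ℝ)) →ₗ[ℝ] (Q.D → ℝ) where
  toFun x d := (x.1 (Q.tail d) - x.1 (Q.tail (Q.rev d))) + (x.2 (Q.left d) - x.2 (Q.left (Q.rev d)))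
  map_add' x y := by ext d; simp; ring
  map_smul' r x := by ext d; simp; ring

open Classical in
lemma sum_tail_face_coboundary (φ : Q.F → ℝ) (v : Q.V) :
    ∑ d with Q.tail d = v, (φ (Q.left d) - φ (Q.left (Q.rev d))) = 0 := by
  rw [Finset.sum_sub_distrib, sub_eq_zero, ← Q.sum_rot v (fun d => φ (Q.left d))]
  exact Finset.sum_congr rfl fun d _ => by rw [Q.left_rot]

open Classical in
lemma sum_left_vertex_coboundary (ψ : Q.V → ℝ) (f : Q.F) :
    ∑ d with Q.left d = f, (ψ (Q.tail d) - ψ (Q.tail (Q.rev d))) = 0 := by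
  rw [Finset.sum_sub_distrib, sub_eq_zero, ← Q.sum_next f (fun d => ψ (Q.tail d))]
  exact Finset.sum_congr rfl fun d _ => by rw [Q.tail_next]

lemma eq_zero_of_sum_mul_self {ι : Type*} [Fintype ι] {x : ι → ℝ} (h : ∑ i, x i * x i = 0) :
    ∀ i, x i = 0 := fun i => by
  have := (Finset.sum_eq_zero_iff_of_nonneg (fun i _ => mul_self_nonneg (x i))).1 h i
    (Finset.mem_univ i)
  simpa using this

lemma finrank_ker_hodgeMap_le : Module.finrank ℝ (LinearMap.ker Q.hodgeMap) ≤ 2 := by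
  obtain ⟨v₀⟩ : Nonempty Q.V := Fintype.card_pos_iff.1 (by have := Q.threeConnected.1; omega)
  obtain ⟨d₀, -⟩ := Q.exists_tail_eq v₀
  let T : LinearMap.ker Q.hodgeMap →ₗ[ℝ] (ℝ × ℝ) :=
    { toFun := fun x => (x.1.1 v₀, x.1.2 (Q.left d₀))
      map_add' := fun x y => rfl
      map_smul' := fun r x => rfl }
  have hT : Function.Injective T := by
    rw [← LinearMap.ker_eq_bot, LinearMap.ker_eq_bot']
    rintro ⟨⟨ψ, φ⟩, hx⟩ h
    have h0 : ∀ d, (ψ (Q.tail d) - ψ (Q.tail (Q.rev d))) +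
      (φ (Q.left d) - φ (Q.left (Q.rev d))) = 0 := fun d => congrFun hx d
    have h1 : ψ v₀ = 0 := congrArg Prod.fst h
    have h2 : φ (Q.left d₀) = 0 := congrArg Prod.snd h
    have horth := Q.sum_coboundary_mul Q.tail (fun d => φ (Q.left d) - φ (Q.left (Q.rev d)))
      (fun d => by simp only [Q.rev_rev]; ring) (Q.sum_tail_face_coboundary φ) ψ
    have hz := eq_zero_of_sum_mul_self (x := fun d => φ (Q.left d) - φ (Q.left (Q.rev d))) (by
      have h3 : ∀ d, (φ (Q.left d) - φ (Q.left (Q.rev d))) * (φ (Q.left d) - φ (Q.left (Q.rev d))) =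
          -((ψ (Q.tail d) - ψ (Q.tail (Q.rev d))) * (φ (Q.left d) - φ (Q.left (Q.rev d)))) :=
        fun d => by
          have := h0 d
          linear_combination (φ (Q.left d) - φ (Q.left (Q.rev d))) * this
      simp only [h3]
      rw [Finset.sum_neg_distrib, horth, neg_zero])
    have hφ : φ = 0 := by
      ext f
      rw [Q.eq_of_face_invariant φ (fun d => sub_eq_zero.1 (hz d)) f (Q.left d₀), h2]
      rfl
    have hψ : ψ = 0 := by
      ext v
      rw [Q.eq_of_edge_invariant ∅ (by simp) ψ (fun d _ _ => by
        have := h0 d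
        rw [hφ] at this
        simpa [sub_eq_zero] using this) (a := v) (b := v₀) (by simp) (by simp), h1]
      rfl
    subst hφ hψ
    rfl
  have := LinearMap.finrank_le_finrank_of_injective hT
  simpa using this

/-- Discrete Hodge decomposition on the sphere. -/
lemma range_hodgeMap : LinearMap.range Q.hodgeMap = Q.antisymmetric := by
  apply Submodule.eq_of_le_of_finrank_le
  · rintro _ ⟨x, rfl⟩ d
    simp only [hodgeMap, LinearMap.coe_mk, AddHom.coe_mk, Q.rev_rev]
    ring
  · have h1 := Q.two_mul_finrank_antisymmetric_le
    have h2 := Q.finrank_ker_hodgeMap_le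
    have h3 := LinearMap.finrank_range_add_finrank_ker Q.hodgeMap
    have h4 := Q.euler
    rw [Module.finrank_prod, Module.finrank_fintype_fun_eq_card,
      Module.finrank_fintype_fun_eq_card] at h3
    omega

open Classical in
lemma exists_face_potential (σ : Q.D → ℝ) (hσ : ∀ d, σ (Q.rev d) = -σ d)
    (h : ∀ v, ∑ d with Q.tail d = v, σ d = 0) :
    ∃ φ : Q.F → ℝ, ∀ d, σ d = φ (Q.left d) - φ (Q.left (Q.rev d)) := by
  obtain ⟨⟨ψ, φ⟩, hx⟩ : σ ∈ LinearMap.range Q.hodgeMap := by rw [Q.range_hodgeMap]; exact hσ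
  have h0 : ∀ d, (ψ (Q.tail d) - ψ (Q.tail (Q.rev d))) +
      (φ (Q.left d) - φ (Q.left (Q.rev d))) = σ d := fun d => congrFun hx d
  have h1 := Q.sum_coboundary_mul Q.tail (fun d => ψ (Q.tail d) - ψ (Q.tail (Q.rev d)))
    (fun d => by simp only [Q.rev_rev]; ring) (fun v => by
      rw [← sub_eq_zero.2 ((h v).trans (Q.sum_tail_face_coboundary φ v).symm),
        ← Finset.sum_sub_distrib]
      exact Finset.sum_congr rfl fun d _ => by rw [← h0 d]; ring) ψ
  have h2 := eq_zero_of_sum_mul_self h1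
  exact ⟨φ, fun d => by rw [← h0 d, h2 d, zero_add]⟩

open Classical in
lemma exists_vertex_potential (σ : Q.D → ℝ) (hσ : ∀ d, σ (Q.rev d) = -σ d)
    (h : ∀ f, ∑ d with Q.left d = f, σ d = 0) :
    ∃ ψ : Q.V → ℝ, ∀ d, σ d = ψ (Q.tail d) - ψ (Q.tail (Q.rev d)) := by
  obtain ⟨⟨ψ, φ⟩, hx⟩ : σ ∈ LinearMap.range Q.hodgeMap := by rw [Q.range_hodgeMap]; exact hσ
  have h0 : ∀ d, (ψ (Q.tail d) - ψ (Q.tail (Q.rev d))) +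
      (φ (Q.left d) - φ (Q.left (Q.rev d))) = σ d := fun d => congrFun hx d
  have h1 := Q.sum_coboundary_mul Q.left (fun d => φ (Q.left d) - φ (Q.left (Q.rev d)))
    (fun d => by simp only [Q.rev_rev]; ring) (fun f => by
      rw [← sub_eq_zero.2 ((h f).trans (Q.sum_left_vertex_coboundary ψ f).symm),
        ← Finset.sum_sub_distrib]
      exact Finset.sum_congr rfl fun d _ => by rw [← h0 d]; ring) φ
  have h2 := eq_zero_of_sum_mul_self h1
  exact ⟨ψ, fun d => by rw [← h0 d, h2 d, add_zero]⟩

open Classical in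
lemma exists_face_potential_vec {ι : Type*} (σ : Q.D → ι → ℝ) (hσ : ∀ d, σ (Q.rev d) = -σ d)
    (h : ∀ v, ∑ d with Q.tail d = v, σ d = 0) :
    ∃ φ : Q.F → ι → ℝ, ∀ d, σ d = φ (Q.left d) - φ (Q.left (Q.rev d)) := by
  choose φ hφ using fun i => Q.exists_face_potential (fun d => σ d i)
    (fun d => by rw [hσ]; rfl) (fun v => by
      have := congrFun (h v) i
      rwa [Finset.sum_apply] at this)
  exact ⟨fun f i => φ i f, fun d => funext fun i => hφ i d⟩

/-- The darts around `tail x` that are passed on the way from `x` to `y`. -/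
lemma exists_fan {x y : Q.D} (h : Q.tail x = Q.tail y) :
    ∃ s : Finset Q.D, (∀ d ∈ s, Q.tail d = Q.tail x) ∧ y ∉ s ∧ (x ≠ y → x ∈ s) ∧
      (∀ d ∈ s, Q.next (Q.rev d) ≠ y → Q.next (Q.rev d) ∈ s) ∧
      (∀ d, Q.next (Q.rev d) ∈ s → Q.next (Q.rev d) ≠ x → d ∈ s) ∧
      ∀ φ : Q.F → ℝ, ∑ d ∈ s, (φ (Q.left d) - φ (Q.left (Q.rev d))) =
        φ (Q.left x) - φ (Q.left y) := by
  classical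
  obtain ⟨f, hf⟩ : ∃ f, f = Q.next * Q.rev := ⟨_, rfl⟩
  have hex : ∃ n : ℕ, (f ^ n) x = y := by
    rw [hf]
    exact (Q.vertex_orbit x y h).exists_nat_pow_eq
  let n := Nat.find hex
  have hn : (f ^ n) x = y := Nat.find_spec hex
  have hmin : ∀ m < n, (f ^ m) x ≠ y := fun m hm => Nat.find_min hex hm
  have hinj : Set.InjOn (fun i : ℕ => (f ^ i) x) (Finset.range n : Set ℕ) := by
    have key : ∀ i j, i < j → j < n → (f ^ i) x ≠ (f ^ j) x := by
      intro i j hij hj he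
      refine hmin (n - j + i) (by omega) ?_
      rw [pow_add, Equiv.Perm.mul_apply, he, ← Equiv.Perm.mul_apply, ← pow_add,
        Nat.sub_add_cancel hj.le, hn]
    intro i hi j hj he
    simp only [Finset.coe_range, Set.mem_Iio] at hi hj
    rcases lt_trichotomy i j with hij | hij | hij
    · exact absurd he (key i j hij hj)
    · exact hij
    · exact absurd he.symm (key j i hij hi)
  have hstep : ∀ d, Q.next (Q.rev d) = f d := fun d => by rw [hf]; rfl
  have hsucc : ∀ i, f ((f ^ i) x) = (f ^ (i + 1)) x := fun i => by
    rw [pow_succ', Equiv.Perm.mul_apply]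
  refine ⟨(Finset.range n).image fun i => (f ^ i) x, ?_, ?_, ?_, ?_, ?_, ?_⟩
  · intro d hd
    obtain ⟨i, -, rfl⟩ := Finset.mem_image.1 hd
    clear hd
    induction i with
    | zero => rfl
    | succ k ih => rw [← hsucc, ← hstep, Q.tail_rot, ih]
  · intro hy
    obtain ⟨i, hi, he⟩ := Finset.mem_image.1 hy
    exact hmin i (Finset.mem_range.1 hi) he
  · intro hxy
    refine Finset.mem_image.2 ⟨0, Finset.mem_range.2 (Nat.pos_of_ne_zero fun h0 => hxy ?_), rfl⟩
    rw [← hn, h0]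
    rfl
  · intro d hd hne
    obtain ⟨i, hi, rfl⟩ := Finset.mem_image.1 hd
    rw [hstep, hsucc] at hne ⊢
    refine Finset.mem_image.2 ⟨i + 1, Finset.mem_range.2 ?_, rfl⟩
    have hi' := Finset.mem_range.1 hi
    have : i + 1 ≠ n := fun h => hne (by rw [h, hn])
    omega
  · intro d hd hne
    obtain ⟨i, hi, he⟩ := Finset.mem_image.1 hd
    have hi' := Finset.mem_range.1 hi
    rw [hstep] at hne he
    cases i with
    | zero => exact absurd he.symm hne
    | succ k =>
      replace he : (f ^ (k + 1)) x = f d := he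
      rw [← hsucc] at he
      rw [← f.injective he]
      exact Finset.mem_image.2 ⟨k, Finset.mem_range.2 (by omega), rfl⟩
  · intro φ
    rw [Finset.sum_image hinj]
    have : ∀ i, φ (Q.left ((f ^ i) x)) - φ (Q.left (Q.rev ((f ^ i) x))) =
        φ (Q.left ((f ^ i) x)) - φ (Q.left ((f ^ (i + 1)) x)) := fun i => by
      rw [← hsucc, ← hstep, Q.left_rot]
    simp only [this]
    rw [Finset.sum_range_sub', hn]
    rfl

open Classical in
/-- The closed dual curve given by a set of crossed darts. -/
lemma exists_potential_of_crossing (s : Finset Q.D)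
    (hs : ∀ φ : Q.F → ℝ, ∑ d ∈ s, (φ (Q.left d) - φ (Q.left (Q.rev d))) = 0) :
    ∃ ψ : Q.V → ℝ, ∀ d, ((if d ∈ s then 1 else 0) - (if Q.rev d ∈ s then 1 else 0) : ℝ) =
      ψ (Q.tail d) - ψ (Q.tail (Q.rev d)) := by
  apply Q.exists_vertex_potential
  · intro d
    rw [Q.rev_rev]
    ring
  · intro f
    have h := hs fun g => if g = f then 1 else 0
    refine Eq.trans ?_ h
    rw [Finset.sum_filter]
    have h1 : ∑ d, (if Q.left d = f then (if Q.rev d ∈ s then (1 : ℝ) else 0) else 0) =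
        ∑ d, (if Q.left (Q.rev d) = f then (if d ∈ s then (1 : ℝ) else 0) else 0) := by
      rw [← Equiv.sum_comp Q.rev]
      simp only [Q.rev_rev]
    have h2 : ∀ d, (if Q.left d = f then ((if d ∈ s then 1 else 0) -
        (if Q.rev d ∈ s then 1 else 0) : ℝ) else 0) =
        (if Q.left d = f then (if d ∈ s then (1 : ℝ) else 0) else 0) -
        (if Q.left d = f then (if Q.rev d ∈ s then (1 : ℝ) else 0) else 0) := fun d => by
      split_ifs <;> simp
    rw [Finset.sum_congr rfl fun d _ => h2 d]
    rw [Finset.sum_sub_distrib, h1, ← Finset.sum_sub_distrib]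
    symm
    rw [← Finset.sum_filter_add_sum_filter_not Finset.univ (fun d => d ∈ s)]
    rw [Finset.sum_eq_zero (s := {x ∈ Finset.univ | x ∉ s}), add_zero]
    · have hs' : ({d ∈ Finset.univ | d ∈ s} : Finset Q.D) = s := by
        ext d
        simp
      rw [hs']
      refine Finset.sum_congr rfl fun d hd => ?_
      rw [if_pos hd]
    · intro d hd
      simp [(Finset.mem_filter.1 hd).2]

/-- The boundary of a face passes through each of its vertices once. -/
lemma dart_eq_of_tail_left {x y : Q.D} (ht : Q.tail x = Q.tail y) (hl : Q.left x = Q.left y) :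
    x = y := by
  classical
  by_contra hne
  obtain ⟨s, hst, hys, hxs, -, -, hsum⟩ := Q.exists_fan ht
  obtain ⟨ψ, hψ⟩ := Q.exists_potential_of_crossing s fun φ => by rw [hsum, hl, sub_self]
  have hrev : ∀ d, Q.tail d = Q.tail x → Q.rev d ∉ s := fun d hd h =>
    Q.tail_rev_ne d ((hst _ h).trans hd.symm)
  have hconst : ∀ a b, a ∉ ({Q.tail x} : Finset Q.V) → b ∉ ({Q.tail x} : Finset Q.V) → ψ a = ψ b :=
      fun a b => Q.eq_of_edge_invariant {Q.tail x} (by simp) ψ (fun d h1 h2 => by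
    simp only [Finset.mem_singleton] at h1 h2
    have := hψ d
    rw [if_neg (fun h => h1 (hst _ h)), if_neg (fun h => h2 (hst _ h)), sub_zero] at this
    linarith)
  have hx := hψ x
  have hy := hψ y
  rw [if_pos (hxs hne), if_neg (hrev x rfl)] at hx
  rw [if_neg hys, if_neg (hrev y ht.symm), ← ht] at hy
  have := hconst (Q.tail (Q.rev x)) (Q.tail (Q.rev y))
    (by simpa using Q.tail_rev_ne x) (by simpa [ht] using Q.tail_rev_ne y)
  rw [this] at hx
  linarith

lemma left_rev_ne (d : Q.D) : Q.left (Q.rev d) ≠ Q.left d := fun h =>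
  Q.rot_ne (Q.rev d) (by
    rw [Q.rev_rev]
    exact Q.dart_eq_of_tail_left (Q.tail_next d) (by rw [Q.left_next, h]))

/-- Two faces that share two vertices share the edge between them. -/
lemma exists_dart_of_two_faces {x x' y y' : Q.D} (hx : Q.left x = Q.left x')
    (hy : Q.left y = Q.left y') (hxy : Q.left x ≠ Q.left y) (ha : Q.tail x = Q.tail y)
    (hb : Q.tail x' = Q.tail y') (hab : Q.tail x ≠ Q.tail x') :
    ∃ d, Q.tail d = Q.tail x ∧ Q.tail (Q.rev d) = Q.tail x' ∧
      (Q.left d = Q.left x ∧ Q.left (Q.rev d) = Q.left y ∨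
        Q.left d = Q.left y ∧ Q.left (Q.rev d) = Q.left x) := by
  classical
  obtain ⟨s, hst, hys, hxs, hnext, hprev, hsum⟩ := Q.exists_fan ha
  obtain ⟨t, htt, -, -, -, -, htsum⟩ := Q.exists_fan hb.symm
  have hdisj : Disjoint s t := Finset.disjoint_left.2 fun d h1 h2 =>
    hab (by rw [← hst d h1, htt d h2, hb])
  obtain ⟨ψ, hψ⟩ := Q.exists_potential_of_crossing (s ∪ t) fun φ => by
    rw [Finset.sum_union hdisj, hsum, htsum, hx, hy]
    ring
  have hxs := hxs fun h => hxy (by rw [h])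
  have hconst : ∀ a b, a ∉ ({Q.tail x, Q.tail x'} : Finset Q.V) →
      b ∉ ({Q.tail x, Q.tail x'} : Finset Q.V) → ψ a = ψ b :=
    fun a b => Q.eq_of_edge_invariant {Q.tail x, Q.tail x'} Finset.card_le_two ψ (fun d h1 h2 => by
      simp only [Finset.mem_insert, Finset.mem_singleton, not_or] at h1 h2
      have := hψ d
      rw [if_neg, if_neg, sub_zero] at this
      · linarith
      · exact fun h => (Finset.mem_union.1 h).elim (fun h => h2.1 (hst _ h))
          (fun h => h2.2 ((htt _ h).trans hb.symm))
      · exact fun h => (Finset.mem_union.1 h).elim (fun h => h1.1 (hst _ h))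
          (fun h => h1.2 ((htt _ h).trans hb.symm)))
  have key : ∀ d e, Q.tail d = Q.tail x → Q.tail e = Q.tail x →
      Q.tail (Q.rev d) ≠ Q.tail x' → Q.tail (Q.rev e) ≠ Q.tail x' → d ∈ s → e ∈ s := by
    intro d e hd he hd' he' hds
    by_contra hes
    have h1 : ∀ e, Q.tail e = Q.tail x → Q.tail (Q.rev e) ≠ Q.tail x' → Q.rev e ∉ s ∪ t := by
      intro e he he' h
      rcases Finset.mem_union.1 h with h | h
      · exact Q.tail_rev_ne e ((hst _ h).trans he.symm)
      · exact he' ((htt _ h).trans hb.symm)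
    have hd1 := hψ d
    have he1 := hψ e
    rw [if_pos (Finset.mem_union_left _ hds), if_neg (h1 d hd hd')] at hd1
    rw [if_neg (fun h => (Finset.mem_union.1 h).elim hes
      (fun h => hab (by rw [← he, htt _ h, hb]))), if_neg (h1 e he he')] at he1
    rw [hd, hconst (Q.tail (Q.rev d)) (Q.tail (Q.rev e))
      (by
        simp only [Finset.mem_insert, Finset.mem_singleton, not_or]
        exact ⟨fun h => Q.tail_rev_ne d (h.trans hd.symm), hd'⟩)
      (by
        simp only [Finset.mem_insert, Finset.mem_singleton, not_or]
        exact ⟨fun h => Q.tail_rev_ne e (h.trans he.symm), he'⟩)] at hd1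
    rw [he] at he1
    linarith
  have huniq : ∀ d e, Q.tail d = Q.tail x → Q.tail e = Q.tail x →
      Q.tail (Q.rev d) = Q.tail x' → Q.tail (Q.rev e) = Q.tail x' → d = e :=
    fun d e hd he hd' he' => Q.dart_ext d e (hd.trans he.symm) (hd'.trans he'.symm)
  by_cases h1 : Q.tail (Q.rev x) = Q.tail x'
  · refine ⟨x, rfl, h1, Or.inl ⟨rfl, ?_⟩⟩
    by_cases h2 : Q.next (Q.rev x) = y
    · rw [← h2, Q.left_rot]
    · have h3 := hnext x hxs h2
      refine absurd (key _ y (Q.tail_rot x) ha.symm (fun h => Q.rot_ne x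
        (huniq _ _ (Q.tail_rot x) rfl h h1)) (fun h => hys ?_) h3) hys
      rwa [huniq y x ha.symm rfl h h1]
  · have h2 : Q.tail (Q.rev y) = Q.tail x' := by
      by_contra h2
      exact hys (key x y rfl ha.symm h1 h2 hxs)
    refine ⟨y, ha.symm, h2, Or.inr ⟨rfl, ?_⟩⟩
    by_cases h3 : Q.next (Q.rev y) = x
    · rw [← h3, Q.left_rot]
    · have ht := (Q.tail_rot y).trans ha.symm
      exact absurd (hprev y (key x _ rfl ht h1 (fun h => Q.rot_ne y
        (huniq _ _ ht ha.symm h h2)) hxs) h3) hys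

/-- The boundary of a face has no chords. -/
lemma left_eq_or_of_chord {e x x' : Q.D} (hx : Q.left x = Q.left x') (ha : Q.tail e = Q.tail x)
    (hb : Q.tail (Q.rev e) = Q.tail x') : Q.left e = Q.left x ∨ Q.left (Q.rev e) = Q.left x := by
  by_contra hcon
  push Not at hcon
  obtain ⟨d, hd1, hd2, hd⟩ := Q.exists_dart_of_two_faces (x := x) (x' := x') (y := e)
    (y' := Q.next e) hx (Q.left_next e).symm hcon.1.symm ha.symm
    (hb.symm.trans (Q.tail_next e).symm) (by rw [← ha, ← hb]; exact (Q.tail_rev_ne e).symm)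
  have : d = e := Q.dart_ext _ _ (hd1.trans ha.symm) (hd2.trans hb.symm)
  subst this
  rcases hd with ⟨h, -⟩ | ⟨-, h⟩
  · exact hcon.1 h
  · exact hcon.2 h

end SphericalPolyhedron

/-! Screws and lines in space -/

/-- The velocity of the point `x` under the screw `S`. -/
def velocity (x : Fin 3 → ℝ) : (Fin 6 → ℝ) →ₗ[ℝ] (Fin 3 → ℝ) where
  toFun S := ![S 1 * x 2 - S 2 * x 1 - S 3, S 2 * x 0 - S 0 * x 2 - S 4,
    S 0 * x 1 - S 1 * x 0 - S 5]
  map_add' S T := by ext i; fin_cases i <;> simp <;> ring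
  map_smul' r S := by ext i; fin_cases i <;> simp <;> ring

lemma velocity_zero (x : Fin 3 → ℝ) (S : Fin 6 → ℝ) :
    velocity x S 0 = S 1 * x 2 - S 2 * x 1 - S 3 := rfl
lemma velocity_one (x : Fin 3 → ℝ) (S : Fin 6 → ℝ) :
    velocity x S 1 = S 2 * x 0 - S 0 * x 2 - S 4 := rfl
lemma velocity_two (x : Fin 3 → ℝ) (S : Fin 6 → ℝ) :
    velocity x S 2 = S 0 * x 1 - S 1 * x 0 - S 5 := rfl

lemma joinPts_eq (x y : Fin 3 → ℝ) : joinPts x y = ![x 0 - y 0, x 1 - y 1, x 2 - y 2,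
    x 1 * y 2 - x 2 * y 1, x 2 * y 0 - x 0 * y 2, x 0 * y 1 - x 1 * y 0] := by
  ext i; fin_cases i <;> simp [joinPts, join, homog]

lemma join_homogDir (f y : Fin 3 → ℝ) : join (homogDir f) (homog y) = ![f 0, f 1, f 2,
    f 1 * y 2 - f 2 * y 1, f 2 * y 0 - f 0 * y 2, f 0 * y 1 - f 1 * y 0] := by
  ext i; fin_cases i <;> simp [join, homog, homogDir]

lemma joinPts_swap (x y : Fin 3 → ℝ) : joinPts y x = -joinPts x y := by
  rw [joinPts_eq, joinPts_eq]
  ext i; fin_cases i <;> simp <;> ring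

lemma velocity_joinPts_left (x y : Fin 3 → ℝ) : velocity x (joinPts x y) = 0 := by
  rw [joinPts_eq]
  ext i; fin_cases i <;> simp [velocity] <;> ring

lemma velocity_joinPts_right (x y : Fin 3 → ℝ) : velocity y (joinPts x y) = 0 := by
  rw [joinPts_swap, map_neg, velocity_joinPts_left, neg_zero]

lemma velocity_eq_zero_iff (x : Fin 3 → ℝ) (S : Fin 6 → ℝ) :
    velocity x S = 0 ↔ ∃ f : Fin 3 → ℝ, S = join (homogDir f) (homog x) := by
  constructor
  · intro h
    refine ⟨![S 0, S 1, S 2], ?_⟩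
    have h0 := congrFun h 0
    have h1 := congrFun h 1
    have h2 := congrFun h 2
    rw [velocity_zero] at h0
    rw [velocity_one] at h1
    rw [velocity_two] at h2
    simp only [Pi.zero_apply] at h0 h1 h2
    rw [join_homogDir]
    ext i; fin_cases i <;> simp <;> linarith
  · rintro ⟨f, rfl⟩
    rw [join_homogDir]
    ext i; fin_cases i <;> simp [velocity]

lemma fin_three_dot (a b : Fin 3 → ℝ) : a ⬝ᵥ b = a 0 * b 0 + a 1 * b 1 + a 2 * b 2 := by
  simp [dotProduct, Fin.sum_univ_three]

lemma velocity_dot (x y : Fin 3 → ℝ) (S : Fin 6 → ℝ) :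
    (x - y) ⬝ᵥ (velocity x S - velocity y S) = 0 := by
  simp only [fin_three_dot, Pi.sub_apply, velocity_zero, velocity_one, velocity_two]
  ring

lemma exists_smul_of_crossProduct_eq_zero {a b : Fin 3 → ℝ} (ha : a ≠ 0) (h : crossProduct a b = 0) :
    ∃ w : ℝ, b = w • a := by
  rw [cross_apply] at h
  have h0 : a 1 * b 2 - a 2 * b 1 = 0 := congrFun h 0
  have h1 : a 2 * b 0 - a 0 * b 2 = 0 := congrFun h 1
  have h2 : a 0 * b 1 - a 1 * b 0 = 0 := congrFun h 2
  have hne : a 0 ≠ 0 ∨ a 1 ≠ 0 ∨ a 2 ≠ 0 := by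
    by_contra hcon
    push Not at hcon
    exact ha (by ext i; fin_cases i <;> simp [hcon])
  rcases hne with hne | hne | hne
  · refine ⟨b 0 / a 0, ?_⟩
    ext i; fin_cases i <;> simp <;> field_simp <;> linarith
  · refine ⟨b 1 / a 1, ?_⟩
    ext i; fin_cases i <;> simp <;> field_simp <;> linarith
  · refine ⟨b 2 / a 2, ?_⟩
    ext i; fin_cases i <;> simp <;> field_simp <;> linarith

lemma dot_self_pos {a : Fin 3 → ℝ} (ha : a ≠ 0) : a ⬝ᵥ a ≠ 0 := by
  simpa using ha

lemma joinPts_ne_zero {x y : Fin 3 → ℝ} (h : x ≠ y) : joinPts x y ≠ 0 := by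
  intro h0
  rw [joinPts_eq] at h0
  apply h
  have h1 : x 0 - y 0 = 0 := congrFun h0 0
  have h2 : x 1 - y 1 = 0 := congrFun h0 1
  have h3 : x 2 - y 2 = 0 := congrFun h0 2
  ext i; fin_cases i <;> simp <;> linarith

/-- A screw that fixes two points is a multiple of the line through them. -/
lemma exists_smul_joinPts {x y : Fin 3 → ℝ} (h : x ≠ y) {S : Fin 6 → ℝ}
    (hx : velocity x S = 0) (hy : velocity y S = 0) : ∃ w : ℝ, S = w • joinPts x y := by
  have hx0 : S 1 * x 2 - S 2 * x 1 - S 3 = 0 := congrFun hx 0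
  have hx1 : S 2 * x 0 - S 0 * x 2 - S 4 = 0 := congrFun hx 1
  have hx2 : S 0 * x 1 - S 1 * x 0 - S 5 = 0 := congrFun hx 2
  have hy0 : S 1 * y 2 - S 2 * y 1 - S 3 = 0 := congrFun hy 0
  have hy1 : S 2 * y 0 - S 0 * y 2 - S 4 = 0 := congrFun hy 1
  have hy2 : S 0 * y 1 - S 1 * y 0 - S 5 = 0 := congrFun hy 2
  obtain ⟨w, hw⟩ := exists_smul_of_crossProduct_eq_zero (a := x - y) (b := ![S 0, S 1, S 2])
    (sub_ne_zero.2 h) (by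
      rw [cross_apply]
      ext i; fin_cases i <;> simp <;> linarith)
  have h0 : S 0 = w * (x 0 - y 0) := congrFun hw 0
  have h1 : S 1 = w * (x 1 - y 1) := congrFun hw 1
  have h2 : S 2 = w * (x 2 - y 2) := congrFun hw 2
  refine ⟨w, ?_⟩
  rw [joinPts_eq]
  rw [h1, h2] at hx0
  rw [h2, h0] at hx1
  rw [h0, h1] at hx2
  ext i; fin_cases i <;> simp <;> linarith

lemma exists_screw_of_two {x y : Fin 3 → ℝ} (h : x ≠ y) {m n : Fin 3 → ℝ}
    (hmn : (x - y) ⬝ᵥ (m - n) = 0) : ∃ S, velocity x S = m ∧ velocity y S = n := by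
  have hq : (x - y) ⬝ᵥ (x - y) ≠ 0 := dot_self_pos (sub_ne_zero.2 h)
  rw [fin_three_dot] at hmn hq
  simp only [Pi.sub_apply] at hmn hq
  set q := (x 0 - y 0) * (x 0 - y 0) + (x 1 - y 1) * (x 1 - y 1) + (x 2 - y 2) * (x 2 - y 2) with hqd
  obtain ⟨s0, h0⟩ : ∃ s, s * q = (x 1 - y 1) * (m 2 - n 2) - (x 2 - y 2) * (m 1 - n 1) :=
    ⟨_, div_mul_cancel₀ _ hq⟩
  obtain ⟨s1, h1⟩ : ∃ s, s * q = (x 2 - y 2) * (m 0 - n 0) - (x 0 - y 0) * (m 2 - n 2) :=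
    ⟨_, div_mul_cancel₀ _ hq⟩
  obtain ⟨s2, h2⟩ : ∃ s, s * q = (x 0 - y 0) * (m 1 - n 1) - (x 1 - y 1) * (m 0 - n 0) :=
    ⟨_, div_mul_cancel₀ _ hq⟩
  refine ⟨![s0, s1, s2, s1 * x 2 - s2 * x 1 - m 0, s2 * x 0 - s0 * x 2 - m 1,
    s0 * x 1 - s1 * x 0 - m 2], ?_, ?_⟩
  · ext i; fin_cases i <;> simp [velocity]
  · ext i; fin_cases i <;> simp [velocity] <;> apply mul_right_cancel₀ hq
    · linear_combination (y 2 - x 2) * h1 - (y 1 - x 1) * h2 + m 0 * hqd - n 0 * hqd + (x 0 - y 0) * hmn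
    · linear_combination (y 0 - x 0) * h2 - (y 2 - x 2) * h0 + m 1 * hqd - n 1 * hqd + (x 1 - y 1) * hmn
    · linear_combination (y 1 - x 1) * h0 - (y 0 - x 0) * h1 + m 2 * hqd - n 2 * hqd + (x 2 - y 2) * hmn

/-- Three points that do not lie on a line. -/
def NonCollinear (x y z : Fin 3 → ℝ) : Prop := crossProduct (x - z) (y - z) ≠ 0

lemma NonCollinear.ne {x y z : Fin 3 → ℝ} (h : NonCollinear x y z) : x ≠ y := by
  rintro rfl
  exact h (cross_self _)

lemma velocity_smul_joinPts (x y z : Fin 3 → ℝ) :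
    velocity z (joinPts x y) = crossProduct (x - z) (y - z) * (-1) := by
  rw [joinPts_eq, cross_apply]
  ext i; fin_cases i <;> simp [velocity] <;> ring

lemma eq_zero_of_velocity_three {x y z : Fin 3 → ℝ} (h : NonCollinear x y z) {S : Fin 6 → ℝ}
    (hx : velocity x S = 0) (hy : velocity y S = 0) (hz : velocity z S = 0) : S = 0 := by
  obtain ⟨w, rfl⟩ := exists_smul_joinPts h.ne hx hy
  rw [map_smul, velocity_smul_joinPts] at hz
  rcases smul_eq_zero.1 hz with hw | hw
  · rw [hw, zero_smul]
  · exact absurd (by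
      have h1 : -crossProduct (x - z) (y - z) = 0 := by rw [← hw]; ext i; simp
      exact neg_eq_zero.1 h1) h

lemma exists_smul_cross {a b m : Fin 3 → ℝ} (h : crossProduct a b ≠ 0) (ha : a ⬝ᵥ m = 0)
    (hb : b ⬝ᵥ m = 0) : ∃ w : ℝ, m = w • crossProduct a b := by
  apply exists_smul_of_crossProduct_eq_zero h
  rw [fin_three_dot] at ha hb
  rw [cross_apply, cross_apply]
  ext i; fin_cases i <;> simp
  · linear_combination b 0 * ha - a 0 * hb
  · linear_combination b 1 * ha - a 1 * hb
  · linear_combination b 2 * ha - a 2 * hb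

lemma exists_screw_of_three {x y z : Fin 3 → ℝ} (h : NonCollinear x y z) {m n k : Fin 3 → ℝ}
    (hmn : (x - y) ⬝ᵥ (m - n) = 0) (hmk : (x - z) ⬝ᵥ (m - k) = 0)
    (hnk : (y - z) ⬝ᵥ (n - k) = 0) :
    ∃ S, velocity x S = m ∧ velocity y S = n ∧ velocity z S = k := by
  obtain ⟨S, hx, hy⟩ := exists_screw_of_two h.ne hmn
  have h1 := velocity_dot x z S
  have h2 := velocity_dot y z S
  rw [hx] at h1
  rw [hy] at h2
  obtain ⟨w, hw⟩ := exists_smul_cross (m := k - velocity z S) h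
    (by rw [fin_three_dot] at *; simp only [Pi.sub_apply] at *; linarith)
    (by rw [fin_three_dot] at *; simp only [Pi.sub_apply] at *; linarith)
  refine ⟨S - w • joinPts x y, ?_, ?_, ?_⟩
  · rw [map_sub, map_smul, velocity_joinPts_left, smul_zero, sub_zero, hx]
  · rw [map_sub, map_smul, velocity_joinPts_right, smul_zero, sub_zero, hy]
  · rw [map_sub, map_smul, velocity_smul_joinPts]
    rw [sub_eq_iff_eq_add] at hw
    rw [hw]
    ext i
    simp
    ring

/-- Four points that do not lie in a plane. -/
def NonCoplanar (x y z v : Fin 3 → ℝ) : Prop := (Matrix.of ![x - v, y - v, z - v]).det ≠ 0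

lemma NonCoplanar.eq_of_dot {x y z v : Fin 3 → ℝ} (h : NonCoplanar x y z v) {m n : Fin 3 → ℝ}
    (hx : (x - v) ⬝ᵥ (m - n) = 0) (hy : (y - v) ⬝ᵥ (m - n) = 0) (hz : (z - v) ⬝ᵥ (m - n) = 0) :
    m = n := by
  rw [← sub_eq_zero]
  apply Matrix.eq_zero_of_mulVec_eq_zero h
  ext i
  fin_cases i
  · exact hx
  · exact hy
  · exact hz

lemma NonCoplanar.exists_dot {x y z v : Fin 3 → ℝ} (h : NonCoplanar x y z v) (m n k : Fin 3 → ℝ) :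
    ∃ w, (x - v) ⬝ᵥ (m - w) = 0 ∧ (y - v) ⬝ᵥ (n - w) = 0 ∧ (z - v) ⬝ᵥ (k - w) = 0 := by
  obtain ⟨w, hw⟩ := (Matrix.mulVec_surjective_iff_isUnit.2
    ((Matrix.isUnit_iff_isUnit_det _).2 (isUnit_iff_ne_zero.2 h)))
    ![(x - v) ⬝ᵥ m, (y - v) ⬝ᵥ n, (z - v) ⬝ᵥ k]
  refine ⟨w, ?_, ?_, ?_⟩
  · rw [dotProduct_sub, sub_eq_zero]; exact (congrFun hw 0).symm
  · rw [dotProduct_sub, sub_eq_zero]; exact (congrFun hw 1).symm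
  · rw [dotProduct_sub, sub_eq_zero]; exact (congrFun hw 2).symm

/-! Generic configurations -/

section Generic

variable {W W' : Type*}

lemma IsGenericConfig.comp {p : W → Fin 3 → ℝ} (hp : IsGenericConfig p) {f : W' → W}
    (hf : Function.Injective f) : IsGenericConfig (p ∘ f) :=
  AlgebraicIndependent.comp hp (fun x : W' × Fin 3 => (f x.1, x.2)) (by
    rintro ⟨a, i⟩ ⟨b, j⟩ h
    simp only [Prod.mk.injEq] at h
    rw [hf h.1, h.2])

lemma IsGenericConfig.aeval_ne_zero {p : W → Fin 3 → ℝ} (hp : IsGenericConfig p)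
    (F : MvPolynomial (W × Fin 3) ℚ) (hF : ∃ e : W → Fin 3 → ℚ,
      MvPolynomial.aeval (fun x : W × Fin 3 => e x.1 x.2) F ≠ 0) :
    MvPolynomial.aeval (fun x : W × Fin 3 => p x.1 x.2) F ≠ 0 := by
  intro h
  have : F = 0 := hp.eq_zero_of_aeval_eq_zero F h
  obtain ⟨e, he⟩ := hF
  exact he (by rw [this, map_zero])

lemma IsGenericConfig.injective {p : W → Fin 3 → ℝ} (hp : IsGenericConfig p) :
    Function.Injective p := by
  intro a b hab
  have h := AlgebraicIndependent.injective hp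
  have := h (a₁ := (a, 0)) (a₂ := (b, 0)) (by simp [hab])
  exact congrArg Prod.fst this

open Classical in
lemma IsGenericConfig.nonCollinear {p : W → Fin 3 → ℝ} (hp : IsGenericConfig p) {a b c : W}
    (hab : a ≠ b) (hac : a ≠ c) (hbc : b ≠ c) : NonCollinear (p a) (p b) (p c) := by
  have := hp.aeval_ne_zero ((MvPolynomial.X (a, 1) - MvPolynomial.X (c, 1)) *
    (MvPolynomial.X (b, 2) - MvPolynomial.X (c, 2)) - (MvPolynomial.X (a, 2) -
    MvPolynomial.X (c, 2)) * (MvPolynomial.X (b, 1) - MvPolynomial.X (c, 1)))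
    ⟨fun w => if w = a then ![0, 1, 0] else if w = b then ![0, 0, 1] else 0, by
      simp [hab.symm, hac.symm, hbc.symm]⟩
  intro h
  apply this
  rw [cross_apply] at h
  have h0 := congrFun h 0
  simpa using h0

open Classical in
lemma IsGenericConfig.nonCoplanar {p : W → Fin 3 → ℝ} (hp : IsGenericConfig p) {a b c v : W}
    (hab : a ≠ b) (hac : a ≠ c) (hbc : b ≠ c) (hav : a ≠ v) (hbv : b ≠ v) (hcv : c ≠ v) :
    NonCoplanar (p a) (p b) (p c) (p v) := by
  have := hp.aeval_ne_zero (Matrix.of fun i j : Fin 3 =>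
      (MvPolynomial.X (![a, b, c] i, j) - MvPolynomial.X (v, j) :
        MvPolynomial (W × Fin 3) ℚ)).det
    ⟨fun w => if w = a then ![1, 0, 0] else if w = b then ![0, 1, 0] else
      if w = c then ![0, 0, 1] else 0, by
      rw [Matrix.det_fin_three]
      simp [hab.symm, hac.symm, hbc.symm, hav.symm, hbv.symm, hcv.symm]⟩
  intro h
  apply this
  rw [Matrix.det_fin_three] at h ⊢
  simpa using h

lemma infinite_of_isTranscendenceBasis_real {T : Set ℝ}
    (hT : IsTranscendenceBasis ℚ ((↑) : T → ℝ)) : T.Infinite := by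
  intro hfin
  have hc : Cardinal.mk ℝ ≤ Cardinal.aleph0 := by
    have halg := hT.isAlgebraic
    refine (Algebra.IsAlgebraic.cardinalMk_le_max (Algebra.adjoin ℚ (Set.range ((↑) : T → ℝ)))
      ℝ).trans (max_le ?_ le_rfl)
    have hfin' := hfin.to_subtype
    rw [← Cardinal.mk_congr hT.1.aevalEquiv.toEquiv]
    exact MvPolynomial.cardinalMk_le_max.trans (by simp)
  exact not_le_of_gt Cardinal.aleph0_lt_continuum (by rwa [← Cardinal.mk_real])

lemma AlgebraicIndependent.exists_infinite_superset {ι : Type*} {x : ι → ℝ}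
    (hx : AlgebraicIndependent ℚ x) :
    ∃ T : Set ℝ, Set.range x ⊆ T ∧ T.Infinite ∧ AlgebraicIndependent ℚ ((↑) : T → ℝ) := by
  obtain ⟨T, hsT, hT⟩ := exists_isTranscendenceBasis_superset hx.coe_range
  exact ⟨T, hsT, infinite_of_isTranscendenceBasis_real hT, hT.1⟩

open Classical in
lemma exists_injective_extension {ι κ : Type*} [Finite κ] {x : ι → ℝ} (hx : Function.Injective x)
    {f : ι → κ} (hf : Function.Injective f) {T : Set ℝ} (hT : T.Infinite) (hxT : ∀ i, x i ∈ T) :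
    ∃ y : κ → ℝ, Function.Injective y ∧ (∀ k, y k ∈ T) ∧ ∀ i, y (f i) = x i := by
  have : Finite ι := Finite.of_injective f hf
  have hinf : (T \ Set.range x).Infinite := hT.sdiff (Set.finite_range x)
  have := hinf.to_subtype
  obtain ⟨n, ⟨e₁⟩⟩ := Finite.exists_equiv_fin κ
  obtain ⟨e⟩ : Nonempty (κ ↪ (T \ Set.range x : Set ℝ)) :=
    ⟨(e₁.toEmbedding.trans Fin.valEmbedding).trans (Infinite.natEmbedding _)⟩
  refine ⟨fun k => if h : ∃ i, f i = k then x h.choose else e k, ?_, ?_, ?_⟩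
  · intro k l h
    dsimp only at h
    split_ifs at h with h1 h2 h2
    · rw [← h1.choose_spec, ← h2.choose_spec, hx h]
    · exact absurd ⟨_, h⟩ (e l).2.2
    · exact absurd ⟨_, h.symm⟩ (e k).2.2
    · exact e.injective (Subtype.ext h)
  · intro k
    dsimp only
    split_ifs with h
    · exact hxT _
    · exact (e k).2.1
  · intro i
    have h : ∃ j, f j = f i := ⟨i, rfl⟩
    dsimp only
    rw [dif_pos h, hf h.choose_spec]

lemma IsGenericConfig.exists_extension [Finite W'] {p : W → Fin 3 → ℝ}
    (hp : IsGenericConfig p) {f : W → W'} (hf : Function.Injective f) :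
    ∃ q : W' → Fin 3 → ℝ, IsGenericConfig q ∧ ∀ w, q (f w) = p w := by
  have hp' : AlgebraicIndependent ℚ fun x : W × Fin 3 => p x.1 x.2 := hp
  obtain ⟨T, hsT, hT, hT'⟩ := hp'.exists_infinite_superset
  have hf' : Function.Injective (Prod.map f id : W × Fin 3 → W' × Fin 3) :=
    hf.prodMap Function.injective_id
  obtain ⟨y, hy, hyT, hyf⟩ := exists_injective_extension hp'.injective hf' hT
    fun i => hsT ⟨i, rfl⟩
  refine ⟨fun w i => y (w, i), ?_, fun w => funext fun i => hyf (w, i)⟩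
  exact AlgebraicIndependent.comp hT' (fun k => ⟨y k, hyT k⟩)
    fun k l h => hy (congrArg Subtype.val h)

end Generic

namespace SphericalPolyhedron

variable (R : SphericalPolyhedron.{u})

/-- The line of the edge of a dart. -/
def dartLine (p : R.V → Fin 3 → ℝ) (d : R.D) : Fin 6 → ℝ :=
  joinPts (p (R.tail d)) (p (R.tail (R.rev d)))

/-- Every infinitesimal motion of the vertices that preserves the edges and the faces not in `B` is
trivial. -/
def InfRigid (B : Set R.F) (p : R.V → Fin 3 → ℝ) : Prop :=
  ∀ m : R.V → Fin 3 → ℝ,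
    (∀ d, (p (R.tail d) - p (R.tail (R.rev d))) ⬝ᵥ (m (R.tail d) - m (R.tail (R.rev d))) = 0) →
    (∀ f, f ∉ B → ∃ S, ∀ d, R.left d = f → velocity (p (R.tail d)) S = m (R.tail d)) →
    ∃ S, ∀ v, velocity (p v) S = m v

open Classical in
/-- Scalars on the edges and loads on the corners of the faces in `B`, in equilibrium at every
vertex and on every face, come from scalars on the boundary polygons of those faces. -/
def StressFree (B : Set R.F) (p : R.V → Fin 3 → ℝ) : Prop :=
  ∀ (l : R.D → ℝ) (L : R.D → Fin 6 → ℝ), (∀ d, l (R.rev d) = l d) →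
    (∀ d, velocity (p (R.tail d)) (L d) = 0) → (∀ d, R.left d ∉ B → L d = 0) →
    (∀ f, ∑ d with R.left d = f, L d = 0) →
    (∀ v, ∑ d with R.tail d = v, (l d • R.dartLine p d + L d) = 0) →
    ∃ μ : R.D → ℝ, (∀ d, R.left d ∉ B → μ d = 0) ∧
      (∀ d, L (R.next d) = μ (R.next d) • R.dartLine p (R.next d) - μ d • R.dartLine p d) ∧
      ∀ d, l d + μ d + μ (R.rev d) = 0

open Classical in
lemma exists_boundary_potential {M : Type*} [AddCommGroup M] (L : R.D → M)
    (h : ∀ f, ∑ d with R.left d = f, L d = 0) :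
    ∃ b : R.D → M, ∀ d, b (R.next d) - b d = L (R.next d) := by
  choose r hr using R.left_surjective
  have hex : ∀ d, ∃ n : ℕ, (R.next ^ n) (r (R.left d)) = d := fun d =>
    (R.face_orbit _ _ (hr (R.left d))).exists_nat_pow_eq
  let n : R.D → ℕ := fun d => Nat.find (hex d)
  have hn : ∀ d, (R.next ^ n d) (r (R.left d)) = d := fun d => Nat.find_spec (hex d)
  let b : R.D → M := fun d => ∑ i ∈ Finset.range (n d), L ((R.next ^ (i + 1)) (r (R.left d)))
  have hstep : ∀ d, R.next d ≠ r (R.left d) → b (R.next d) - b d = L (R.next d) := by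
    intro d hd
    have hnn : n (R.next d) = n d + 1 := by
      apply le_antisymm
      · apply Nat.find_min'
        rw [R.left_next, pow_succ', Equiv.Perm.mul_apply, hn]
      · have h1 := hn (R.next d)
        rw [R.left_next] at h1
        cases hk : n (R.next d) with
        | zero =>
          rw [hk] at h1
          exact absurd h1.symm hd
        | succ k =>
          rw [hk, pow_succ', Equiv.Perm.mul_apply] at h1
          have : n d ≤ k := Nat.find_min' (hex d) (R.next.injective h1)
          omega
    simp only [b]
    rw [R.left_next, hnn, Finset.sum_range_succ, add_sub_cancel_left, pow_succ',
      Equiv.Perm.mul_apply, hn]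
  refine ⟨b, fun d => ?_⟩
  by_cases hd : R.next d = r (R.left d)
  · have hsum : ∑ e with R.left e = R.left d, (b (R.next e) - b e - L (R.next e)) = 0 := by
      rw [Finset.sum_sub_distrib, Finset.sum_sub_distrib, R.sum_next _ b, R.sum_next _ L, h,
        sub_self, sub_zero]
    rw [Finset.sum_eq_single d] at hsum
    · exact sub_eq_zero.1 hsum
    · intro e he hed
      have he' : R.left e = R.left d := (Finset.mem_filter.1 he).2
      rw [hstep e, sub_self]
      rw [he', ← hd]
      exact fun h => hed (R.next.injective h)
    · simp
  · exact hstep d hd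

variable {R} {p : R.V → Fin 3 → ℝ}

lemma dartLine_rev (d : R.D) : R.dartLine p (R.rev d) = -R.dartLine p d := by
  rw [dartLine, dartLine, R.rev_rev, joinPts_swap]

lemma velocity_dartLine_tail (d : R.D) : velocity (p (R.tail d)) (R.dartLine p d) = 0 :=
  velocity_joinPts_left _ _

lemma dartLine_ne_zero (hp : IsGenericConfig p) (d : R.D) : R.dartLine p d ≠ 0 :=
  joinPts_ne_zero (hp.injective.ne (R.tail_rev_ne d).symm)

lemma smul_dartLine_inj (hp : IsGenericConfig p) {d : R.D} {a b : ℝ}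
    (h : a • R.dartLine p d = b • R.dartLine p d) : a = b :=
  smul_left_injective ℝ (dartLine_ne_zero hp d) h

lemma exists_smul_dartLine (hp : IsGenericConfig p) (d : R.D) {S : Fin 6 → ℝ}
    (h1 : velocity (p (R.tail d)) S = 0) (h2 : velocity (p (R.tail (R.rev d))) S = 0) :
    ∃ w : ℝ, S = w • R.dartLine p d :=
  exists_smul_joinPts (hp.injective.ne (R.tail_rev_ne d).symm) h1 h2

lemma nonCollinear_face (hp : IsGenericConfig p) (d : R.D) : NonCollinear (p (R.tail d))
    (p (R.tail (R.next d))) (p (R.tail (R.next (R.next d)))) := by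
  apply hp.nonCollinear
  · rw [R.tail_next]
    exact (R.tail_rev_ne d).symm
  · rw [R.tail_next (R.next d)]
    exact (R.tail_rev_next_ne d).symm
  · rw [R.tail_next (R.next d)]
    exact (R.tail_rev_ne _).symm

/-- A screw is determined by its effect on the vertices of a face. -/
lemma screw_eq_of_face (hp : IsGenericConfig p) {f : R.F} {S T : Fin 6 → ℝ}
    (h : ∀ d, R.left d = f → velocity (p (R.tail d)) S = velocity (p (R.tail d)) T) : S = T := by
  obtain ⟨d, hd⟩ := R.left_surjective f
  rw [← sub_eq_zero]
  apply eq_zero_of_velocity_three (nonCollinear_face hp d)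
  · rw [map_sub, sub_eq_zero, h d hd]
  · rw [map_sub, sub_eq_zero, h _ ((R.left_next d).trans hd)]
  · rw [map_sub, sub_eq_zero, h _ ((R.left_next _).trans ((R.left_next d).trans hd))]

lemma exists_vertex_function {α : Type*} (g : R.D → α) (h : ∀ d, g (R.next (R.rev d)) = g d) :
    ∃ m : R.V → α, ∀ d, m (R.tail d) = g d := by
  choose δ hδ using R.exists_tail_eq
  exact ⟨fun v => g (δ v), fun d => (R.vertex_orbit _ _ (hδ _)).apply_eq_of_invariant g h⟩

theorem InfRigid.stressFree {B : Set R.F} (hp : IsGenericConfig p) (h : R.InfRigid B p) :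
    R.StressFree B p := by
  classical
  intro l L hl hL hL0 hLf hLv
  obtain ⟨b, hb, hb0⟩ : ∃ b : R.D → Fin 6 → ℝ,
      (∀ d, b (R.next d) - b d = L (R.next d)) ∧ ∀ d, R.left d ∉ B → b d = 0 := by
    obtain ⟨b, hb⟩ := R.exists_boundary_potential L hLf
    refine ⟨fun d => if R.left d ∈ B then b d else 0, fun d => ?_, fun d hd => if_neg hd⟩
    dsimp only
    rw [R.left_next]
    split_ifs with hd
    · exact hb d
    · rw [hL0 _ (by rwa [R.left_next]), sub_zero]
  obtain ⟨S, hS⟩ := R.exists_face_potential_vec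
    (fun d => l d • R.dartLine p d + b d - b (R.rev d))
    (fun d => by
      rw [hl, dartLine_rev, R.rev_rev, smul_neg]
      abel)
    (fun v => by
      have h1 : ∑ d with R.tail d = v, b (R.rev d) = ∑ d with R.tail d = v, (b d - L d) := by
        rw [← R.sum_rot v (fun d => b d - L d)]
        exact Finset.sum_congr rfl fun d _ => by rw [← hb]; abel
      rw [Finset.sum_sub_distrib, h1, ← Finset.sum_sub_distrib, ← hLv v]
      exact Finset.sum_congr rfl fun d _ => by abel)
  obtain ⟨m, hm⟩ := exists_vertex_function
    (fun d => velocity (p (R.tail d)) (S (R.left d) - b d)) (fun d => by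
      have h1 : S (R.left d) - b d = (S (R.left (R.rev d)) - b (R.next (R.rev d))) +
          (l d • R.dartLine p d + L (R.next (R.rev d))) := by
        rw [← hb, ← sub_eq_zero]
        have := hS d
        rw [eq_sub_iff_add_eq] at this
        rw [← this]
        abel
      have h2 := hL (R.next (R.rev d))
      rw [R.tail_rot] at h2
      rw [h1, map_add, map_add, map_smul, velocity_dartLine_tail, h2, R.left_rot, R.tail_rot]
      simp)
  have hm' : ∀ d, m (R.tail (R.rev d)) =
      velocity (p (R.tail (R.rev d))) (S (R.left d) - b d) := by
    intro d
    rw [← R.tail_next, hm, R.left_next]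
    have h1 : b (R.next d) = b d + L (R.next d) := by rw [← hb]; abel
    rw [h1, ← sub_sub, map_sub, hL, sub_zero]
  obtain ⟨T, hT⟩ := h m (fun d => by rw [hm, hm']; exact velocity_dot _ _ _) (fun f hf =>
    ⟨S f, fun d hd => by
      rw [hm, hd, hb0 d (by rwa [hd]), sub_zero]⟩)
  have hW : ∀ d, ∃ c : ℝ, S (R.left d) - b d - T = c • R.dartLine p d := fun d =>
    exists_smul_dartLine hp d (by rw [map_sub, ← hm, hT, sub_self])
      (by rw [map_sub, ← hm', hT, sub_self])
  choose c hc using hW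
  refine ⟨fun d => -c d, fun d hd => ?_, fun d => ?_, fun d => ?_⟩
  · have h1 : S (R.left d) = T := screw_eq_of_face hp fun e he => by
      rw [hT, hm, he, hb0 e (by rwa [he]), sub_zero]
    have h2 := hc d
    rw [h1, hb0 d hd, sub_zero, sub_self, ← zero_smul ℝ (R.dartLine p d)] at h2
    exact neg_eq_zero.2 (smul_dartLine_inj hp h2).symm
  · rw [neg_smul, neg_smul, ← hc, ← hc, ← hb, R.left_next]
    abel
  · have h1 := hc (R.rev d)
    rw [dartLine_rev, smul_neg] at h1
    have h2 : l d • R.dartLine p d = (c d + c (R.rev d)) • R.dartLine p d := by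
      rw [add_smul, ← hc d, ← neg_eq_iff_eq_neg.2 h1]
      have := hS d
      rw [eq_sub_iff_add_eq] at this
      rw [← this]
      abel
    rw [smul_dartLine_inj hp h2]
    ring

theorem StressFree.infRigid {B : Set R.F} (hp : IsGenericConfig p) (h : R.StressFree B p) :
    R.InfRigid B p := by
  classical
  intro m hm hf
  obtain ⟨b, hb1, hb2, hb3⟩ : ∃ b : R.D → Fin 6 → ℝ,
      (∀ d, velocity (p (R.tail d)) (b d) = m (R.tail d)) ∧
      (∀ d, velocity (p (R.tail (R.rev d))) (b d) = m (R.tail (R.rev d))) ∧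
      ∀ d, R.left d ∉ B → b (R.next d) = b d := by
    have h1 : ∀ d, ∃ S, velocity (p (R.tail d)) S = m (R.tail d) ∧
        velocity (p (R.tail (R.rev d))) S = m (R.tail (R.rev d)) := fun d =>
      exists_screw_of_two (hp.injective.ne (R.tail_rev_ne d).symm) (hm d)
    choose s hs using h1
    have h2 : ∀ f, ∃ S, f ∉ B → ∀ d, R.left d = f →
        velocity (p (R.tail d)) S = m (R.tail d) := fun f => by
      by_cases hfB : f ∈ B
      · exact ⟨0, fun h => absurd hfB h⟩
      · obtain ⟨S, hS⟩ := hf f hfB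
        exact ⟨S, fun _ => hS⟩
    choose t ht using h2
    refine ⟨fun d => if R.left d ∈ B then s d else t (R.left d), fun d => ?_, fun d => ?_,
      fun d hd => ?_⟩
    · dsimp only
      split_ifs with hd
      · exact (hs d).1
      · exact ht _ hd d rfl
    · dsimp only
      split_ifs with hd
      · exact (hs d).2
      · rw [← R.tail_next]
        exact ht _ hd _ (R.left_next d)
    · dsimp only
      rw [R.left_next, if_neg hd, if_neg hd]
  have hl : ∀ d, ∃ w : ℝ, b d - b (R.rev d) = w • R.dartLine p d := fun d =>
    exists_smul_dartLine hp d
      (by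
        have := hb2 (R.rev d)
        rw [R.rev_rev] at this
        rw [map_sub, hb1, this, sub_self])
      (by rw [map_sub, hb2, hb1, sub_self])
  choose l hl using hl
  have hLn : ∀ d, b (R.next.symm (R.next d)) = b d := fun d => by rw [Equiv.symm_apply_apply]
  obtain ⟨μ, -, hμ1, hμ2⟩ := h l (fun d => b (R.next.symm d) - b d)
    (fun d => by
      have h1 := hl (R.rev d)
      rw [R.rev_rev, dartLine_rev, smul_neg, ← neg_sub, hl d, neg_inj] at h1
      exact (smul_dartLine_inj hp h1).symm)
    (fun d => by
      have h1 := hb2 (R.next.symm d)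
      rw [← R.tail_self] at h1
      rw [map_sub, hb1, h1, sub_self])
    (fun d hd => by
      have h1 := hb3 (R.next.symm d) (by rwa [R.left_symm])
      rw [Equiv.apply_symm_apply] at h1
      rw [h1, sub_self])
    (fun f => by
      rw [← R.sum_next]
      simp only [hLn]
      rw [Finset.sum_sub_distrib, R.sum_next f b, sub_self])
    (fun v => by
      rw [Finset.sum_add_distrib, ← R.sum_rot v (fun d => b (R.next.symm d) - b d)]
      simp only [hLn, ← hl]
      rw [Finset.sum_sub_distrib, Finset.sum_sub_distrib, R.sum_rot v b]
      abel)
  simp only [hLn] at hμ1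
  have hnext : ∀ d, b (R.next d) + μ (R.next d) • R.dartLine p (R.next d) =
      b d + μ d • R.dartLine p d := fun d => by
    have := hμ1 d
    rw [eq_sub_iff_add_eq] at this
    rw [← this]
    abel
  have hrev : ∀ d, b d + μ d • R.dartLine p d =
      b (R.rev d) + μ (R.rev d) • R.dartLine p (R.rev d) := fun d => by
    have h1 : (l d + μ d + μ (R.rev d)) • R.dartLine p d = 0 := by rw [hμ2, zero_smul]
    rw [add_smul, add_smul, ← hl] at h1
    rw [dartLine_rev, smul_neg, ← sub_eq_zero, ← h1]
    abel
  choose δ hδ using R.left_surjective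
  have hface : ∀ d, b (δ (R.left d)) + μ (δ (R.left d)) • R.dartLine p (δ (R.left d)) =
      b d + μ d • R.dartLine p d := fun d =>
    (R.face_orbit _ _ (hδ (R.left d))).apply_eq_of_invariant
      (fun d => b d + μ d • R.dartLine p d) hnext
  have hconst := R.eq_of_face_invariant
    (fun f => b (δ f) + μ (δ f) • R.dartLine p (δ f)) (fun d => by
      rw [hface, hface, hrev])
  obtain ⟨v₀⟩ : Nonempty R.V := Fintype.card_pos_iff.1 (by have := R.threeConnected.1; omega)
  obtain ⟨d₀, -⟩ := R.exists_tail_eq v₀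
  refine ⟨b d₀ + μ d₀ • R.dartLine p d₀, fun v => ?_⟩
  obtain ⟨d, rfl⟩ := R.exists_tail_eq v
  have h1 := hconst (R.left d₀) (R.left d)
  rw [hface, hface] at h1
  rw [h1, map_add, map_smul, velocity_dartLine_tail, smul_zero, add_zero, hb1]

theorem stressFree_iff_infRigid {B : Set R.F} (hp : IsGenericConfig p) :
    R.StressFree B p ↔ R.InfRigid B p :=
  ⟨fun h => h.infRigid hp, fun h => h.stressFree hp⟩

end SphericalPolyhedron

namespace SphericalPolyhedron

def GenericallyInfRigid (R : SphericalPolyhedron.{u}) (B : Set R.F) : Prop :=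
  ∀ p : R.V → Fin 3 → ℝ, IsGenericConfig p → R.InfRigid B p

variable (R : SphericalPolyhedron.{u}) (c : R.D)

lemma gusset_edges_iff (E : Option R.V → Option R.V → Prop) (hE : ∀ x y, E x y → E y x) :
    (∀ x, E (R.gussetTail c x) (R.gussetTail c (R.gussetRev x))) ↔
      (∀ d, E (some (R.tail d)) (some (R.tail (R.rev d)))) ∧
      E (some (R.tail (R.next.symm c))) none ∧ E (some (R.tail c)) none ∧
      E (some (R.tail (R.rev c))) none := by
  constructor
  · intro h
    exact ⟨fun d => h (Sum.inl d), h (Sum.inr 2), h (Sum.inr 0), h (Sum.inr 5)⟩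
  · rintro ⟨h, h1, h2, h3⟩ (d | i)
    · exact h d
    · fin_cases i
      · exact h2
      · exact hE _ _ h2
      · exact h1
      · exact hE _ _ h1
      · exact hE _ _ h3
      · exact h3

lemma gusset_face_iff_of_ne (C : Option R.V → Prop) {f : R.F} (hf : f ≠ R.left c) :
    (∀ x, R.gussetLeft c x = Sum.inl f → C (R.gussetTail c x)) ↔
      ∀ d, R.left d = f → C (some (R.tail d)) := by
  constructor
  · intro h d hd
    refine h (Sum.inl d) ?_
    rw [R.gussetLeft_of_ne c (fun h => hf (by rw [← hd, h, R.left_symm]))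
      (fun h => hf (by rw [← hd, h])), hd]
  · intro h x hx
    rcases R.gusset_face_cases c x with ⟨hx', -⟩ | ⟨hx', -⟩ | ⟨d, rfl, hx'⟩
    · rw [hx'] at hx
      cases hx
    · rw [hx'] at hx
      cases hx
    · rw [hx', Sum.inl.injEq] at hx
      rw [R.gussetRepl_of_ne c (fun h => hf (by rw [← hx, h, R.left_symm]))
        (fun h => hf (by rw [← hx, h]))]
      exact h d hx

lemma gusset_face_iff_self (C : Option R.V → Prop) :
    (∀ x, R.gussetLeft c x = Sum.inl (R.left c) → C (R.gussetTail c x)) ↔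
      (∀ d, R.left d = R.left c → d ≠ c → C (some (R.tail d))) ∧ C none := by
  constructor
  · intro h
    refine ⟨fun d hd hdc => ?_, h (Sum.inr 4) rfl⟩
    by_cases h1 : d = R.next.symm c
    · subst h1
      exact h (Sum.inr 2) rfl
    · exact h (Sum.inl d) (by rw [R.gussetLeft_of_ne c h1 hdc, hd])
  · rintro ⟨h, h'⟩ x hx
    rcases R.gusset_face_cases c x with ⟨hx', -⟩ | ⟨hx', -⟩ | ⟨d, rfl, hx'⟩
    · rw [hx'] at hx
      cases hx
    · rw [hx'] at hx
      cases hx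
    · rw [hx', Sum.inl.injEq] at hx
      by_cases h2 : d = c
      · subst h2
        rw [R.gussetRepl_self]
        exact h'
      by_cases h1 : d = R.next.symm c
      · have h3 := h d hx h2
        rw [h1] at h3
        rw [h1, R.gussetRepl_symm]
        exact h3
      rw [R.gussetRepl_of_ne c h1 h2]
      exact h d hx h2

lemma gusset_face_zero (C : Option R.V → Prop) (h1 : C (some (R.tail (R.next.symm c))))
    (h2 : C (some (R.tail c))) (h3 : C none) (x : R.D ⊕ Fin 6)
    (hx : R.gussetLeft c x = Sum.inr 0) : C (R.gussetTail c x) := by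
  rcases x with d | i
  · by_cases hd : d = R.next.symm c
    · subst hd
      exact h1
    by_cases hd' : d = c
    · subst hd'
      exact h2
    rw [R.gussetLeft_of_ne c hd hd'] at hx
    cases hx
  · fin_cases i
    · exact h2
    · exact h3
    · exact h1
    · exact h3
    · exact h3
    · cases hx

lemma gusset_face_one (C : Option R.V → Prop) (h1 : C (some (R.tail (R.rev c))))
    (h2 : C (some (R.tail c))) (h3 : C none) (x : R.D ⊕ Fin 6)
    (hx : R.gussetLeft c x = Sum.inr 1) : C (R.gussetTail c x) := by
  rcases x with d | i
  · by_cases hd : d = R.next.symm c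
    · subst hd
      rw [R.gussetLeft_symm] at hx
      cases hx
    by_cases hd' : d = c
    · subst hd'
      exact h2
    rw [R.gussetLeft_of_ne c hd hd'] at hx
    cases hx
  · fin_cases i
    · exact h2
    · exact h3
    · cases hx
    · exact h3
    · exact h3
    · exact h1

/-- A motion that is trivial on three points is trivial on a fourth one joined to them. -/
lemma velocity_eq_of_three_edges {x y z v m : Fin 3 → ℝ} (h : NonCoplanar x y z v)
    {S : Fin 6 → ℝ} (hx : (x - v) ⬝ᵥ (velocity x S - m) = 0)
    (hy : (y - v) ⬝ᵥ (velocity y S - m) = 0) (hz : (z - v) ⬝ᵥ (velocity z S - m) = 0) :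
    velocity v S = m := by
  have key : ∀ x : Fin 3 → ℝ, (x - v) ⬝ᵥ (velocity x S - m) = 0 →
      (x - v) ⬝ᵥ (velocity v S - m) = 0 := fun x hx => by
    have h1 := velocity_dot x v S
    have h2 : velocity v S - m = (velocity x S - m) - (velocity x S - velocity v S) := by abel
    rw [h2, dotProduct_sub, hx, h1, sub_zero]
  exact h.eq_of_dot (key x hx) (key y hy) (key z hz)

lemma dot_symm (x y m n : Fin 3 → ℝ) (h : (x - y) ⬝ᵥ (m - n) = 0) :
    (y - x) ⬝ᵥ (n - m) = 0 := by
  rw [← neg_sub x y, ← neg_sub m n, neg_dotProduct_neg, h]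

theorem infRigid_gusset_iff {B : Set R.F} {q : Option R.V → Fin 3 → ℝ} (hq : IsGenericConfig q) :
    (R.gusset c).InfRigid (Sum.inl '' B) q ↔ R.InfRigid B (q ∘ some) := by
  have hau : R.tail (R.next.symm c) ≠ R.tail c := R.tail_symm_ne c
  have hwu : R.tail (R.rev c) ≠ R.tail c := R.tail_rev_ne c
  have hwa : R.tail (R.rev c) ≠ R.tail (R.next.symm c) := R.tail_rev_ne_tail_symm c
  obtain ⟨a, ha⟩ : ∃ a, R.tail (R.next.symm c) = a := ⟨_, rfl⟩
  obtain ⟨u, hu⟩ : ∃ u, R.tail c = u := ⟨_, rfl⟩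
  obtain ⟨w, hw⟩ : ∃ w, R.tail (R.rev c) = w := ⟨_, rfl⟩
  have hua : R.tail (R.rev (R.next.symm c)) = u := by rw [← R.tail_self, hu]
  rw [ha, hu] at hau
  rw [hw, hu] at hwu
  rw [ha, hw] at hwa
  have hnc : NonCoplanar (q (some a)) (q (some u)) (q (some w)) (q none) :=
    hq.nonCoplanar (by simpa) (by simpa using hwa.symm) (by simpa using hwu.symm) (by simp)
      (by simp) (by simp)
  have hnc' : NonCoplanar (q (some a)) (q (some w)) (q none) (q (some u)) :=
    hq.nonCoplanar (by simpa using hwa.symm) (by simp) (by simp) (by simpa)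
      (by simpa) (by simp)
  have hE : ∀ m : Option R.V → Fin 3 → ℝ, (∀ x : (R.gusset c).D,
      (q ((R.gusset c).tail x) - q ((R.gusset c).tail ((R.gusset c).rev x))) ⬝ᵥ
      (m ((R.gusset c).tail x) - m ((R.gusset c).tail ((R.gusset c).rev x))) = 0) ↔
      (∀ d, (q (some (R.tail d)) - q (some (R.tail (R.rev d)))) ⬝ᵥ
        (m (some (R.tail d)) - m (some (R.tail (R.rev d)))) = 0) ∧
      (q (some a) - q none) ⬝ᵥ (m (some a) - m none) = 0 ∧
      (q (some u) - q none) ⬝ᵥ (m (some u) - m none) = 0 ∧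
      (q (some w) - q none) ⬝ᵥ (m (some w) - m none) = 0 := fun m => by
    rw [← ha, ← hu, ← hw]
    exact R.gusset_edges_iff c (fun x y => (q x - q y) ⬝ᵥ (m x - m y) = 0)
      (fun x y => dot_symm _ _ _ _)
  constructor
  · intro h m hm hf
    obtain ⟨n, hn1, hn2, hn3, hn⟩ : ∃ n, (q (some a) - q none) ⬝ᵥ (m a - n) = 0 ∧
        (q (some u) - q none) ⬝ᵥ (m u - n) = 0 ∧ (q (some w) - q none) ⬝ᵥ (m w - n) = 0 ∧
        (R.left c ∉ B → ∃ S, (∀ d, R.left d = R.left c →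
          velocity (q (some (R.tail d))) S = m (R.tail d)) ∧ velocity (q none) S = n) := by
      by_cases hB : R.left c ∈ B
      · obtain ⟨n, h1, h2, h3⟩ := hnc.exists_dot (m a) (m u) (m w)
        exact ⟨n, h1, h2, h3, fun h => absurd hB h⟩
      · obtain ⟨S, hS⟩ := hf _ hB
        refine ⟨velocity (q none) S, ?_, ?_, ?_, fun _ => ⟨S, hS, rfl⟩⟩
        · rw [← ha, ← hS _ (R.left_symm c)]
          exact velocity_dot _ _ _
        · rw [← hu, ← hS _ rfl]
          exact velocity_dot _ _ _
        · rw [← hw, ← R.tail_next, ← hS _ (R.left_next c)]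
          exact velocity_dot _ _ _
    have hTri : ∀ x y : R.V, x ≠ y → (q (some x) - q (some y)) ⬝ᵥ (m x - m y) = 0 →
        (q (some x) - q none) ⬝ᵥ (m x - n) = 0 → (q (some y) - q none) ⬝ᵥ (m y - n) = 0 →
        ∃ S, velocity (q (some x)) S = m x ∧ velocity (q (some y)) S = m y ∧
          velocity (q none) S = n := fun x y hxy h1 h2 h3 =>
      exists_screw_of_three (hq.nonCollinear (by simpa) (by simp) (by simp)) h1 h2 h3
    obtain ⟨S, hS⟩ := h (fun x => x.elim n m) ((hE fun x => x.elim n m).2 ⟨hm, hn1, hn2, hn3⟩) (by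
      rintro (f | i) hf'
      · have hfB : f ∉ B := fun h => hf' ⟨f, h, rfl⟩
        by_cases hfc : f = R.left c
        · subst hfc
          obtain ⟨S, hS1, hS2⟩ := hn hfB
          exact ⟨S, (R.gusset_face_iff_self c
            (fun x => velocity (q x) S = Option.elim x n m)).2 ⟨fun d hd _ => hS1 d hd, hS2⟩⟩
        · obtain ⟨S, hS⟩ := hf f hfB
          exact ⟨S, (R.gusset_face_iff_of_ne c
            (fun x => velocity (q x) S = Option.elim x n m) hfc).2 hS⟩
      · fin_cases i
        · obtain ⟨S, h1, h2, h3⟩ := hTri a u hau (by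
            have := hm (R.next.symm c)
            rwa [hua, ha] at this) hn1 hn2
          exact ⟨S, R.gusset_face_zero c (fun x => velocity (q x) S = Option.elim x n m)
            (by rw [ha]; exact h1) (by rw [hu]; exact h2) h3⟩
        · obtain ⟨S, h1, h2, h3⟩ := hTri u w hwu.symm (by
            have := hm c
            rwa [hu, hw] at this) hn2 hn3
          exact ⟨S, R.gusset_face_one c (fun x => velocity (q x) S = Option.elim x n m)
            (by rw [hw]; exact h2) (by rw [hu]; exact h1) h3⟩)
    exact ⟨S, fun v => hS (some v)⟩
  · intro h m hm hf
    obtain ⟨hm0, hm1, hm2, hm3⟩ := (hE m).1 hm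
    obtain ⟨S, hS⟩ := h (m ∘ some) hm0 (by
      intro f hfB
      obtain ⟨S, hS⟩ := hf (Sum.inl f) (by
        rintro ⟨g, hg, hgf⟩
        rw [← Sum.inl.inj hgf] at hfB
        exact hfB hg)
      refine ⟨S, ?_⟩
      by_cases hfc : f = R.left c
      · subst hfc
        obtain ⟨h1, h2⟩ := (R.gusset_face_iff_self c
          (fun x => velocity (q x) S = m x)).1 hS
        intro d hd
        by_cases hdc : d = c
        · subst hdc
          have h3 := h1 _ (R.left_symm d) (R.symm_ne d)
          have h4 := h1 _ (R.left_next d) (R.next_ne d)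
          rw [R.tail_next, hw] at h4
          rw [ha] at h3
          rw [hu]
          have h5 := hm0 (R.next.symm d)
          have h6 := hm0 d
          rw [hua, ha] at h5
          rw [hu, hw] at h6
          exact velocity_eq_of_three_edges hnc' (by rw [h3]; exact h5)
            (by rw [h4]; exact dot_symm _ _ _ _ h6) (by rw [h2]; exact dot_symm _ _ _ _ hm2)
        · exact h1 d hd hdc
      · exact (R.gusset_face_iff_of_ne c (fun x => velocity (q x) S = m x) hfc).1 hS)
    have hS' : ∀ v, velocity (q (some v)) S = m (some v) := hS
    refine ⟨S, ?_⟩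
    rintro (_ | v)
    · exact velocity_eq_of_three_edges hnc (by rw [hS']; exact hm1) (by rw [hS']; exact hm2)
        (by rw [hS']; exact hm3)
    · exact hS' v

theorem genericallyInfRigid_gusset_iff {B : Set R.F} :
    (R.gusset c).GenericallyInfRigid (Sum.inl '' B) ↔ R.GenericallyInfRigid B := by
  constructor
  · intro h p hp
    obtain ⟨q, hq, hqp⟩ := hp.exists_extension (Option.some_injective R.V)
    have h1 := (R.infRigid_gusset_iff c hq).1 (h q hq)
    rwa [show q ∘ some = p from funext hqp] at h1
  · intro h q hq
    exact (R.infRigid_gusset_iff c hq).2 (h _ (IsGenericConfig.comp hq (Option.some_injective R.V)))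

end SphericalPolyhedron

namespace BlockHolePolyhedron

theorem Gusseting.genericallyInfRigid_iff {P Q : BlockHolePolyhedron.{u}} (h : P.Gusseting Q)
    {k : FaceKind} (hk : k ≠ .surface) :
    Q.GenericallyInfRigid {f | Q.kind f = k} ↔ P.GenericallyInfRigid {f | P.kind f = k} := by
  induction h with
  | refl => rfl
  | @step Q h c hc ih =>
    rw [← ih, ← Q.genericallyInfRigid_gusset_iff c]
    have : {f | (Q.gusset c hc).kind f = k} = Sum.inl '' {f | Q.kind f = k} := by
      ext f
      constructor
      · rcases f with f | i
        · exact fun hf => ⟨f, hf, rfl⟩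
        · exact fun hf => absurd hf.symm hk
      · rintro ⟨f, hf, rfl⟩
        exact hf
    rw [this]
    rfl

lemma Separated.exists_dart {Q : BlockHolePolyhedron.{u}} (hQ : Q.Separated) (v : Q.V) :
    ∃ d, Q.tail d = v ∧ Q.kind (Q.left d) ≠ .hole := by
  obtain ⟨d, rfl⟩ := Q.exists_tail_eq v
  by_cases hd : Q.kind (Q.left d) = .hole
  · refine ⟨Q.next (Q.rev d), Q.tail_rot d, fun h => ?_⟩
    have := hQ _ _ (Q.tail_rot d) h hd
    rw [Q.left_rot] at this
    exact Q.left_rev_ne d this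
  · exact ⟨d, rfl, hd⟩

lemma Separated.kind_left_or {Q : BlockHolePolyhedron.{u}} (hQ : Q.Separated) (d : Q.D) :
    Q.kind (Q.left d) ≠ .hole ∨ Q.kind (Q.left (Q.rev d)) ≠ .hole := by
  by_contra hcon
  push Not at hcon
  have := hQ _ _ (Q.tail_rot d) (by rw [Q.left_rot]; exact hcon.2) hcon.1
  rw [Q.left_rot] at this
  exact Q.left_rev_ne d this

theorem Separated.motionStructure_isRigid_iff {Q : BlockHolePolyhedron.{u}} (hQ : Q.Separated)
    {p : Q.V → Fin 3 → ℝ} (hp : IsGenericConfig p) :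
    (Q.motionStructure p).IsRigid ↔ Q.InfRigid {f | Q.kind f = .hole} p := by
  classical
  constructor
  · intro h m hm hf
    choose S hS using fun f : {f // Q.kind f ≠ .hole} => hf f.1 f.2
    have hrig := h S (by
      rintro ⟨d, h1, h2⟩
      refine SphericalPolyhedron.exists_smul_dartLine hp d ?_ ?_
      · rw [map_sub, sub_eq_zero]
        change velocity _ (S ⟨Q.left d, h1⟩) = velocity _ (S ⟨Q.left (Q.rev d), h2⟩)
        rw [hS ⟨Q.left d, h1⟩ d rfl, ← Q.tail_rot d, hS ⟨Q.left (Q.rev d), h2⟩ _ (Q.left_rot d)]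
      · rw [map_sub, sub_eq_zero]
        change velocity _ (S ⟨Q.left d, h1⟩) = velocity _ (S ⟨Q.left (Q.rev d), h2⟩)
        rw [hS ⟨Q.left (Q.rev d), h2⟩ (Q.rev d) rfl, ← Q.tail_next,
          hS ⟨Q.left d, h1⟩ _ (Q.left_next d)])
    obtain ⟨v₀⟩ : Nonempty Q.V := Fintype.card_pos_iff.1 (by have := Q.threeConnected.1; omega)
    obtain ⟨d₀, -, hd₀⟩ := hQ.exists_dart v₀
    refine ⟨S ⟨Q.left d₀, hd₀⟩, fun v => ?_⟩
    obtain ⟨d, rfl, hd⟩ := hQ.exists_dart v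
    rw [hrig ⟨Q.left d₀, hd₀⟩ ⟨Q.left d, hd⟩]
    exact hS _ d rfl
  · intro h S hS
    let T : Q.F → Fin 6 → ℝ := fun f => if hf : Q.kind f ≠ .hole then S ⟨f, hf⟩ else 0
    have hT : ∀ f (hf : Q.kind f ≠ .hole), T f = S ⟨f, hf⟩ := fun f hf => dif_pos hf
    have hinv : ∀ d e, Q.tail d = Q.tail e → Q.kind (Q.left d) ≠ .hole →
        Q.kind (Q.left e) ≠ .hole →
        velocity (p (Q.tail d)) (T (Q.left d)) = velocity (p (Q.tail e)) (T (Q.left e)) := by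
      intro d e hde hd he
      refine Equiv.Perm.SameCycle.apply_eq_of_invariant_off (f := Q.next * Q.rev)
        (fun x => velocity (p (Q.tail x)) (T (Q.left x))) (fun x => Q.kind (Q.left x) = .hole) d
        ?_ ?_ (Equiv.Perm.SameCycle.refl _ _) (Q.vertex_orbit d e hde) hd he
      · intro x y hx hy hbx hby
        have ht : Q.tail x = Q.tail y :=
          (hx.symm.trans hy).apply_eq_of_invariant Q.tail fun z => Q.tail_rot z
        exact Q.dart_eq_of_tail_left ht (hQ _ _ ht hbx hby)
      · intro x _ hx hy
        have hy' : Q.kind (Q.left (Q.rev x)) ≠ .hole := by rw [← Q.left_rot]; exact hy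
        rw [Equiv.Perm.mul_apply, Q.tail_rot, Q.left_rot, hT _ hx, hT _ hy']
        obtain ⟨w, hw⟩ := hS ⟨x, hx, hy'⟩
        change S ⟨Q.left x, hx⟩ - S ⟨Q.left (Q.rev x), hy'⟩ = w • Q.dartLine p x at hw
        symm
        rw [← sub_eq_zero, ← map_sub, hw, map_smul, SphericalPolyhedron.velocity_dartLine_tail,
          smul_zero]
    choose δ hδ hδ' using hQ.exists_dart
    obtain ⟨m, hm⟩ : ∃ m : Q.V → Fin 3 → ℝ, ∀ d, Q.kind (Q.left d) ≠ .hole →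
        m (Q.tail d) = velocity (p (Q.tail d)) (T (Q.left d)) :=
      ⟨fun v => velocity (p (Q.tail (δ v))) (T (Q.left (δ v))), fun d hd =>
        hinv _ _ (hδ _) (hδ' _) hd⟩
    have hedge : ∀ d, Q.kind (Q.left d) ≠ .hole →
        (p (Q.tail d) - p (Q.tail (Q.rev d))) ⬝ᵥ (m (Q.tail d) - m (Q.tail (Q.rev d))) = 0 := by
      intro d hd
      rw [← Q.tail_next, hm d hd, hm _ (by rwa [Q.left_next]), Q.left_next]
      exact velocity_dot _ _ _
    obtain ⟨U, hU⟩ := h m (fun d => by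
        rcases hQ.kind_left_or d with hd | hd
        · exact hedge d hd
        · have := hedge _ hd
          rw [Q.rev_rev] at this
          exact SphericalPolyhedron.dot_symm _ _ _ _ this)
      (fun f hf => ⟨T f, fun d hd => by rw [hm d (by rw [hd]; exact hf), hd]⟩)
    have key : ∀ f : {f // Q.kind f ≠ .hole}, S f = U := by
      rintro ⟨f, hf⟩
      refine SphericalPolyhedron.screw_eq_of_face hp (f := f) fun d hd => ?_
      subst hd
      rw [hU, hm d hf, hT _ hf]
    intro k l
    exact (key k).trans (key l).symm

theorem Separated.motionGenericallyRigid_iff {Q : BlockHolePolyhedron.{u}} (hQ : Q.Separated) :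
    Q.MotionGenericallyRigid ↔ Q.GenericallyInfRigid {f | Q.kind f = .hole} :=
  forall₂_congr fun _ hp => hQ.motionStructure_isRigid_iff hp

/-! Existence of a separated gusseting -/

lemma Gusseting.trans {P Q R : BlockHolePolyhedron.{u}} (h : P.Gusseting Q)
    (h' : Q.Gusseting R) : P.Gusseting R := by
  induction h' with
  | refl => exact h
  | step _ c hc ih => exact ih.step c hc

open Classical in
noncomputable def contactCorners (P : BlockHolePolyhedron.{u}) : Finset P.D :=
  Finset.univ.filter P.IsContactCorner

lemma mem_contactCorners {P : BlockHolePolyhedron.{u}} {d : P.D} :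
    d ∈ P.contactCorners ↔ P.IsContactCorner d := by
  simp [contactCorners]

lemma exists_of_isContactCorner_gusset {P : BlockHolePolyhedron.{u}} {c : P.D}
    {hc : P.IsContactCorner c} {x : (P.gusset c hc).D} (hx : (P.gusset c hc).IsContactCorner x) :
    ∃ d, d ≠ c ∧ P.IsContactCorner d ∧ P.gussetRepl c d = x := by
  classical
  have key : ∀ y : P.D ⊕ Fin 6, Sum.elim P.kind (fun _ => FaceKind.surface) (P.gussetLeft c y) ≠
      .surface → ∃ d, P.gussetRepl c d = y ∧ P.gussetLeft c y = Sum.inl (P.left d) ∧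
        P.gussetTail c y = if d = c then none else some (P.tail d) := by
    intro y hy
    rcases P.gusset_face_cases c y with ⟨h, -⟩ | ⟨h, -⟩ | ⟨d, rfl, h⟩
    · rw [h] at hy
      exact absurd rfl hy
    · rw [h] at hy
      exact absurd rfl hy
    · refine ⟨d, rfl, h, ?_⟩
      by_cases h1 : d = c
      · subst h1
        rw [P.gussetRepl_self, if_pos rfl]
        rfl
      rw [if_neg h1]
      by_cases h2 : d = P.next.symm c
      · subst h2
        rw [P.gussetRepl_symm]
        rfl
      · rw [P.gussetRepl_of_ne c h2 h1]
        rfl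
  obtain ⟨hx1, y, hy1, hy2, hy3⟩ := hx
  change Sum.elim P.kind (fun _ => FaceKind.surface) (P.gussetLeft c x) ≠ .surface at hx1
  change P.gussetTail c y = P.gussetTail c x at hy1
  change P.gussetLeft c y ≠ P.gussetLeft c x at hy2
  change Sum.elim P.kind (fun _ => FaceKind.surface) (P.gussetLeft c y) =
    Sum.elim P.kind (fun _ => FaceKind.surface) (P.gussetLeft c x) at hy3
  obtain ⟨d, hd1, hd2, hd3⟩ := key x hx1
  obtain ⟨e, he1, he2, he3⟩ := key y (by rwa [hy3])
  rw [hd3, he3] at hy1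
  rw [hd2, he2] at hy2 hy3
  rw [hd2] at hx1
  have hde : P.left e ≠ P.left d := fun h => hy2 (by rw [h])
  have hne : d ≠ c := by
    rintro rfl
    by_cases he : e = d
    · exact hde (by rw [he])
    · simp [he] at hy1
  have hne' : e ≠ c := by
    rintro rfl
    simp [hne] at hy1
  rw [if_neg hne, if_neg hne'] at hy1
  exact ⟨d, hne, ⟨hx1, e, Option.some_injective _ hy1, hde, hy3⟩, hd1⟩

lemma card_contactCorners_gusset_lt (P : BlockHolePolyhedron.{u}) (c : P.D)
    (hc : P.IsContactCorner c) :
    (P.gusset c hc).contactCorners.card < P.contactCorners.card := by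
  classical
  have h1 : (P.gusset c hc).contactCorners ⊆
      (P.contactCorners.erase c).image (P.gussetRepl c) := by
    intro x hx
    obtain ⟨d, hd, hd', rfl⟩ := exists_of_isContactCorner_gusset (mem_contactCorners.1 hx)
    exact Finset.mem_image.2 ⟨d, Finset.mem_erase.2 ⟨hd, mem_contactCorners.2 hd'⟩, rfl⟩
  exact ((Finset.card_le_card h1).trans Finset.card_image_le).trans_lt
    (Finset.card_erase_lt_of_mem (mem_contactCorners.2 hc))

theorem exists_separated_gusseting (P : BlockHolePolyhedron.{u}) :
    ∃ Q : BlockHolePolyhedron.{u}, P.Gusseting Q ∧ Q.Separated ∧ Q.swap.Separated := by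
  induction hn : P.contactCorners.card using Nat.strong_induction_on generalizing P with
  | _ n ih =>
    by_cases hex : ∃ c, P.IsContactCorner c
    · obtain ⟨c, hc⟩ := hex
      obtain ⟨Q, hQ, hQ'⟩ := ih _ (hn ▸ P.card_contactCorners_gusset_lt c hc) _ rfl
      exact ⟨Q, (Gusseting.refl.step c hc).trans hQ, hQ'⟩
    · push Not at hex
      refine ⟨P, .refl, fun d e h hd he => ?_, fun d e h hd he => ?_⟩
      · by_contra hne
        exact hex d ⟨by rw [hd]; simp, e, h.symm, Ne.symm hne, by rw [hd, he]⟩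
      · have hd' : P.kind (P.left d) = .block := by
          change (P.kind (P.left d)).swap = .hole at hd
          cases hk : P.kind (P.left d) <;> simp_all [FaceKind.swap]
        have he' : P.kind (P.left e) = .block := by
          change (P.kind (P.left e)).swap = .hole at he
          cases hk : P.kind (P.left e) <;> simp_all [FaceKind.swap]
        by_contra hne
        exact hex d ⟨by rw [hd']; simp, e, h.symm, Ne.symm hne, by rw [hd', he']⟩

end BlockHolePolyhedron

section Framework

variable {W : Type*} [Fintype W]

/-- The load along `f` through the point `x`. -/
def pointLoad (x : Fin 3 → ℝ) : (Fin 3 → ℝ) →ₗ[ℝ] (Fin 6 → ℝ) where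
  toFun f := join (homogDir f) (homog x)
  map_add' f g := by
    simp only [join_homogDir]
    ext i; fin_cases i <;> simp <;> ring
  map_smul' r f := by
    simp only [join_homogDir]
    ext i; fin_cases i <;> simp <;> ring

lemma pointLoad_apply (x f : Fin 3 → ℝ) : pointLoad x f = join (homogDir f) (homog x) := rfl

lemma pointLoad_sub (x y : Fin 3 → ℝ) : pointLoad x (x - y) = joinPts x y := by
  rw [pointLoad_apply, join_homogDir, joinPts_eq]
  ext i; fin_cases i <;> simp <;> ring

lemma pointLoad_injective (x : Fin 3 → ℝ) : Function.Injective (pointLoad x) := by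
  intro f g h
  rw [pointLoad_apply, pointLoad_apply, join_homogDir, join_homogDir] at h
  have h0 : f 0 = g 0 := congrFun h 0
  have h1 : f 1 = g 1 := congrFun h 1
  have h2 : f 2 = g 2 := congrFun h 2
  ext i; fin_cases i <;> assumption

/-- The work of a load on a screw. -/
def work (S : Fin 6 → ℝ) : (Fin 6 → ℝ) →ₗ[ℝ] ℝ where
  toFun L := -(S 0 * L 3 + S 1 * L 4 + S 2 * L 5 + S 3 * L 0 + S 4 * L 1 + S 5 * L 2)
  map_add' L M := by simp; ring
  map_smul' r L := by simp; ring

lemma dot_velocity (x f : Fin 3 → ℝ) (S : Fin 6 → ℝ) :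
    f ⬝ᵥ velocity x S = work S (pointLoad x f) := by
  rw [fin_three_dot, velocity_zero, velocity_one, velocity_two, pointLoad_apply, join_homogDir]
  simp [work]
  ring

lemma eq_zero_of_work_eq_zero {L : Fin 6 → ℝ} (h : ∀ S, work S L = 0) : L = 0 := by
  have := fun i => h (Pi.single i 1)
  simp only [work, LinearMap.coe_mk, AddHom.coe_mk] at this
  ext i
  fin_cases i
  · simpa using this 3
  · simpa using this 4
  · simpa using this 5
  · simpa using this 0
  · simpa using this 1
  · simpa using this 2

def IsInfinitesimallyRigid (G : SimpleGraph W) (p : W → Fin 3 → ℝ) : Prop :=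
  ∀ m : W → Fin 3 → ℝ, (∀ i j, G.Adj i j → (p i - p j) ⬝ᵥ (m i - m j) = 0) →
    ∃ S, ∀ i, velocity (p i) S = m i

open Classical in
lemma exists_dot_representation (φ : (W → Fin 3 → ℝ) →ₗ[ℝ] ℝ) :
    ∃ g : W → Fin 3 → ℝ, ∀ f, φ f = ∑ i, f i ⬝ᵥ g i := by
  refine ⟨fun i k => φ (Pi.single i (Pi.single k 1)), fun f => ?_⟩
  have h1 : f = ∑ i, ∑ k, f i k • (Pi.single i (Pi.single k 1) : W → Fin 3 → ℝ) := by
    ext i k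
    simp only [Finset.sum_apply, Pi.smul_apply, smul_eq_mul]
    rw [Finset.sum_eq_single i, Finset.sum_eq_single k]
    · simp
    · intro l _ hl
      simp [hl.symm]
    · simp
    · intro j _ hj
      simp [hj.symm]
    · simp
  conv_lhs => rw [h1]
  simp only [map_sum, map_smul, smul_eq_mul, dotProduct]

/-- The forces exerted by the bars on the joints. -/
def barForces (G : SimpleGraph W) (p : W → Fin 3 → ℝ) : Submodule ℝ (W → Fin 3 → ℝ) where
  carrier := {r | ∃ l, IsBarScalar G l ∧ ∀ i, r i = ∑ j, l i j • (p i - p j)}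
  add_mem' := by
    rintro a b ⟨l, ⟨hl, hl'⟩, ha⟩ ⟨k, ⟨hk, hk'⟩, hb⟩
    refine ⟨l + k, ⟨fun i j => ?_, fun i j hij => ?_⟩, fun i => ?_⟩
    · simp [hl i j, hk i j]
    · simp [hl' i j hij, hk' i j hij]
    · simp [ha, hb, add_smul, Finset.sum_add_distrib]
  zero_mem' := ⟨0, ⟨fun _ _ => rfl, fun _ _ _ => rfl⟩, fun i => by simp⟩
  smul_mem' := by
    rintro c a ⟨l, ⟨hl, hl'⟩, ha⟩
    refine ⟨c • l, ⟨fun i j => ?_, fun i j hij => ?_⟩, fun i => ?_⟩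
    · simp [hl i j]
    · simp [hl' i j hij]
    · simp [ha, Finset.smul_sum, smul_smul]

open Classical in
lemma bar_mem_barForces {G : SimpleGraph W} {p : W → Fin 3 → ℝ} {a b : W} (hab : G.Adj a b) :
    (Pi.single a (p a - p b) + Pi.single b (p b - p a) : W → Fin 3 → ℝ) ∈ barForces G p := by
  have hne := hab.ne
  refine ⟨fun i j => if (i = a ∧ j = b) ∨ (i = b ∧ j = a) then 1 else 0,
    ⟨fun i j => ?_, fun i j hij => ?_⟩, fun i => ?_⟩
  · exact if_congr (by tauto) rfl rfl
  · refine if_neg ?_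
    rintro (⟨rfl, rfl⟩ | ⟨rfl, rfl⟩)
    · exact hij hab
    · exact hij hab.symm
  · by_cases ha : i = a
    · subst ha
      rw [Finset.sum_eq_single b]
      · simp [hne]
      · intro j _ hj
        simp [hj, hne]
      · simp
    by_cases hb : i = b
    · subst hb
      rw [Finset.sum_eq_single a]
      · simp [hne.symm]
      · intro j _ hj
        simp [hj, hne.symm]
      · simp
    simp [ha, hb]

theorem isStaticallyRigid_iff (G : SimpleGraph W) (p : W → Fin 3 → ℝ) :
    IsStaticallyRigid G p ↔ IsInfinitesimallyRigid G p := by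
  classical
  constructor
  · intro h m hm
    let T : (Fin 6 → ℝ) →ₗ[ℝ] (W → Fin 3 → ℝ) := LinearMap.pi fun i => velocity (p i)
    by_contra hcon
    have hmT : m ∉ LinearMap.range T := by
      rintro ⟨S, hS⟩
      exact hcon ⟨S, fun i => congrFun hS i⟩
    obtain ⟨φ, hφ, hφT⟩ := Submodule.exists_le_ker_of_notMem hmT
    obtain ⟨f, hf⟩ := exists_dot_representation φ
    have hsum : ∑ i, pointLoad (p i) (f i) = 0 := by
      apply eq_zero_of_work_eq_zero
      intro S
      have h1 : φ (T S) = 0 := hφT ⟨S, rfl⟩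
      rw [hf] at h1
      rw [map_sum, ← h1]
      exact Finset.sum_congr rfl fun i _ => by rw [← dot_velocity, dotProduct_comm]; rfl
    obtain ⟨l, ⟨hl, hl'⟩, hlL⟩ := h (fun i => pointLoad (p i) (f i)) ⟨fun i => ⟨f i, rfl⟩, hsum⟩
    have hfl : ∀ i, f i = -∑ j, l i j • (p i - p j) := fun i => by
      apply pointLoad_injective (p i)
      rw [map_neg, map_sum, ← add_eq_zero_iff_eq_neg, ← hlL i]
      simp only [map_smul, pointLoad_sub]
    apply hφ
    rw [hf]
    have h2 : ∑ i, m i ⬝ᵥ f i = -∑ i, ∑ j, l i j * (m i ⬝ᵥ (p i - p j)) := by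
      rw [← Finset.sum_neg_distrib]
      refine Finset.sum_congr rfl fun i _ => ?_
      rw [hfl, dotProduct_neg, dotProduct_sum]
      simp only [dotProduct_smul, smul_eq_mul]
    have h3 : ∑ i, ∑ j, l i j * (m i ⬝ᵥ (p i - p j)) =
        -∑ i, ∑ j, l i j * (m i ⬝ᵥ (p i - p j)) := by
      conv_rhs => rw [Finset.sum_comm]
      rw [← Finset.sum_neg_distrib]
      refine Finset.sum_congr rfl fun i _ => ?_
      rw [← Finset.sum_neg_distrib]
      refine Finset.sum_congr rfl fun j _ => ?_
      by_cases hij : G.Adj i j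
      · have h4 := hm i j hij
        have h5 : m i ⬝ᵥ (p i - p j) + m j ⬝ᵥ (p j - p i) = 0 := by
          rw [← h4, dotProduct_comm (m i), dotProduct_comm (m j), dotProduct_sub, ← neg_sub (p i),
            neg_dotProduct]
          ring
        rw [hl j i]
        linear_combination l i j * h5
      · rw [hl' i j hij, hl' j i (fun h => hij h.symm)]
        simp
    rw [h2]
    linarith
  · intro h L ⟨hL, hsum⟩
    choose f hf using hL
    suffices hmem : f ∈ barForces G p by
      obtain ⟨l, ⟨hl, hl'⟩, hfl⟩ := hmem
      refine ⟨-l, ⟨fun i j => by simp [hl i j], fun i j hij => by simp [hl' i j hij]⟩, fun i => ?_⟩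
      rw [hf, ← pointLoad_apply, hfl, map_sum, ← Finset.sum_add_distrib]
      refine Finset.sum_eq_zero fun j _ => ?_
      rw [map_smul, pointLoad_sub]
      simp
    by_contra hcon
    obtain ⟨φ, hφ, hφR⟩ := Submodule.exists_le_ker_of_notMem hcon
    obtain ⟨m, hm⟩ := exists_dot_representation φ
    obtain ⟨S, hS⟩ := h m (fun i j hij => by
      have h1 : φ _ = 0 := hφR (bar_mem_barForces hij)
      rw [map_add, hm, hm, Finset.sum_eq_single i, Finset.sum_eq_single j] at h1
      · rw [Pi.single_eq_same, Pi.single_eq_same] at h1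
        rw [← h1, dotProduct_sub, ← neg_sub (p i) (p j), neg_dotProduct, sub_eq_add_neg]
      · intro k _ hk
        simp [hk]
      · simp
      · intro k _ hk
        simp [hk]
      · simp)
    apply hφ
    rw [hm]
    have h2 : ∑ i, f i ⬝ᵥ m i = work S (∑ i, L i) := by
      rw [map_sum]
      refine Finset.sum_congr rfl fun i _ => ?_
      rw [hf, ← pointLoad_apply, ← dot_velocity, hS]
    rw [h2, hsum, map_zero]

end Framework

namespace BlockHolePolyhedron

variable (P : BlockHolePolyhedron.{u}) (I : P.Filling)

/-- The inclusion of the joints of a subframework. -/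
def frameJoint (k : P.Block) :
    P.FaceVertex k.1 ⊕ Fin (I.added k) → P.V ⊕ Σ k : P.Block, Fin (I.added k) :=
  Sum.map Subtype.val fun x => ⟨k, x⟩

lemma frameJoint_injective (k : P.Block) : Function.Injective (P.frameJoint I k) :=
  Sum.map_injective.2 ⟨Subtype.val_injective, fun _ _ h => by simpa using h⟩

lemma map_adj_of_injective {V W : Type*} {f : V → W} (hf : Function.Injective f)
    (G : SimpleGraph V) (x y : W) :
    (G.map f).Adj x y ↔ ∃ a b, G.Adj a b ∧ f a = x ∧ f b = y :=
  SimpleGraph.map_adj ⟨f, hf⟩ G x y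

/-- Adjacency in the subframework of the face `f`. -/
def FrameAdj (f : P.F) (x y : P.V ⊕ Σ k : P.Block, Fin (I.added k)) : Prop :=
  ∃ (h : P.kind f = .block) (i j : P.FaceVertex f ⊕ Fin (I.added ⟨f, h⟩)),
    (I.frame ⟨f, h⟩).Adj i j ∧ P.frameJoint I ⟨f, h⟩ i = x ∧ P.frameJoint I ⟨f, h⟩ j = y

lemma staticGraph_adj_iff {x y : P.V ⊕ Σ k : P.Block, Fin (I.added k)} :
    (P.staticGraph I).Adj x y ↔
      (∃ d, Sum.inl (P.tail d) = x ∧ Sum.inl (P.tail (P.rev d)) = y) ∨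
        ∃ f, P.FrameAdj I f x y := by
  rw [staticGraph, SimpleGraph.sup_adj, SimpleGraph.iSup_adj]
  refine or_congr ?_ ?_
  · rw [map_adj_of_injective Sum.inl_injective]
    constructor
    · rintro ⟨a, b, hab, rfl, rfl⟩
      obtain ⟨-, ⟨d, rfl, rfl⟩ | ⟨d, rfl, rfl⟩⟩ := (SimpleGraph.fromRel_adj _ _ _).1 hab
      · exact ⟨d, rfl, rfl⟩
      · exact ⟨P.rev d, rfl, by rw [P.rev_rev]⟩
    · rintro ⟨d, rfl, rfl⟩
      exact ⟨_, _, SphericalPolyhedron.adj_of_dart P.tail_rev_ne d, rfl, rfl⟩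
  · constructor
    · rintro ⟨k, hk⟩
      obtain ⟨i, j, hij, hi, hj⟩ := (map_adj_of_injective (P.frameJoint_injective I k) _ _ _).1 hk
      exact ⟨k.1, k.2, i, j, hij, hi, hj⟩
    · rintro ⟨f, h, i, j, hij, hi, hj⟩
      exact ⟨⟨f, h⟩, (map_adj_of_injective (P.frameJoint_injective I _) _ _ _).2 ⟨i, j, hij, hi, hj⟩⟩

end BlockHolePolyhedron

namespace BlockHolePolyhedron

variable (P : BlockHolePolyhedron.{u}) (I : P.Filling)

variable {P I}

lemma FrameAdj.symm {f : P.F} {x y : P.V ⊕ Σ k : P.Block, Fin (I.added k)}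
    (h : P.FrameAdj I f x y) : P.FrameAdj I f y x := by
  obtain ⟨h, i, j, hij, hi, hj⟩ := h
  exact ⟨h, j, i, hij.symm, hj, hi⟩

lemma FrameAdj.exists_dart {f : P.F} {a : P.V} {y : P.V ⊕ Σ k : P.Block, Fin (I.added k)}
    (h : P.FrameAdj I f (Sum.inl a) y) : ∃ d, P.left d = f ∧ P.tail d = a := by
  obtain ⟨h, i | i, j, hij, hi, hj⟩ := h
  · obtain ⟨d, hd, hd'⟩ := i.2
    exact ⟨d, hd, hd'.trans (Sum.inl_injective hi)⟩
  · cases hi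

lemma FrameAdj.block_eq {f : P.F} {s : Σ k : P.Block, Fin (I.added k)}
    {y : P.V ⊕ Σ k : P.Block, Fin (I.added k)} (h : P.FrameAdj I f (Sum.inr s) y) : f = s.1.1 := by
  obtain ⟨h, i | i, j, hij, hi, hj⟩ := h
  · cases hi
  · rw [← Sum.inr_injective hi]

lemma FrameAdj.ne {f : P.F} {x y : P.V ⊕ Σ k : P.Block, Fin (I.added k)}
    (h : P.FrameAdj I f x y) : x ≠ y := by
  obtain ⟨h, i, j, hij, rfl, rfl⟩ := h
  exact (P.frameJoint_injective I _).ne hij.ne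

lemma frameAdj_dart {d : P.D} (h : P.kind (P.left d) = .block) :
    P.FrameAdj I (P.left d) (Sum.inl (P.tail d)) (Sum.inl (P.tail (P.rev d))) :=
  ⟨h, Sum.inl ⟨P.tail d, d, rfl, rfl⟩,
    Sum.inl ⟨P.tail (P.rev d), P.next d, P.left_next d, P.tail_next d⟩,
    I.polygon ⟨_, h⟩ _ _ ⟨d, rfl, rfl, rfl⟩, rfl, rfl⟩

/-- A bar of a subframework that is also an edge lies on the boundary polygon. -/
lemma FrameAdj.left_eq_or {f : P.F} {d : P.D}
    (h : P.FrameAdj I f (Sum.inl (P.tail d)) (Sum.inl (P.tail (P.rev d)))) :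
    P.left d = f ∨ P.left (P.rev d) = f := by
  obtain ⟨x, rfl, hx⟩ := h.exists_dart
  obtain ⟨x', hx', hx''⟩ := h.symm.exists_dart
  exact P.left_eq_or_of_chord hx'.symm hx.symm hx''.symm

/-- Two subframeworks share only edges of the polyhedron. -/
lemma FrameAdj.exists_dart_of_ne {f g : P.F} {x y : P.V ⊕ Σ k : P.Block, Fin (I.added k)}
    (hf : P.FrameAdj I f x y) (hg : P.FrameAdj I g x y) (hfg : f ≠ g) :
    ∃ d, Sum.inl (P.tail d) = x ∧ Sum.inl (P.tail (P.rev d)) = y := by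
  rcases x with a | s
  · rcases y with b | s
    · obtain ⟨x, hx, hxa⟩ := hf.exists_dart
      obtain ⟨x', hx', hxb⟩ := hf.symm.exists_dart
      obtain ⟨y, hy, hya⟩ := hg.exists_dart
      obtain ⟨y', hy', hyb⟩ := hg.symm.exists_dart
      have hab : a ≠ b := fun h => hf.ne (by rw [h])
      obtain ⟨d, hd1, hd2, -⟩ := P.exists_dart_of_two_faces (hx.trans hx'.symm)
        (hy.trans hy'.symm) (by rwa [hx, hy]) (hxa.trans hya.symm) (hxb.trans hyb.symm)
        (by rwa [hxa, hxb])
      exact ⟨d, by rw [hd1, hxa], by rw [hd2, hxb]⟩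
    · exact absurd (hf.symm.block_eq.trans hg.symm.block_eq.symm) hfg
  · exact absurd (hf.block_eq.trans hg.block_eq.symm) hfg

/-! Rigidity of the static framework -/

lemma isInfinitesimallyRigid_frame {q : (P.V ⊕ Σ k : P.Block, Fin (I.added k)) → Fin 3 → ℝ}
    (hq : IsGenericConfig q) (k : P.Block) :
    IsInfinitesimallyRigid (I.frame k) (q ∘ P.frameJoint I k) :=
  (isStaticallyRigid_iff _ _).1 (I.isostatic k _ (hq.comp (P.frameJoint_injective I k))).2

theorem isStaticallyRigid_staticGraph_iff
    {q : (P.V ⊕ Σ k : P.Block, Fin (I.added k)) → Fin 3 → ℝ} (hq : IsGenericConfig q) :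
    IsStaticallyRigid (P.staticGraph I) q ↔ P.InfRigid {f | P.kind f = .hole} (q ∘ Sum.inl) := by
  rw [isStaticallyRigid_iff]
  have hp : IsGenericConfig (q ∘ Sum.inl : P.V → Fin 3 → ℝ) := hq.comp Sum.inl_injective
  constructor
  · intro h m hm hf
    have hS : ∀ k : P.Block, ∃ S, ∀ d, P.left d = k.1 →
        velocity (q (Sum.inl (P.tail d))) S = m (P.tail d) := fun k =>
      hf k.1 (by
        change P.kind k.1 ≠ .hole
        rw [k.2]
        simp)
    choose S hS using hS
    let M : (P.V ⊕ Σ k : P.Block, Fin (I.added k)) → Fin 3 → ℝ :=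
      Sum.elim m fun s => velocity (q (Sum.inr s)) (S s.1)
    obtain ⟨T, hT⟩ := h M (by
      intro x y hxy
      rcases (P.staticGraph_adj_iff I).1 hxy with ⟨d, rfl, rfl⟩ | ⟨f, hf, i, j, -, rfl, rfl⟩
      · exact hm d
      · have key : ∀ i, M (P.frameJoint I ⟨f, hf⟩ i) =
            velocity (q (P.frameJoint I ⟨f, hf⟩ i)) (S ⟨f, hf⟩) := by
          rintro (⟨a, d, hd, rfl⟩ | i)
          · exact (hS ⟨f, hf⟩ d hd).symm
          · rfl
        rw [key, key]
        exact velocity_dot _ _ _)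
    exact ⟨T, fun v => hT (Sum.inl v)⟩
  · intro h M hM
    have hframe : ∀ k : P.Block, ∃ S, ∀ i, velocity (q (P.frameJoint I k i)) S =
        M (P.frameJoint I k i) := fun k =>
      isInfinitesimallyRigid_frame hq k (M ∘ P.frameJoint I k) fun i j hij =>
        hM _ _ ((P.staticGraph_adj_iff I).2 (Or.inr ⟨k.1, k.2, i, j, hij, rfl, rfl⟩))
    choose S hS using hframe
    have hSd : ∀ (k : P.Block) d, P.left d = k.1 →
        velocity (q (Sum.inl (P.tail d))) (S k) = M (Sum.inl (P.tail d)) := fun k d hd =>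
      hS k (Sum.inl ⟨P.tail d, d, hd, rfl⟩)
    have hedge : ∀ d, (q (Sum.inl (P.tail d)) - q (Sum.inl (P.tail (P.rev d)))) ⬝ᵥ
        (M (Sum.inl (P.tail d)) - M (Sum.inl (P.tail (P.rev d)))) = 0 := fun d =>
      hM _ _ ((P.staticGraph_adj_iff I).2 (Or.inl ⟨d, rfl, rfl⟩))
    obtain ⟨T, hT⟩ := h (M ∘ Sum.inl) hedge (fun f hf => by
      cases hk : P.kind f with
      | hole => exact absurd hk hf
      | block => exact ⟨S ⟨f, hk⟩, hSd ⟨f, hk⟩⟩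
      | surface =>
        obtain ⟨d, rfl⟩ := P.left_surjective f
        have h3 := P.surface_triangle d hk
        have e1 := hedge d
        have e2 := hedge (P.next d)
        have e3 := hedge (P.next (P.next d))
        rw [← P.tail_next] at e1
        rw [← P.tail_next (P.next d)] at e2
        rw [← P.tail_next (P.next (P.next d)), h3] at e3
        obtain ⟨S, h1, h2, h3⟩ := exists_screw_of_three
          (SphericalPolyhedron.nonCollinear_face hp d) e1
          (SphericalPolyhedron.dot_symm _ _ _ _ e3) e2
        refine ⟨S, fun e he => ?_⟩
        obtain ⟨n, rfl⟩ := (P.face_orbit d e he.symm).exists_nat_pow_eq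
        clear he
        have key : ∀ n : ℕ, (P.next ^ n) d = d ∨ (P.next ^ n) d = P.next d ∨
            (P.next ^ n) d = P.next (P.next d) := by
          intro n
          induction n with
          | zero => exact Or.inl rfl
          | succ n ih =>
            rw [pow_succ', Equiv.Perm.mul_apply]
            rcases ih with h | h | h
            · exact Or.inr (Or.inl (by rw [h]))
            · exact Or.inr (Or.inr (by rw [h]))
            · exact Or.inl (by rw [h, P.surface_triangle d hk])
        rcases key n with h | h | h
        · rw [h]; exact h1
        · rw [h]; exact h2
        · rw [h]; exact h3)
    refine ⟨T, ?_⟩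
    rintro (v | ⟨k, x⟩)
    · exact hT v
    · have : S k = T := SphericalPolyhedron.screw_eq_of_face hp (f := k.1) fun d hd =>
        (hSd k d hd).trans (hT _).symm
      rw [← this]
      exact hS k (Sum.inr x)

/-! Independence of the static framework -/

open Classical in
lemma sum_eq_sum_face {M : Type*} [AddCommMonoid M] (f : P.F) (g : P.V → M)
    (hg : ∀ v, (∀ d, P.left d = f → P.tail d ≠ v) → g v = 0) :
    ∑ v, g v = ∑ d with P.left d = f, g (P.tail d) := by
  symm
  refine Finset.sum_of_injOn P.tail (fun d hd e he h => ?_) (fun _ _ => by simp)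
    (fun v _ hv => hg v fun d hd hdv => hv ⟨d, by simpa using hd, hdv⟩) (fun _ _ => rfl)
  simp only [Finset.coe_filter, Finset.mem_univ, true_and, Set.mem_ofPred_eq] at hd he
  exact P.dart_eq_of_tail_left h (hd.trans he.symm)

open Classical in
lemma sum_eq_sum_vertex {M : Type*} [AddCommMonoid M] (v : P.V) (g : P.F → M)
    (hg : ∀ f, (∀ d, P.tail d = v → P.left d ≠ f) → g f = 0) :
    ∑ f, g f = ∑ d with P.tail d = v, g (P.left d) := by
  symm
  refine Finset.sum_of_injOn P.left (fun d hd e he h => ?_) (fun _ _ => by simp)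
    (fun f _ hf => hg f fun d hd hdf => hf ⟨d, by simpa using hd, hdf⟩) (fun _ _ => rfl)
  simp only [Finset.coe_filter, Finset.mem_univ, true_and, Set.mem_ofPred_eq] at hd he
  exact P.dart_eq_of_tail_left (hd.trans he.symm) h

variable {q : (P.V ⊕ Σ k : P.Block, Fin (I.added k)) → Fin 3 → ℝ}

/-- The resultant at `x` of the bar forces given by `ν`. -/
noncomputable def resultant (q : (P.V ⊕ Σ k : P.Block, Fin (I.added k)) → Fin 3 → ℝ)
    (ν : (P.V ⊕ Σ k : P.Block, Fin (I.added k)) → (P.V ⊕ Σ k : P.Block, Fin (I.added k)) → ℝ)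
    (x : P.V ⊕ Σ k : P.Block, Fin (I.added k)) : Fin 6 → ℝ :=
  ∑ y, ν x y • joinPts (q x) (q y)

lemma velocity_resultant (ν) (x : P.V ⊕ Σ k : P.Block, Fin (I.added k)) :
    velocity (q x) (resultant q ν x) = 0 := by
  rw [resultant, map_sum]
  exact Finset.sum_eq_zero fun y _ => by rw [map_smul, velocity_joinPts_left, smul_zero]

lemma sum_resultant {ν} (hν : ∀ x y, ν x y = ν y x) :
    ∑ x : P.V ⊕ Σ k : P.Block, Fin (I.added k), resultant q ν x = 0 := by
  have h : ∑ x, resultant q ν x = -∑ x, resultant q ν x := by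
    simp only [resultant]
    conv_rhs => rw [Finset.sum_comm]
    rw [← Finset.sum_neg_distrib]
    refine Finset.sum_congr rfl fun x _ => ?_
    rw [← Finset.sum_neg_distrib]
    exact Finset.sum_congr rfl fun y _ => by rw [joinPts_swap, smul_neg, hν]
  ext i
  have := congrFun h i
  simp only [Pi.neg_apply] at this
  simp only [Pi.zero_apply]
  linarith

lemma resultant_frameJoint (k : P.Block) {ν} (hν : ∀ x y, ν x y ≠ 0 → P.FrameAdj I k.1 x y)
    (i : P.FaceVertex k.1 ⊕ Fin (I.added k)) :
    resultant q ν (P.frameJoint I k i) = ∑ j, ν (P.frameJoint I k i) (P.frameJoint I k j) •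
      joinPts (q (P.frameJoint I k i)) (q (P.frameJoint I k j)) := by
  symm
  refine Fintype.sum_of_injective (P.frameJoint I k) (P.frameJoint_injective I k) _ _ ?_
    (fun j => rfl)
  intro y hy
  by_cases h : ν (P.frameJoint I k i) y = 0
  · rw [h, zero_smul]
  · obtain ⟨_, _, j, -, -, hj⟩ := hν _ _ h
    exact absurd ⟨j, hj⟩ hy

lemma frame_independent (hq : IsGenericConfig q) (f : P.F) {ν}
    (hsymm : ∀ x y, ν x y = ν y x) (hν : ∀ x y, ν x y ≠ 0 → P.FrameAdj I f x y)
    (heq : ∀ x, resultant q ν x = 0) : ν = 0 := by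
  by_cases hk : P.kind f = .block
  · have h := (I.isostatic ⟨f, hk⟩ _ (hq.comp (P.frameJoint_injective I ⟨f, hk⟩))).1
      (fun i j => ν (P.frameJoint I ⟨f, hk⟩ i) (P.frameJoint I ⟨f, hk⟩ j))
      ⟨⟨fun i j => hsymm _ _, fun i j hij => by
        by_contra hne
        obtain ⟨_, i', j', hij', hi, hj⟩ := hν _ _ hne
        rw [P.frameJoint_injective I _ hi, P.frameJoint_injective I _ hj] at hij'
        exact hij hij'⟩, fun i => by
        rw [← heq (P.frameJoint I ⟨f, hk⟩ i)]
        exact (resultant_frameJoint ⟨f, hk⟩ hν i).symm⟩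
    ext x y
    by_contra hne
    obtain ⟨_, i, j, -, rfl, rfl⟩ := hν _ _ hne
    exact hne (congrFun (congrFun h i) j)
  · ext x y
    by_contra hne
    exact hk (hν _ _ hne).1

open Classical in
lemma exists_frame_resolution (hq : IsGenericConfig q) (f : P.F) (hk : P.kind f = .block)
    (L : P.D → Fin 6 → ℝ) (hL : ∀ d, velocity (q (Sum.inl (P.tail d))) (L d) = 0)
    (hsum : ∑ d with P.left d = f, L d = 0) :
    ∃ ν, (∀ x y, ν x y = ν y x) ∧ (∀ x y, ν x y ≠ 0 → P.FrameAdj I f x y) ∧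
      (∀ d, P.left d = f → resultant q ν (Sum.inl (P.tail d)) = L d) ∧
      ∀ s, resultant q ν (Sum.inr s) = 0 := by
  have hδ : ∀ a : P.FaceVertex f, ∃ d, P.left d = f ∧ P.tail d = a := fun a => a.2
  choose δ hδ hδ' using hδ
  have hδd : ∀ d (hd : P.left d = f), δ ⟨P.tail d, d, hd, rfl⟩ = d := fun d hd =>
    P.dart_eq_of_tail_left (hδ' _) ((hδ _).trans hd.symm)
  set φ := P.frameJoint I ⟨f, hk⟩ with hφ
  have hφi : Function.Injective φ := P.frameJoint_injective I ⟨f, hk⟩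
  obtain ⟨l, ⟨hl, hl'⟩, hlL⟩ :=
    (I.isostatic ⟨f, hk⟩ _ (hq.comp (P.frameJoint_injective I ⟨f, hk⟩))).2
    (Sum.elim (fun a => -L (δ a)) fun _ => 0) ⟨by
      rintro (a | x)
      · apply (velocity_eq_zero_iff _ _).1
        have := hL (δ a)
        rw [hδ'] at this
        change velocity (q (Sum.inl a.1)) (-L (δ a)) = 0
        rw [map_neg, this, neg_zero]
      · exact (velocity_eq_zero_iff _ _).1 (map_zero _), by
      rw [Fintype.sum_sum_type]
      simp only [Sum.elim_inl, Sum.elim_inr, Finset.sum_const_zero, add_zero]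
      rw [Finset.sum_neg_distrib, neg_eq_zero, ← hsum]
      refine Finset.sum_of_injOn δ (fun a _ b _ h => ?_) (fun a _ => by simp [hδ a])
        (fun d hd hd' => absurd ⟨_, by simp, hδd d (by simpa using hd)⟩ hd') (fun _ _ => rfl)
      exact Subtype.ext ((hδ' a).symm.trans ((congrArg P.tail h).trans (hδ' b)))⟩
  let ν := fun x y => Function.extend φ (fun i => Function.extend φ (l i) 0 y) 0 x
  have hνφ : ∀ i j, ν (φ i) (φ j) = l i j := fun i j => by
    simp only [ν]
    rw [hφi.extend_apply, hφi.extend_apply]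
  have hν : ∀ x y, ν x y ≠ 0 → ∃ i j, φ i = x ∧ φ j = y := by
    intro x y hxy
    by_cases hx : ∃ i, φ i = x
    · obtain ⟨i, rfl⟩ := hx
      by_cases hy : ∃ j, φ j = y
      · obtain ⟨j, rfl⟩ := hy
        exact ⟨i, j, rfl, rfl⟩
      · refine absurd ?_ hxy
        simp only [ν]
        rw [hφi.extend_apply, Function.extend_apply' _ _ _ hy]
        rfl
    · refine absurd ?_ hxy
      simp only [ν]
      rw [Function.extend_apply' _ _ _ hx]
      rfl
  have hadj : ∀ x y, ν x y ≠ 0 → P.FrameAdj I f x y := by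
    intro x y hxy
    obtain ⟨i, j, rfl, rfl⟩ := hν x y hxy
    rw [hνφ] at hxy
    exact ⟨hk, i, j, by_contra fun h => hxy (hl' i j h), rfl, rfl⟩
  have hres : ∀ i, resultant q ν (φ i) = Sum.elim (fun a => L (δ a)) (fun _ => 0) i := fun i => by
    have h1 := hlL i
    rw [resultant_frameJoint ⟨f, hk⟩ hadj i]
    simp only [← hφ, hνφ]
    rw [add_comm, add_eq_zero_iff_eq_neg] at h1
    refine h1.trans ?_
    rcases i with a | x
    · exact neg_neg _
    · exact neg_zero
  refine ⟨ν, fun x y => ?_, hadj, fun d hd => ?_, fun s => ?_⟩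
  · by_cases hxy : ν x y = 0
    · by_contra hne
      obtain ⟨i, j, rfl, rfl⟩ := hν y x fun h => hne (hxy.trans h.symm)
      exact hne (by rw [hνφ, hνφ, hl])
    · obtain ⟨i, j, rfl, rfl⟩ := hν x y hxy
      rw [hνφ, hνφ, hl]
  · have := hres (Sum.inl ⟨P.tail d, d, hd, rfl⟩)
    rw [Sum.elim_inl, hδd d hd] at this
    exact this
  · by_cases hs : ∃ i, φ i = Sum.inr s
    · obtain ⟨i | i, hi⟩ := hs
      · cases hi
      · rw [← hi, hres]
        rfl
    · refine Finset.sum_eq_zero fun y _ => ?_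
      by_cases h : ν (Sum.inr s) y = 0
      · rw [h, zero_smul]
      · obtain ⟨i, -, hi, -⟩ := hν _ _ h
        exact absurd ⟨i, hi⟩ hs

end BlockHolePolyhedron

namespace BlockHolePolyhedron

variable {P : BlockHolePolyhedron.{u}} {I : P.Filling}

open Classical in
/-- Scalars on the darts as scalars on pairs of joints. -/
noncomputable def edgeScalar (l : P.D → ℝ) (x y : P.V ⊕ Σ k : P.Block, Fin (I.added k)) : ℝ :=
  ∑ d, if Sum.inl (P.tail d) = x ∧ Sum.inl (P.tail (P.rev d)) = y then l d else 0

lemma edgeScalar_dart (l : P.D → ℝ) (d : P.D) :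
    edgeScalar (I := I) l (Sum.inl (P.tail d)) (Sum.inl (P.tail (P.rev d))) = l d := by
  rw [edgeScalar, Finset.sum_eq_single d]
  · exact if_pos ⟨rfl, rfl⟩
  · intro e _ he
    refine if_neg fun h => he ?_
    exact P.dart_ext _ _ (Sum.inl_injective h.1) (Sum.inl_injective h.2)
  · simp

lemma exists_dart_of_edgeScalar {l : P.D → ℝ} {x y : P.V ⊕ Σ k : P.Block, Fin (I.added k)}
    (h : edgeScalar l x y ≠ 0) :
    ∃ d, Sum.inl (P.tail d) = x ∧ Sum.inl (P.tail (P.rev d)) = y ∧ l d ≠ 0 := by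
  obtain ⟨d, -, hd⟩ := Finset.exists_ne_zero_of_sum_ne_zero h
  split_ifs at hd with h1
  · exact ⟨d, h1.1, h1.2, hd⟩
  · exact absurd rfl hd

lemma edgeScalar_symm {l : P.D → ℝ} (hl : ∀ d, l (P.rev d) = l d)
    (x y : P.V ⊕ Σ k : P.Block, Fin (I.added k)) : edgeScalar l x y = edgeScalar l y x := by
  classical
  rw [edgeScalar, edgeScalar, ← Equiv.sum_comp P.rev]
  refine Finset.sum_congr rfl fun d _ => ?_
  rw [P.rev_rev, hl]
  exact if_congr and_comm rfl rfl

variable {q : (P.V ⊕ Σ k : P.Block, Fin (I.added k)) → Fin 3 → ℝ}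

open Classical in
lemma resultant_edgeScalar (l : P.D → ℝ) (x : P.V ⊕ Σ k : P.Block, Fin (I.added k)) :
    resultant q (edgeScalar l) x =
      ∑ d, if Sum.inl (P.tail d) = x then l d • P.dartLine (q ∘ Sum.inl) d else 0 := by
  simp only [resultant, edgeScalar, Finset.sum_smul]
  rw [Finset.sum_comm]
  refine Finset.sum_congr rfl fun d _ => ?_
  by_cases hx : Sum.inl (P.tail d) = x
  · subst hx
    rw [Finset.sum_eq_single (Sum.inl (P.tail (P.rev d)))]
    · simp
      rfl
    · intro y _ hy
      simp [hy.symm]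
    · simp
  · simp [hx]

lemma resultant_edgeScalar_inr (l : P.D → ℝ) (s : Σ k : P.Block, Fin (I.added k)) :
    resultant q (edgeScalar l) (Sum.inr s) = 0 := by
  rw [resultant_edgeScalar]
  simp

open Classical in
lemma resultant_edgeScalar_inl (l : P.D → ℝ) (v : P.V) :
    resultant q (edgeScalar l) (Sum.inl v) =
      ∑ d with P.tail d = v, l d • P.dartLine (q ∘ Sum.inl) d := by
  rw [resultant_edgeScalar, Finset.sum_filter]
  simp

lemma resultant_add (ν ν' : (P.V ⊕ Σ k : P.Block, Fin (I.added k)) →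
    (P.V ⊕ Σ k : P.Block, Fin (I.added k)) → ℝ) (x) :
    resultant q (fun x y => ν x y + ν' x y) x = resultant q ν x + resultant q ν' x := by
  simp only [resultant, add_smul, Finset.sum_add_distrib]

lemma resultant_sub (ν ν' : (P.V ⊕ Σ k : P.Block, Fin (I.added k)) →
    (P.V ⊕ Σ k : P.Block, Fin (I.added k)) → ℝ) (x) :
    resultant q (fun x y => ν x y - ν' x y) x = resultant q ν x - resultant q ν' x := by
  simp only [resultant, sub_smul, Finset.sum_sub_distrib]

lemma resultant_sum (ν : P.F → (P.V ⊕ Σ k : P.Block, Fin (I.added k)) →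
    (P.V ⊕ Σ k : P.Block, Fin (I.added k)) → ℝ) (x) :
    resultant q (fun x y => ∑ f, ν f x y) x = ∑ f, resultant q (ν f) x := by
  simp only [resultant, Finset.sum_smul]
  rw [Finset.sum_comm]

lemma resultant_eq_zero {ν : (P.V ⊕ Σ k : P.Block, Fin (I.added k)) →
    (P.V ⊕ Σ k : P.Block, Fin (I.added k)) → ℝ} {f : P.F}
    (hν : ∀ x y, ν x y ≠ 0 → P.FrameAdj I f x y) {x : P.V ⊕ Σ k : P.Block, Fin (I.added k)}
    (hx : ∀ y, ¬ P.FrameAdj I f x y) : resultant q ν x = 0 :=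
  Finset.sum_eq_zero fun y _ => by
    have : ν x y = 0 := by_contra fun h => hx y (hν x y h)
    rw [this, zero_smul]

open Classical in
/-- The forces at a vertex are those of its edges and those of the subframeworks around it. -/
lemma resultant_decomposition (l : P.D → ℝ)
    {ν : P.F → (P.V ⊕ Σ k : P.Block, Fin (I.added k)) →
      (P.V ⊕ Σ k : P.Block, Fin (I.added k)) → ℝ}
    (hν : ∀ f x y, ν f x y ≠ 0 → P.FrameAdj I f x y) (v : P.V) :
    resultant q (fun x y => edgeScalar l x y + ∑ f, ν f x y) (Sum.inl v) =
      ∑ d with P.tail d = v, (l d • P.dartLine (q ∘ Sum.inl) d +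
        resultant q (ν (P.left d)) (Sum.inl (P.tail d))) := by
  rw [resultant_add, resultant_edgeScalar_inl, resultant_sum, Finset.sum_add_distrib,
    sum_eq_sum_vertex v]
  · congr 1
    exact Finset.sum_congr rfl fun d hd => by rw [(Finset.mem_filter.1 hd).2]
  · intro f hf
    refine resultant_eq_zero (hν f) fun y hy => ?_
    obtain ⟨d, hd, hd'⟩ := hy.exists_dart
    exact hf d hd' hd

theorem stressFree_of_isIndependent (hq : IsGenericConfig q)
    (h : IsIndependent (P.staticGraph I) q) :
    P.StressFree {f | P.kind f = .block} (q ∘ Sum.inl) := by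
  classical
  intro l L hl hL hL0 hLf hLv
  obtain ⟨ν, hνs, hνa, hνd, hνr⟩ : ∃ ν : P.F → (P.V ⊕ Σ k : P.Block, Fin (I.added k)) →
      (P.V ⊕ Σ k : P.Block, Fin (I.added k)) → ℝ, (∀ f x y, ν f x y = ν f y x) ∧
      (∀ f x y, ν f x y ≠ 0 → P.FrameAdj I f x y) ∧
      (∀ d, resultant q (ν (P.left d)) (Sum.inl (P.tail d)) = L d) ∧
      ∀ f s, resultant q (ν f) (Sum.inr s) = 0 := by
    have hex : ∀ f, ∃ ν : (P.V ⊕ Σ k : P.Block, Fin (I.added k)) →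
        (P.V ⊕ Σ k : P.Block, Fin (I.added k)) → ℝ, (∀ x y, ν x y = ν y x) ∧
        (∀ x y, ν x y ≠ 0 → P.FrameAdj I f x y) ∧
        (∀ d, P.left d = f → resultant q ν (Sum.inl (P.tail d)) = L d) ∧
        ∀ s, resultant q ν (Sum.inr s) = 0 := by
      intro f
      by_cases hk : P.kind f = .block
      · exact exists_frame_resolution hq f hk L hL (hLf f)
      · refine ⟨0, fun _ _ => rfl, fun _ _ h => absurd rfl h, fun d hd => ?_, fun s => ?_⟩
        · rw [hL0 d (by rw [hd]; exact hk)]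
          simp [resultant]
        · simp [resultant]
    choose ν h1 h2 h3 h4 using hex
    exact ⟨ν, h1, h2, fun d => h3 _ d rfl, h4⟩
  have hzero := h (fun x y => edgeScalar l x y + ∑ f, ν f x y) ⟨⟨fun x y => by
      dsimp only
      rw [edgeScalar_symm hl, Finset.sum_congr rfl fun f _ => hνs f x y], fun x y hxy => by
      dsimp only
      rw [staticGraph_adj_iff, not_or] at hxy
      have h1 : edgeScalar l x y = 0 := by
        by_contra hne
        obtain ⟨d, hd, hd', -⟩ := exists_dart_of_edgeScalar hne
        exact hxy.1 ⟨d, hd, hd'⟩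
      rw [h1, zero_add]
      refine Finset.sum_eq_zero fun f _ => ?_
      by_contra hne
      exact hxy.2 ⟨f, hνa f x y hne⟩⟩, fun x => by
      change resultant q (fun x y => edgeScalar l x y + ∑ f, ν f x y) x = 0
      rcases x with v | s
      · rw [resultant_decomposition l hνa, ← hLv v]
        simp only [hνd]
      · rw [resultant_add, resultant_edgeScalar_inr, resultant_sum, zero_add]
        exact Finset.sum_eq_zero fun f _ => hνr f s⟩
  replace hzero : ∀ x y, edgeScalar l x y + ∑ f, ν f x y = 0 :=
    fun x y => congrFun (congrFun hzero x) y
  have hpoly : ∀ f x y, ν f x y ≠ 0 →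
      ∃ d, Sum.inl (P.tail d) = x ∧ Sum.inl (P.tail (P.rev d)) = y := by
    intro f x y hne
    by_contra hcon
    have h1 : edgeScalar l x y = 0 := by
      by_contra hne
      obtain ⟨d, hd, hd', -⟩ := exists_dart_of_edgeScalar hne
      exact hcon ⟨d, hd, hd'⟩
    have h2 := hzero x y
    rw [h1, zero_add, Finset.sum_eq_single f] at h2
    · exact hne h2
    · intro g _ hg
      by_contra hne'
      exact hcon ((hνa f x y hne).exists_dart_of_ne (hνa g x y hne') hg.symm)
    · simp
  refine ⟨fun d => ν (P.left d) (Sum.inl (P.tail d)) (Sum.inl (P.tail (P.rev d))), fun d hd => ?_,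
    fun d => ?_, fun d => ?_⟩
  · by_contra hne
    exact hd (hνa _ _ _ hne).1
  · rw [← hνd, P.left_next, resultant, Fintype.sum_eq_add
      (Sum.inl (P.tail (P.rev (P.next d)))) (Sum.inl (P.tail d))]
    · rw [sub_eq_add_neg]
      congr 1
      · dsimp only
        rw [P.left_next]
        rfl
      · dsimp only
        rw [P.tail_next, hνs, joinPts_swap, smul_neg]
        rfl
    · exact fun h => P.tail_rev_next_ne d (Sum.inl_injective h)
    · rintro y ⟨hy1, hy2⟩
      by_contra hne
      have hne' : ν (P.left d) (Sum.inl (P.tail (P.next d))) y ≠ 0 := fun h =>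
        hne (by rw [h, zero_smul])
      obtain ⟨e, he, rfl⟩ := hpoly _ _ _ hne'
      have hadj := hνa _ _ _ hne'
      rw [← he] at hadj
      replace he := Sum.inl_injective he
      rcases hadj.left_eq_or with h1 | h1
      · have : e = P.next d := P.dart_eq_of_tail_left he (by rw [h1, P.left_next])
        exact hy1 (by rw [this])
      · have : P.next (P.rev e) = P.next d := P.dart_eq_of_tail_left
          ((P.tail_rot e).trans he) (by rw [P.left_rot, h1, P.left_next])
        exact hy2 (by rw [P.next.injective this])
  · have h1 := hzero (Sum.inl (P.tail d)) (Sum.inl (P.tail (P.rev d)))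
    rw [edgeScalar_dart, Fintype.sum_eq_add (P.left d) (P.left (P.rev d))
      (P.left_rev_ne d).symm] at h1
    · dsimp only
      rw [P.rev_rev, add_assoc, hνs (P.left (P.rev d))]
      exact h1
    · rintro f ⟨hf1, hf2⟩
      by_contra hne
      rcases (hνa _ _ _ hne).left_eq_or with h2 | h2
      · exact hf1 h2.symm
      · exact hf2 h2.symm

theorem isIndependent_of_stressFree (hq : IsGenericConfig q)
    (h : P.StressFree {f | P.kind f = .block} (q ∘ Sum.inl)) :
    IsIndependent (P.staticGraph I) q := by
  classical
  rintro Λ ⟨⟨hΛs, hΛa⟩, hΛ⟩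
  let l : P.D → ℝ := fun d => Λ (Sum.inl (P.tail d)) (Sum.inl (P.tail (P.rev d)))
  let E : (P.V ⊕ Σ k : P.Block, Fin (I.added k)) → (P.V ⊕ Σ k : P.Block, Fin (I.added k)) → Prop :=
    fun x y => ∃ d, Sum.inl (P.tail d) = x ∧ Sum.inl (P.tail (P.rev d)) = y
  have hEs : ∀ x y, E x y → E y x := by
    rintro x y ⟨d, hd, hd'⟩
    exact ⟨P.rev d, hd', by rwa [P.rev_rev]⟩
  let ν : P.F → (P.V ⊕ Σ k : P.Block, Fin (I.added k)) →
      (P.V ⊕ Σ k : P.Block, Fin (I.added k)) → ℝ :=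
    fun f x y => if P.FrameAdj I f x y ∧ ¬ E x y then Λ x y else 0
  have hνs : ∀ f x y, ν f x y = ν f y x := fun f x y => by
    simp only [ν]
    rw [hΛs x y]
    exact if_congr (and_congr ⟨fun h => h.symm, fun h => h.symm⟩
      (not_congr ⟨hEs _ _, hEs _ _⟩)) rfl rfl
  have hνa : ∀ f x y, ν f x y ≠ 0 → P.FrameAdj I f x y := fun f x y hne =>
    by_contra fun h => hne (if_neg fun h' => h h'.1)
  have hνE : ∀ f x y, E x y → ν f x y = 0 := fun f x y hE => if_neg fun h => h.2 hE
  have hl : ∀ d, l (P.rev d) = l d := fun d => by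
    simp only [l]
    rw [P.rev_rev, hΛs]
  have hdec : Λ = fun x y => edgeScalar l x y + ∑ f, ν f x y := by
    ext x y
    by_cases hE : E x y
    · rw [Finset.sum_eq_zero fun f _ => hνE f x y hE, add_zero]
      obtain ⟨d, rfl, rfl⟩ := hE
      rw [edgeScalar_dart]
    · have h1 : edgeScalar l x y = 0 := by
        by_contra hne
        obtain ⟨d, hd, hd', -⟩ := exists_dart_of_edgeScalar hne
        exact hE ⟨d, hd, hd'⟩
      rw [h1, zero_add]
      by_cases hf : ∃ f, P.FrameAdj I f x y
      · obtain ⟨f, hf⟩ := hf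
        rw [Finset.sum_eq_single f]
        · exact (if_pos ⟨hf, hE⟩).symm
        · intro g _ hg
          exact if_neg fun h => hE (hf.exists_dart_of_ne h.1 hg.symm)
        · simp
      · rw [hΛa x y fun h => ((P.staticGraph_adj_iff I).1 h).elim hE hf,
          Finset.sum_eq_zero fun f _ => if_neg fun h => hf ⟨f, h.1⟩]
  have hνr : ∀ f s, resultant q (ν f) (Sum.inr s) = 0 := by
    intro f s
    by_cases hs : f = s.1.1
    · rw [← hΛ (Sum.inr s)]
      refine Finset.sum_congr rfl fun y _ => ?_
      rw [hdec]
      dsimp only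
      have h1 : edgeScalar l (Sum.inr s) y = 0 := by
        by_contra hne
        obtain ⟨d, hd, -⟩ := exists_dart_of_edgeScalar hne
        cases hd
      rw [h1, zero_add, Finset.sum_eq_single f]
      · intro g _ hg
        by_contra hne
        exact hg ((hνa _ _ _ hne).block_eq.trans hs.symm)
      · simp
    · exact resultant_eq_zero (hνa f) fun y hy => hs hy.block_eq
  have hLv : ∀ v, ∑ d with P.tail d = v, (l d • P.dartLine (q ∘ Sum.inl) d +
      resultant q (ν (P.left d)) (Sum.inl (P.tail d))) = 0 := fun v => by
    rw [← resultant_decomposition l hνa, ← hdec]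
    exact hΛ (Sum.inl v)
  obtain ⟨μ, hμ0, hμ1, hμ2⟩ := h l
    (fun d => resultant q (ν (P.left d)) (Sum.inl (P.tail d))) hl
    (fun d => velocity_resultant _ _)
    (fun d hd => resultant_eq_zero (hνa _) fun y hy => hd hy.1)
    (fun f => by
      have h1 := sum_resultant (q := q) (hνs f)
      rw [Fintype.sum_sum_type, Finset.sum_eq_zero (s := Finset.univ)
        (f := fun s => resultant q (ν f) (Sum.inr s)) fun s _ => hνr f s, add_zero,
        sum_eq_sum_face f] at h1
      · rw [← h1]
        exact Finset.sum_congr rfl fun d hd => by rw [(Finset.mem_filter.1 hd).2]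
      · intro v hv
        refine resultant_eq_zero (hνa f) fun y hy => ?_
        obtain ⟨d, hd, hd'⟩ := hy.exists_dart
        exact hv d hd hd') hLv
  let m : P.F → P.D → ℝ := fun f d =>
    (if P.left d = f then μ d else 0) + if P.left (P.rev d) = f then μ (P.rev d) else 0
  have hm : ∀ f d, m f (P.rev d) = m f d := fun f d => by
    simp only [m]
    rw [P.rev_rev, add_comm]
  have hκ : ∀ f, (fun x y => ν f x y - edgeScalar (m f) x y) = 0 := by
    intro f
    refine frame_independent hq f (fun x y => ?_) (fun x y hne => ?_) (fun x => ?_)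
    · rw [hνs, edgeScalar_symm (hm f)]
    · by_cases h1 : ν f x y = 0
      · rw [h1, zero_sub, neg_ne_zero] at hne
        obtain ⟨d, rfl, rfl, hd⟩ := exists_dart_of_edgeScalar hne
        have key : ∀ e, P.left e = f → μ e ≠ 0 → P.FrameAdj I f (Sum.inl (P.tail e))
            (Sum.inl (P.tail (P.rev e))) := by
          rintro e rfl hμe
          exact frameAdj_dart (by_contra fun h => hμe (hμ0 e h))
        simp only [m] at hd
        by_cases h2 : P.left d = f ∧ μ d ≠ 0
        · exact key d h2.1 h2.2
        · have h3 : (if P.left d = f then μ d else 0) = 0 := by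
            split_ifs with h4
            · by_contra h5
              exact h2 ⟨h4, h5⟩
            · rfl
          rw [h3, zero_add] at hd
          split_ifs at hd with h4
          · have := key (P.rev d) h4 hd
            rw [P.rev_rev] at this
            exact this.symm
          · exact absurd rfl hd
      · exact hνa f x y h1
    · rw [resultant_sub, sub_eq_zero]
      rcases x with v | s
      · rw [resultant_edgeScalar_inl]
        by_cases hv : ∃ e, P.left e = f ∧ P.tail (P.next e) = v
        · obtain ⟨e, rfl, rfl⟩ := hv
          have h1 := hμ1 e
          rw [P.left_next] at h1
          rw [h1]
          simp only [m, add_smul]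
          rw [Finset.sum_add_distrib, Finset.sum_eq_single (P.next e),
            Finset.sum_eq_single (P.rev e)]
          · rw [P.rev_rev, if_pos (P.left_next e), if_pos rfl, SphericalPolyhedron.dartLine_rev,
              smul_neg, sub_eq_add_neg]
          · intro d hd hde
            rw [if_neg, zero_smul]
            intro hl
            apply hde
            have : P.next (P.rev d) = P.next e := P.dart_eq_of_tail_left
              ((P.tail_rot d).trans (Finset.mem_filter.1 hd).2) (by rw [P.left_rot, hl, P.left_next])
            rw [← P.next.injective this, P.rev_rev]
          · intro hd
            simp [P.tail_next] at hd
          · intro d hd hde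
            rw [if_neg, zero_smul]
            intro hl
            exact hde (P.dart_eq_of_tail_left (Finset.mem_filter.1 hd).2
              (by rw [hl, P.left_next]))
          · intro hd
            simp at hd
        · rw [resultant_eq_zero (hνa f), Finset.sum_eq_zero]
          · intro d hd
            have hdv := (Finset.mem_filter.1 hd).2
            simp only [m]
            rw [if_neg, if_neg, add_zero, zero_smul]
            · exact fun h => hv ⟨P.rev d, h, (P.tail_rot d).trans hdv⟩
            · exact fun h => hv ⟨P.next.symm d, (P.left_symm d).trans h, by
                rw [Equiv.apply_symm_apply, hdv]⟩
          · intro y hy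
            obtain ⟨d, hd, hd'⟩ := hy.exists_dart
            exact hv ⟨P.next.symm d, (P.left_symm d).trans hd, by
              rw [Equiv.apply_symm_apply, hd']⟩
      · rw [hνr, resultant_edgeScalar_inr]
  have hν0 : ∀ f x y, ν f x y = edgeScalar (m f) x y := fun f x y =>
    sub_eq_zero.1 (congrFun (congrFun (hκ f) x) y)
  have hμ : ∀ d, μ d = 0 := fun d => by
    have h1 := hν0 (P.left d) (Sum.inl (P.tail d)) (Sum.inl (P.tail (P.rev d)))
    rw [hνE _ _ _ ⟨d, rfl, rfl⟩, edgeScalar_dart] at h1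
    simp only [m] at h1
    rw [if_true, if_neg (P.left_rev_ne d), add_zero] at h1
    exact h1.symm
  have hl0 : ∀ d, l d = 0 := fun d => by
    have := hμ2 d
    rw [hμ, hμ] at this
    simpa using this
  rw [hdec]
  ext x y
  simp only [hν0, m, hμ, edgeScalar, hl0]
  simp

theorem isIndependent_staticGraph_iff (hq : IsGenericConfig q) :
    IsIndependent (P.staticGraph I) q ↔ P.InfRigid {f | P.kind f = .block} (q ∘ Sum.inl) := by
  rw [← SphericalPolyhedron.stressFree_iff_infRigid (hq.comp Sum.inl_injective)]
  exact ⟨stressFree_of_isIndependent hq, isIndependent_of_stressFree hq⟩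

/-- A property of the configurations of the vertices that holds generically holds at the vertices of
a generic configuration with added vertices, and conversely. -/
lemma forall_generic_comp_iff {V W : Type*} [Finite W] {f : V → W} (hf : Function.Injective f)
    (C : (V → Fin 3 → ℝ) → Prop) :
    (∀ q : W → Fin 3 → ℝ, IsGenericConfig q → C (q ∘ f)) ↔
      ∀ p : V → Fin 3 → ℝ, IsGenericConfig p → C p := by
  constructor
  · intro h p hp
    obtain ⟨q, hq, hqp⟩ := hp.exists_extension hf
    have := h q hq
    rwa [show q ∘ f = p from funext hqp] at this
  · exact fun h q hq => h _ (hq.comp hf)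

theorem genericallyIndependent_iff (P : BlockHolePolyhedron.{u}) (I : P.Filling) :
    GenericallyIndependent (P.staticGraph I) ↔
      P.GenericallyInfRigid {f | P.kind f = .block} := by
  refine Iff.trans ?_ (forall_generic_comp_iff
    (Sum.inl_injective (β := Σ k : P.Block, Fin (I.added k))) _)
  exact forall₂_congr fun q hq => isIndependent_staticGraph_iff hq

theorem genericallyIsostatic_iff (P : BlockHolePolyhedron.{u}) (I : P.Filling) :
    GenericallyIsostatic (P.staticGraph I) ↔
      P.GenericallyInfRigid {f | P.kind f = .block} ∧
        P.GenericallyInfRigid {f | P.kind f = .hole} := by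
  rw [← genericallyIndependent_iff P I]
  have : P.GenericallyInfRigid {f | P.kind f = .hole} ↔
      ∀ q : (P.V ⊕ Σ k : P.Block, Fin (I.added k)) → Fin 3 → ℝ, IsGenericConfig q →
        IsStaticallyRigid (P.staticGraph I) q := by
    refine Iff.trans (forall_generic_comp_iff
      (Sum.inl_injective (β := Σ k : P.Block, Fin (I.added k))) _).symm ?_
    exact forall₂_congr fun q hq => (isStaticallyRigid_staticGraph_iff hq).symm
  rw [this]
  exact ⟨fun h => ⟨fun q hq => (h q hq).1, fun q hq => (h q hq).2⟩,
    fun h q hq => ⟨h.1 q hq, h.2 q hq⟩⟩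

lemma swap_kind_block (P : BlockHolePolyhedron.{u}) :
    {f | P.swap.kind f = .block} = {f | P.kind f = .hole} := by
  ext f
  change (P.kind f).swap = .block ↔ P.kind f = .hole
  cases P.kind f <;> simp [FaceKind.swap]

lemma swap_kind_hole (P : BlockHolePolyhedron.{u}) :
    {f | P.swap.kind f = .hole} = {f | P.kind f = .block} := by
  ext f
  change (P.kind f).swap = .hole ↔ P.kind f = .block
  cases P.kind f <;> simp [FaceKind.swap]

end BlockHolePolyhedron

theorem corollary4p9 (P : BlockHolePolyhedron.{u}) :
    (∃ Q : BlockHolePolyhedron.{u}, P.Gusseting Q ∧ Q.Separated ∧ Q.swap.Separated) ∧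
    ∀ (I : P.Filling) (J : P.swap.Filling),
      (∀ Q : BlockHolePolyhedron.{u}, P.Gusseting Q → Q.Separated →
        (Q.MotionGenericallyRigid ↔ GenericallyIndependent (P.swap.staticGraph J))) ∧
      (∀ Q : BlockHolePolyhedron.{u}, P.Gusseting Q → Q.swap.Separated →
        (GenericallyIsostatic (P.staticGraph I) ↔
          Q.swap.MotionGenericallyRigid ∧ GenericallyIndependent (P.swap.staticGraph J))) ∧
      (GenericallyIsostatic (P.staticGraph I) ↔
        GenericallyIsostatic (P.swap.staticGraph J)) := by
  refine ⟨P.exists_separated_gusseting, fun I J => ?_⟩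
  have hJ : GenericallyIndependent (P.swap.staticGraph J) ↔
      P.GenericallyInfRigid {f | P.kind f = .hole} := by
    rw [BlockHolePolyhedron.genericallyIndependent_iff, P.swap_kind_block]
    rfl
  refine ⟨fun Q hQ hs => ?_, fun Q hQ hs => ?_, ?_⟩
  · rw [hs.motionGenericallyRigid_iff, hJ]
    exact hQ.genericallyInfRigid_iff (by simp)
  · rw [hs.motionGenericallyRigid_iff, hJ, BlockHolePolyhedron.genericallyIsostatic_iff,
      Q.swap_kind_hole, ← hQ.genericallyInfRigid_iff (k := .block) (by simp)]
    rfl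
  · rw [BlockHolePolyhedron.genericallyIsostatic_iff, BlockHolePolyhedron.genericallyIsostatic_iff,
      P.swap_kind_hole, P.swap_kind_block, and_comm]
    rfl
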